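/- **Setting.** Let $\mathbb T^3=\mathbb R^3/\mathbb Z^3$ (unit volume) with coordinates $x=(x',z)=(x_1,x_2,z)$, and write $f=\sum_{k\in2\pi\mathbb Z^3}\hat f_k e^{ik\cdot x}$. Let $A=|\nabla|$ be the Fourier multiplier with symbol $|k|$. For $0<s\le1$, $\sigma>0$ and $r>0$ put $$\|f\|_{\mathcal G^{\sigma,s}_r}=\Big(\sum_{k\in 2\pi\mathbb Z^3}\big(1+e^{2r|k|^s}|k|^{2\sigma s}\big)|\hat f_k|^2\Big)^{1/2},\qquad \mathcal G^{\sigma,s}_r=\{f:\|f\|_{\mathcal G^{\sigma,s}_r}<\infty\}.$$ Let $\bar f(x')=\int_0^1 f(x',z)\,dz$, $\tilde f=f-\bar f$, $\nabla_h=(\partial_{x_1},\partial_{x_2})$, and let $H$ be the space of fields $f\in L^2(\mathbb T^3;\mathbb R^2)$ that have mean zero, are even in $z$, and satisfy $\nabla_h\cdot\bar f=0$. Let $\mathcal P\varphi=\tilde\varphi+\bar\varphi-\nabla_h\Delta_h^{-1}\nabla_h\cdot\bar\varphi$ be the hydrostatic Leray projection, and $$Q(V,V)=V\cdot\nabla_hV+w(V)\,\partial_zV,\qquad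 w(V)(x',z)=-\int_0^z\nabla_h\cdot V(x',\tilde z)\,d\tilde z .$$ Let $\Omega=\{\omega\in C([0,\infty);\mathbb R):\omega(0)=0\}$, $W_t(\omega)=\omega(t)$, $\Gamma(t)=e^{-\nu W_tA^s}$ and $$\Omega_{\alpha,\beta,\nu}=\{\omega\in\Omega:\ \alpha+\beta t-\nu W_t\ge0\ \text{ for all }t\ge0\}.$$ Consider, for a fixed path $\omega$, the random PDE $$\partial_tU+\mathcal P\,\Gamma\,Q(\Gamma^{-1}U,\Gamma^{-1}U)=-\tfrac12\nu^2A^{2s}U,\qquad U(0)=U_0, \tag{1}$$ understood in the sense of distributions in $x$ (each Fourier coefficient satisfies the equation at every $t\ge 0$). For $r:[0,\infty)\to(0,\infty)$, $U\in C([0,\infty);\mathcal G^{\sigma,s}_r)$ means that $U(t)\in H\cap\mathcal G^{\sigma,s}_{r(t)}$ for every $t\ge0$, that $t\mapsto U(t)$ is continuous into $L^2$, and that $t\mapsto e^{r(t)A^s}U(t)$ is continuous into $\dot H^{\sigma s}$. **Proposition.** Let $s\in(\frac45,1]$ and $\sigma\in(\frac8{5s},2)$. There is a constant $C^*>0$ depending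 only on $\sigma$ and $s$ such that the following holds. Let $\nu>0$, $\alpha>0$, $0<\beta<\frac{\nu^2}2$, $\eta>0$, put $\phi(t)=\alpha+\beta t$, and let $U_0\in H\cap\mathcal G^{\sigma,s}_{\alpha+\eta}$ satisfy $$\|U_0\|_{\mathcal G^{\sigma,s}_{\alpha+\eta}}<\frac1{C^*}\Big(\frac{\nu^2}2-\beta\Big).$$ Then for every $\omega\in\Omega_{\alpha,\beta,\nu}$ equation (1) has a unique global solution $U$ in $C([0,\infty);\mathcal G^{\sigma,s}_{\phi+\eta})$. Moreover, $t\mapsto\|U(t)\|_{\mathcal G^{\sigma,s}_{\phi(t)+\eta}}$ is decreasing (that is, non-increasing) on $[0,\infty)$. -/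

import Mathlib

open MeasureTheory
open scoped NNReal

noncomputable section

namespace HydrostaticEuler

/-! ### Fourier analysis on the torus `𝕋³ = ℝ³/ℤ³` of unit volume

The coordinates `0, 1` are horizontal, the coordinate `2` is vertical. The frequency `k ∈ 2πℤ³` is
written as `k = 2πn` with `n ∈ ℤ³`. -/

/-- The torus `ℝ³/ℤ³`. -/
abbrev Torus : Type := UnitAddTorus (Fin 3)

/-- The normalized Lebesgue measure of the torus. -/
abbrev torusMeasure : Measure Torus := Measure.pi fun _ => AddCircle.haarAddCircle

/-- `L²(𝕋³; ℝ²)`, the horizontal vector fields. -/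
abbrev HField : Type := Fin 2 → Lp ℝ 2 torusMeasure

/-- The Fourier coefficient `f̂_k = ∫ e^{-ik·x} f(x) dx`, at `k = 2πn`. -/
def coef (f : Torus → ℝ) (n : Fin 3 → ℤ) : ℂ :=
  ∫ x, UnitAddTorus.mFourier (-n) x * (f x : ℂ) ∂torusMeasure

/-- The Fourier coefficient `Û_k ∈ ℂ²` of a horizontal field, at `k = 2πn`. -/
def vcoef (U : HField) (n : Fin 3 → ℤ) : Fin 2 → ℂ := fun i => coef (U i) n

/-- `|k|` for `k = 2πn`. -/
def freqNorm (n : Fin 3 → ℤ) : ℝ := 2 * Real.pi * Real.sqrt (∑ j, (n j : ℝ) ^ 2)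

/-- `|c|²` for `c ∈ ℂ²`. -/
def normSq2 (c : Fin 2 → ℂ) : ℝ := ∑ i, ‖c i‖ ^ 2

/-- `V = m(D) U`: the field `V` is the image of `U` under the Fourier multiplier with symbol `m`.
Since Fourier coefficients determine an `L²` field, there is at most one such `V`. -/
def IsMultiplierImage (m : (Fin 3 → ℤ) → ℂ) (U V : HField) : Prop :=
  ∀ n i, vcoef V n i = m n * vcoef U n i

/-- `D = ∂_j V` in the weak sense on the torus (tested against all `e^{-ik·x}`). -/
def IsWeakPartial (j : Fin 3) (V D : HField) : Prop :=
  IsMultiplierImage (fun n => 2 * Real.pi * Complex.I * (n j : ℂ)) V D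

/-! ### Gevrey classes -/

/-- The `k`-th term of `‖U‖²` in the Gevrey class `𝒢_r^{σ,s}`:
`(1 + e^{2r|k|^s} |k|^{2σs}) |Û_k|²`. -/
def gevreyTerm (σ s r : ℝ) (U : HField) (n : Fin 3 → ℤ) : ℝ :=
  (1 + Real.exp (2 * r * freqNorm n ^ s) * freqNorm n ^ (2 * σ * s)) * normSq2 (vcoef U n)

/-- `U ∈ 𝒢_r^{σ,s}`, i.e. `‖U‖_{𝒢_r^{σ,s}} < ∞`; for `r ≥ 0` this contains `U ∈ H^{σs}`. -/
def MemGevrey (σ s r : ℝ) (U : HField) : Prop := Summable (gevreyTerm σ s r U)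

/-- The norm of `𝒢_r^{σ,s}`. -/
def gevreyNorm (σ s r : ℝ) (U : HField) : ℝ := Real.sqrt (∑' n, gevreyTerm σ s r U n)

/-- `‖e^{r₁A^s} U₁ - e^{r₂A^s} U₂‖²_{Ḣ^{σs}} + ‖U₁ - U₂‖²_{L²}` with `A = |∇|`, the squared distance
between `U₁ ∈ 𝒢_{r₁}^{σ,s}` and `U₂ ∈ 𝒢_{r₂}^{σ,s}`. -/
def gevreyDistSq (σ s r₁ r₂ : ℝ) (U₁ U₂ : HField) : ℝ :=
  ∑' n, (normSq2 (vcoef U₁ n - vcoef U₂ n) + freqNorm n ^ (2 * σ * s) *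
    normSq2 (fun i => (Real.exp (r₁ * freqNorm n ^ s) : ℂ) * vcoef U₁ n i -
      (Real.exp (r₂ * freqNorm n ^ s) : ℂ) * vcoef U₂ n i))

/-! ### The state space -/

/-- The barotropic part `f̄(x') = ∫₀¹ f(x', z) dz`, as a function on `𝕋³` independent of `z`. -/
def barotropic (f : Torus → ℝ) : Torus → ℝ :=
  fun x => ∫ ζ : UnitAddCircle, f (Function.update x 2 ζ) ∂AddCircle.haarAddCircle

/-- The fields in `H` with the symmetry of the boundary conditions: mean zero,
`∇_h · Ū = 0` (weakly, tested against all `e^{-ik·x}`), and `U` even in `z`. -/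
structure MemH (U : HField) : Prop where
  mean_zero : ∀ i, ∫ x, U i x ∂torusMeasure = 0
  div_free : ∀ n : Fin 3 → ℤ,
    ∑ i : Fin 2, 2 * Real.pi * Complex.I * (n i.castSucc : ℂ) * coef (barotropic (U i)) n = 0
  even : ∀ i, ∀ᵐ x ∂torusMeasure, U i (Function.update x 2 (-(x 2))) = U i x

/-- `U ∈ C([0,∞); H ∩ 𝒢_r^{σ,s})` with time-dependent radius `r(t)`: `U(t) ∈ H ∩ 𝒢_{r(t)}^{σ,s}` for
all `t ≥ 0`, and `t ↦ U(t)`, `t ↦ e^{r(t)A^s}U(t)` are continuous in `L²` and `Ḣ^{σs}`. -/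
structure MemCGevrey (σ s : ℝ) (r : ℝ≥0 → ℝ) (U : ℝ≥0 → HField) : Prop where
  mem_H : ∀ t, MemH (U t)
  mem_gevrey : ∀ t, MemGevrey σ s (r t) (U t)
  continuous : ∀ t₀, Filter.Tendsto (fun t => gevreyDistSq σ s (r t) (r t₀) (U t) (U t₀))
    (nhds t₀) (nhds 0)

/-! ### The nonlinearity -/

/-- `w(x', z) = -∫₀ᶻ d(x', ζ) dζ` for `z ∈ [0,1)`; with `d = ∇_h · V` this is the vertical velocity
`w(V)`. -/
def vertical (d : Torus → ℝ) (x : Torus) : ℝ :=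
  -∫ ζ in (0 : ℝ)..(AddCircle.equivIco (1 : ℝ) 0 (x 2) : ℝ),
    d (Function.update x 2 (ζ : UnitAddCircle))

/-- The `i`-th component of `Q(V,V) = V·∇_h V + w(V) ∂_z V`, where `D j = ∂_j V`. -/
def advection (V : HField) (D : Fin 3 → HField) (i : Fin 2) : Torus → ℝ :=
  fun x => ∑ j : Fin 2, V j x * D j.castSucc i x +
    vertical (fun y => ∑ j : Fin 2, D j.castSucc j y) x * D 2 i x

/-- The symbol of the hydrostatic Leray projection
`𝒫φ = φ̃ + φ̄ - ∇_h Δ_h⁻¹ ∇_h · φ̄` at `k = 2πn`. The modes with `n₂ = 0` are those of `φ̄`; the mean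
(`n = 0`, where the fraction is `0/0 = 0`) is left unchanged. -/
def leray (n : Fin 3 → ℤ) (c : Fin 2 → ℂ) : Fin 2 → ℂ := fun i =>
  if n 2 = 0 then
    c i - (n i.castSucc : ℂ) * (∑ j : Fin 2, (n j.castSucc : ℂ) * c j) /
      (∑ j : Fin 2, (n j.castSucc : ℂ) ^ 2)
  else c i

/-! ### Sample paths and the random PDE -/

/-- The canonical Wiener space `Ω = {ω ∈ C([0,∞); ℝ) : ω(0) = 0}`; the Brownian motion is the
coordinate process `W_t(ω) = ω(t)`. -/
abbrev WienerSpace : Type := {ω : C(ℝ≥0, ℝ) // ω 0 = 0}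

/-- `Ω_{α,β,ν} = {ω : α + βt - νW_t ≥ 0 for all t ≥ 0}`. -/
def goodPaths (α β ν : ℝ) : Set WienerSpace :=
  {ω | ∀ t : ℝ≥0, 0 ≤ α + β * t - ν * ω.1 t}

/-- `U` solves `∂ₜU + 𝒫ΓQ(Γ⁻¹U, Γ⁻¹U) = -½ν²|∇|^{2s}U` on `[0,∞)`, where `Γ(t) = e^{-νW_t|∇|^s}`,
along the path `ω`. Here `V = Γ(t)⁻¹U(t)`, and the equation holds in the sense of distributions in
space: each Fourier coefficient satisfies it, with a one-sided time derivative at `t = 0`. -/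
def SolvesRandomPDE (ν s : ℝ) (ω : WienerSpace) (U : ℝ≥0 → HField) : Prop :=
  ∀ t : ℝ≥0, ∃ (V : HField) (D : Fin 3 → HField),
    IsMultiplierImage (fun n => (Real.exp (ν * ω.1 t * freqNorm n ^ s) : ℂ)) (U t) V ∧
    (∀ j, IsWeakPartial j V (D j)) ∧
    (∀ i, Integrable (advection V D i) torusMeasure) ∧
    ∀ n i, HasDerivWithinAt (fun τ : ℝ => vcoef (U τ.toNNReal) n i)
      (-(leray n (fun l => (Real.exp (-(ν * ω.1 t * freqNorm n ^ s)) : ℂ) *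
          coef (advection V D l) n) i) -
        1 / 2 * (ν : ℂ) ^ 2 * ((freqNorm n ^ (2 * s) : ℝ) : ℂ) * vcoef (U t) n i)
      (Set.Ici 0) (t : ℝ)

/-- `U` is a global solution along the path `ω`, with initial value `U₀`, in the class
`C([0,∞); H ∩ 𝒢_r^{σ,s})`. -/
structure IsGlobalSolution (ν σ s : ℝ) (r : ℝ≥0 → ℝ) (ω : WienerSpace) (U₀ : HField)
    (U : ℝ≥0 → HField) : Prop where
  initial : U 0 = U₀
  mem : MemCGevrey σ s r U
  solves : SolvesRandomPDE ν s ω U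

end HydrostaticEuler

end

noncomputable section

namespace HydrostaticEuler

open scoped ENNReal BoundedContinuousFunction ComplexConjugate
open UnitAddTorus (mFourier)

/-! ### Frequencies -/

/-! The argument runs on Fourier coefficients. Write `r(t) = φ(t) + η`, `a = σs` and `Z_k = |k|^a
e^{r|k|^s} Û_k`. Differentiating the exponential costs `β|k|^s`, so (1) becomes `Z_k' = -rate_k Z_k
- |k|^a B_k(Z,Z)` with `rate_k = ν²|k|^{2s}/2 - β|k|^s ≥ κ|k|^{2s}` and `κ = ν²/2 - β`. The noise
thus produces a dissipation of order `2s`, which pays for the growing radius and for the derivative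
lost in the hydrostatic nonlinearity. No cancellation in the transport term is used for the
estimates.

The passage from `U` to `Γ⁻¹U` replaces the radius `r` by `ρ = r - νW`, and `ρ ≥ η > 0` on a good
path. Since `|k|^s ≤ |j|^s + |k-j|^s`, the exponentials in `B` combine to a factor at most `1`. What
is left of the interaction of `j` and `l = k - j` is bounded by twice `|j|^{-8/5} |l|^{-3/5} (1 +
|j|/|j_2|)`, the last factor coming from the vertical velocity (`norm_nlTerm_le`). This kernel is
square summable in `j` uniformly in `k`, because the singular part is summed separately over the
vertical and the two horizontal directions (`kernel_sq_le`). By Cauchy–Schwarz `B` is bounded on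
`ℓ²` (`tsum_conv_sq_le`).

Existence: as `a < 2s`, Duhamel's formula absorbs `|k|^a` uniformly in time, and small data give a
fixed point in the space with norm `(∑ sup_t |Z_k(t)|²)^{1/2}`, on the whole half-line at once. The
fixed point is sought in the closed set of families with the symmetries of `H`.

Monotonicity: the squared Gevrey norm is `∑ p_k(t)|Z_k|²` with weights `p_k` in `[1,2]` that
decrease in time. Splitting `|k|^a = |k|^s |k|^{a-s}` bounds the nonlinear contribution by a
multiple of `‖Z‖ ∑ |k|^{2s}|Z_k|²`, which the dissipation dominates (`sum_energy_le`,
`antitoneOn_energy`); here `s > 4/5` enters. The computation is made for Galerkin truncations, which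
converge to the fixed point (`exists_solution`).

Uniqueness needs no smallness: since `a < 2s`, `|k|^a` is at most a small multiple of the
dissipation plus a constant, and integrating the equation of each mode of the difference in time
before summing yields `I ≤ I/2` for a finite quantity `I` (`IsModeSolution.unique`).

The rest is the dictionary between modes and fields: `Γ⁻¹U` has so rapidly decaying coefficients
that all products are products of absolutely convergent series (`advection_coef`,
`solvesRandomPDE_iff`). -/

lemma freqNorm_eq_norm (n : Fin 3 → ℤ) :
    freqNorm n = 2 * Real.pi * ‖(WithLp.toLp 2 (fun j => (n j : ℝ)) : EuclideanSpace ℝ (Fin 3))‖ := by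
  simp [freqNorm, EuclideanSpace.norm_eq]

lemma freqNorm_nonneg (n : Fin 3 → ℤ) : 0 ≤ freqNorm n := by
  unfold freqNorm; positivity

@[simp] lemma freqNorm_zero : freqNorm 0 = 0 := by simp [freqNorm]

lemma freqNorm_neg (n : Fin 3 → ℤ) : freqNorm (-n) = freqNorm n := by simp [freqNorm]

lemma freqNorm_add_le (j l : Fin 3 → ℤ) : freqNorm (j + l) ≤ freqNorm j + freqNorm l := by
  rw [freqNorm_eq_norm, freqNorm_eq_norm, freqNorm_eq_norm, ← mul_add]
  gcongr
  refine le_trans (le_of_eq ?_) (norm_add_le _ _)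
  congr 1
  ext i
  simp

lemma freqNorm_le_add (k j : Fin 3 → ℤ) : freqNorm k ≤ freqNorm j + freqNorm (k - j) := by
  simpa using freqNorm_add_le j (k - j)

lemma two_pi_abs_le_freqNorm (n : Fin 3 → ℤ) (i : Fin 3) :
    2 * Real.pi * |(n i : ℝ)| ≤ freqNorm n := by
  rw [freqNorm_eq_norm]
  gcongr
  simpa using PiLp.norm_apply_le (WithLp.toLp 2 (fun j => (n j : ℝ)) : EuclideanSpace ℝ (Fin 3)) i

lemma two_pi_le_freqNorm {n : Fin 3 → ℤ} (hn : n ≠ 0) : 2 * Real.pi ≤ freqNorm n := by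
  obtain ⟨i, hi⟩ := Function.ne_iff.mp hn
  have h1 : (1 : ℝ) ≤ |(n i : ℝ)| := by exact_mod_cast Int.one_le_abs hi
  have := two_pi_abs_le_freqNorm n i
  nlinarith [Real.pi_pos]

lemma one_le_freqNorm {n : Fin 3 → ℤ} (hn : n ≠ 0) : 1 ≤ freqNorm n := by
  linarith [two_pi_le_freqNorm hn, Real.pi_gt_three]

lemma freqNorm_pos {n : Fin 3 → ℤ} (hn : n ≠ 0) : 0 < freqNorm n :=
  zero_lt_one.trans_le (one_le_freqNorm hn)

lemma one_add_abs_le_freqNorm {n : Fin 3 → ℤ} (hn : n ≠ 0) (i : Fin 3) :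
    1 + |(n i : ℝ)| ≤ freqNorm n := by
  have h1 := two_pi_le_freqNorm hn
  have h2 := two_pi_abs_le_freqNorm n i
  have := abs_nonneg (n i : ℝ)
  nlinarith [Real.pi_gt_three]

lemma freqNorm_rpow_le_rpow {n : Fin 3 → ℤ} {p q : ℝ} (hq : q ≠ 0) (hp : p ≠ 0) (hpq : p ≤ q) :
    freqNorm n ^ p ≤ freqNorm n ^ q := by
  by_cases hn : n = 0
  · simp [hn, Real.zero_rpow hq, Real.zero_rpow hp]
  · exact Real.rpow_le_rpow_of_exponent_le (one_le_freqNorm hn) hpq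

lemma freqNorm_rpow_nonneg (n : Fin 3 → ℤ) (p : ℝ) : 0 ≤ freqNorm n ^ p :=
  Real.rpow_nonneg (freqNorm_nonneg n) p

/-- `|k|^p ≤ |j|^p + |k-j|^p` for `0 ≤ p ≤ 1`. -/
lemma freqNorm_rpow_le_add {p : ℝ} (hp : 0 ≤ p) (hp1 : p ≤ 1) (k j : Fin 3 → ℤ) :
    freqNorm k ^ p ≤ freqNorm j ^ p + freqNorm (k - j) ^ p :=
  (Real.rpow_le_rpow (freqNorm_nonneg k) (freqNorm_le_add k j) hp).trans
    (Real.rpow_add_le_add_rpow (freqNorm_nonneg j) (freqNorm_nonneg _) hp hp1)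

/-! ### Summability over the lattice -/

/-- A summable weight on `ℤ`. -/
def latticeWeight (m : ℤ) : ℝ := (1 + |(m : ℝ)|) ^ (-(16 / 15) : ℝ)

lemma latticeWeight_nonneg (m : ℤ) : 0 ≤ latticeWeight m := by
  unfold latticeWeight; positivity

lemma summable_latticeWeight : Summable latticeWeight := by
  have h : Summable (fun n : ℕ => (1 + (n : ℝ)) ^ (-(16 / 15) : ℝ)) := by
    have := (summable_nat_add_iff 1).mpr
      (Real.summable_nat_rpow.mpr (by norm_num : (-(16 / 15) : ℝ) < -1))
    refine this.congr fun n => ?_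
    push_cast
    rw [add_comm]
  refine Summable.of_nat_of_neg ?_ ?_ <;> simpa [latticeWeight] using h

lemma tsum_ofReal_latticeWeight_ne_top : ∑' m, ENNReal.ofReal (latticeWeight m) ≠ ∞ := by
  rw [← ENNReal.ofReal_tsum_of_nonneg latticeWeight_nonneg summable_latticeWeight]
  exact ENNReal.ofReal_ne_top

/-- A finite set of lattice points lies in the product of its projections, over which the sum
factorizes. -/
lemma tsum_prod_le (f : Fin 3 → ℤ → ℝ≥0∞) :
    ∑' n : Fin 3 → ℤ, ∏ i, f i (n i) ≤ ∏ i, ∑' m, f i m := by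
  classical
  refine ENNReal.summable.tsum_le_of_sum_le fun S => ?_
  calc ∑ n ∈ S, ∏ i, f i (n i)
      ≤ ∑ n ∈ Fintype.piFinset (fun i => S.image (fun n => n i)), ∏ i, f i (n i) := by
        refine Finset.sum_le_sum_of_subset fun n hn => ?_
        simp only [Fintype.mem_piFinset, Finset.mem_image]
        exact fun i => ⟨n, hn, rfl⟩
    _ = ∏ i, ∑ m ∈ S.image (fun n => n i), f i m := (Finset.prod_univ_sum _ _).symm
    _ ≤ _ := Finset.prod_le_prod' fun i _ => ENNReal.sum_le_tsum _

/-- The bijections allow some coordinates of `j` to be replaced by those of `k - j` with a bound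
independent of `k`. -/
lemma tsum_latticeWeight_mul_le (f : Fin 3 → ℤ → ℤ)
    (hf : ∀ i, Function.Bijective (f i)) :
    ∑' n : Fin 3 → ℤ, ENNReal.ofReal (latticeWeight (f 0 (n 0)) * latticeWeight (f 1 (n 1)) *
      latticeWeight (f 2 (n 2))) ≤ (∑' m, ENNReal.ofReal (latticeWeight m)) ^ 3 := by
  have h := tsum_prod_le (fun i m => ENNReal.ofReal (latticeWeight (f i m)))
  have h2 : ∀ i, ∑' m, ENNReal.ofReal (latticeWeight (f i m)) =
      ∑' m, ENNReal.ofReal (latticeWeight m) := fun i =>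
    (Equiv.ofBijective (f i) (hf i)).tsum_eq (fun m => ENNReal.ofReal (latticeWeight m))
  simp only [h2, Finset.prod_const, Finset.card_univ, Fintype.card_fin] at h
  refine le_trans (le_of_eq (tsum_congr fun n => ?_)) h
  rw [ENNReal.ofReal_mul (mul_nonneg (latticeWeight_nonneg _) (latticeWeight_nonneg _)), ENNReal.ofReal_mul (latticeWeight_nonneg _)]
  simp [Fin.prod_univ_three]

/-- The exponent `16/15 > 1` is chosen so that three factors give exactly `16/5 = 2 · 8/5`, while
two give `32/15 ≤ 12/5`, the exponent left for the two horizontal directions. -/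
lemma freqNorm_rpow_le_latticeWeight {n : Fin 3 → ℤ} (hn : n ≠ 0) (i : Fin 3) :
    freqNorm n ^ (-(16 / 15) : ℝ) ≤ latticeWeight (n i) :=
  Real.rpow_le_rpow_of_nonpos (by positivity) (one_add_abs_le_freqNorm hn i) (by norm_num)

lemma freqNorm_rpow_le_latticeWeight_prod {n : Fin 3 → ℤ} (hn : n ≠ 0) :
    freqNorm n ^ (-(16 / 5) : ℝ) ≤
      latticeWeight (n 0) * latticeWeight (n 1) * latticeWeight (n 2) := by
  have h := freqNorm_pos hn
  have : freqNorm n ^ (-(16 / 5) : ℝ) = freqNorm n ^ (-(16 / 15) : ℝ) *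
      freqNorm n ^ (-(16 / 15) : ℝ) * freqNorm n ^ (-(16 / 15) : ℝ) := by
    rw [← Real.rpow_add h, ← Real.rpow_add h]; norm_num
  rw [this]
  have := freqNorm_rpow_nonneg n (-(16 / 15))
  have hw := latticeWeight_nonneg
  gcongr <;> first | exact hw _ | exact mul_nonneg (hw _) (hw _) |
    exact freqNorm_rpow_le_latticeWeight hn _

lemma freqNorm_rpow_le_latticeWeight_mul {n : Fin 3 → ℤ} (hn : n ≠ 0) :
    freqNorm n ^ (-(12 / 5) : ℝ) ≤ latticeWeight (n 0) * latticeWeight (n 1) := by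
  have h := freqNorm_pos hn
  have h2 : freqNorm n ^ (-(12 / 5) : ℝ) ≤ freqNorm n ^ (-(16 / 15) : ℝ) *
      freqNorm n ^ (-(16 / 15) : ℝ) := by
    rw [← Real.rpow_add h]
    exact Real.rpow_le_rpow_of_exponent_le (one_le_freqNorm hn) (by norm_num)
  refine h2.trans ?_
  have := freqNorm_rpow_nonneg n (-(16 / 15))
  have hw := latticeWeight_nonneg
  gcongr <;> first | exact hw _ | exact mul_nonneg (hw _) (hw _) |
    exact freqNorm_rpow_le_latticeWeight hn _

/-- The sequence `|k|^p` is summable over the nonzero frequencies for `p ≤ -16/5`. -/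
lemma summable_freqNorm_rpow {p : ℝ} (hp : p ≤ -(16 / 5)) :
    Summable (fun n : Fin 3 → ℤ => freqNorm n ^ p) := by
  have hs : Summable (fun n : Fin 3 → ℤ =>
      latticeWeight (n 0) * latticeWeight (n 1) * latticeWeight (n 2)) := by
    have h := tsum_latticeWeight_mul_le (fun _ m => m) (fun _ => Function.bijective_id)
    have h2 := ne_top_of_le_ne_top (ENNReal.pow_ne_top tsum_ofReal_latticeWeight_ne_top) h
    refine (ENNReal.summable_toReal h2).congr fun n => ENNReal.toReal_ofReal ?_
    have := latticeWeight_nonneg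
    exact mul_nonneg (mul_nonneg (this _) (this _)) (this _)
  refine Summable.of_nonneg_of_le (fun n => freqNorm_rpow_nonneg n _) (fun n => ?_) hs
  by_cases hn : n = 0
  · rw [hn, freqNorm_zero, Real.zero_rpow (by linarith)]
    have := latticeWeight_nonneg
    exact mul_nonneg (mul_nonneg (this _) (this _)) (this _)
  · exact (Real.rpow_le_rpow_of_exponent_le (one_le_freqNorm hn) hp).trans
      (freqNorm_rpow_le_latticeWeight_prod hn)

/-! ### The convolution kernel -/

/-- The kernel that dominates the symbol of the nonlinearity in all the estimates. -/
def kernel (j l : Fin 3 → ℤ) : ℝ :=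
  freqNorm j ^ (-(8 / 5) : ℝ) * freqNorm l ^ (-(3 / 5) : ℝ) * (1 + freqNorm j * |(j 2 : ℝ)|⁻¹)

lemma kernel_nonneg (j l : Fin 3 → ℤ) : 0 ≤ kernel j l := by
  have := freqNorm_nonneg j
  have := freqNorm_rpow_nonneg j (-(8 / 5))
  have := freqNorm_rpow_nonneg l (-(3 / 5))
  unfold kernel
  positivity

lemma inv_sq_le_latticeWeight (m : ℤ) : |(m : ℝ)|⁻¹ ^ 2 ≤ 4 * latticeWeight m := by
  by_cases hm : m = 0
  · simp [hm, latticeWeight]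
  have h1 : (1 : ℝ) ≤ |(m : ℝ)| := by exact_mod_cast Int.one_le_abs hm
  have h2 : (1 + |(m : ℝ)|) ^ (-2 : ℝ) ≤ latticeWeight m :=
    Real.rpow_le_rpow_of_exponent_le (by linarith) (by norm_num)
  refine le_trans ?_ (mul_le_mul_of_nonneg_left h2 (by norm_num))
  rw [Real.rpow_neg (by positivity), Real.rpow_two, inv_pow, ← div_eq_mul_inv,
    inv_le_comm₀ (by positivity) (by positivity), inv_div, div_le_iff₀ (by norm_num)]
  nlinarith

/-- The regular part of the kernel has square at most `|j|^{-16/5}`, summable in three dimensions.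
For the singular part `|j|^{-3/5}|l|^{-3/5}|j_2|⁻¹` the inequality `2x²y² ≤ x⁴ + y⁴` separates `j`
from `l`; each of `|j|^{-12/5}`, `|l|^{-12/5}` is summable over the two horizontal directions and
`|j_2|^{-2}` over the vertical one. The constants are not sharp. -/
lemma kernel_sq_le (j l : Fin 3 → ℤ) :
    kernel j l ^ 2 ≤ 10 * (latticeWeight (j 0) * latticeWeight (j 1) * latticeWeight (j 2)) +
      8 * (latticeWeight (l 0) * latticeWeight (l 1) * latticeWeight (j 2)) := by
  have hw := latticeWeight_nonneg
  have hr : 0 ≤ 10 * (latticeWeight (j 0) * latticeWeight (j 1) * latticeWeight (j 2)) +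
      8 * (latticeWeight (l 0) * latticeWeight (l 1) * latticeWeight (j 2)) := by
    have := hw (j 0); have := hw (j 1); have := hw (j 2); have := hw (l 0); have := hw (l 1)
    positivity
  -- A zero frequency contributes nothing, because `0` to a negative power is `0`.
  by_cases hj : j = 0
  · rw [hj] at hr ⊢
    simpa [kernel, Real.zero_rpow] using hr
  by_cases hl : l = 0
  · rw [hl] at hr ⊢
    simpa [kernel, Real.zero_rpow] using hr
  have hjp := freqNorm_pos hj
  have hlp := freqNorm_pos hl
  set x := freqNorm j ^ (-(3 / 5) : ℝ) with hx
  set y := freqNorm l ^ (-(3 / 5) : ℝ) with hy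
  set z := freqNorm j ^ (-(8 / 5) : ℝ) with hz
  set v := |(j 2 : ℝ)|⁻¹ with hv
  have hx0 : 0 ≤ x := freqNorm_rpow_nonneg _ _
  have hy0 : 0 ≤ y := freqNorm_rpow_nonneg _ _
  have hz0 : 0 ≤ z := freqNorm_rpow_nonneg _ _
  have hzx : z * freqNorm j = x := by
    rw [hz, hx]; nth_rw 2 [← Real.rpow_one (freqNorm j)]
    rw [← Real.rpow_add hjp]; norm_num
  have hk : kernel j l = y * z + x * y * v := by
    unfold kernel
    rw [← hzx]; ring
  have hy1 : y ≤ 1 := Real.rpow_le_one_of_one_le_of_nonpos (one_le_freqNorm hl) (by norm_num)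
  have hz2 : z ^ 2 ≤ latticeWeight (j 0) * latticeWeight (j 1) * latticeWeight (j 2) := by
    refine le_trans (le_of_eq ?_) (freqNorm_rpow_le_latticeWeight_prod hj)
    rw [hz, ← Real.rpow_natCast, ← Real.rpow_mul hjp.le]; norm_num
  have hx4 : x ^ 4 ≤ latticeWeight (j 0) * latticeWeight (j 1) := by
    refine le_trans (le_of_eq ?_) (freqNorm_rpow_le_latticeWeight_mul hj)
    rw [hx, ← Real.rpow_natCast, ← Real.rpow_mul hjp.le]; norm_num
  have hy4 : y ^ 4 ≤ latticeWeight (l 0) * latticeWeight (l 1) := by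
    refine le_trans (le_of_eq ?_) (freqNorm_rpow_le_latticeWeight_mul hl)
    rw [hy, ← Real.rpow_natCast, ← Real.rpow_mul hlp.le]; norm_num
  have hv2 := inv_sq_le_latticeWeight (j 2)
  rw [← hv] at hv2
  have h1 : (y * z) ^ 2 ≤ z ^ 2 := by
    rw [mul_pow]
    exact mul_le_of_le_one_left (sq_nonneg z) (pow_le_one₀ hy0 hy1)
  have h2 : (x * y * v) ^ 2 ≤ (1 / 2) * (x ^ 4 + y ^ 4) * v ^ 2 := by
    rw [mul_pow]
    exact mul_le_mul_of_nonneg_right (by nlinarith [sq_nonneg (x ^ 2 - y ^ 2)]) (sq_nonneg v)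
  have h3 : (x ^ 4 + y ^ 4) * v ^ 2 ≤ (latticeWeight (j 0) * latticeWeight (j 1) +
      latticeWeight (l 0) * latticeWeight (l 1)) * (4 * latticeWeight (j 2)) :=
    mul_le_mul (add_le_add hx4 hy4) hv2 (sq_nonneg v)
      (add_nonneg (mul_nonneg (hw _) (hw _)) (mul_nonneg (hw _) (hw _)))
  have h4 : 0 ≤ latticeWeight (l 0) * latticeWeight (l 1) * latticeWeight (j 2) :=
    mul_nonneg (mul_nonneg (hw _) (hw _)) (hw _)
  have h5 : 0 ≤ latticeWeight (j 0) * latticeWeight (j 1) * latticeWeight (j 2) :=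
    mul_nonneg (mul_nonneg (hw _) (hw _)) (hw _)
  rw [hk]
  nlinarith [sq_nonneg (y * z - x * y * v)]

lemma exists_tsum_kernel_sq_le : ∃ C : ℝ, 1 ≤ C ∧ ∀ k : Fin 3 → ℤ,
    ∑' j, ENNReal.ofReal (kernel j (k - j)) ^ 2 ≤ ENNReal.ofReal (C ^ 2) := by
  set Q := ∑' m, ENNReal.ofReal (latticeWeight m)
  have hQ : Q ≠ ∞ := tsum_ofReal_latticeWeight_ne_top
  -- The two parts of `kernel_sq_le` sum to at most `(10 + 8) Q³`; adding `1` makes the constant at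
  -- least `1` and its square at least `18 Q³`.
  refine ⟨18 * Q.toReal ^ 3 + 1, ?_, fun k => ?_⟩
  · have : 0 ≤ Q.toReal := ENNReal.toReal_nonneg
    nlinarith [pow_nonneg this 3]
  have hw := latticeWeight_nonneg
  have h1 := tsum_latticeWeight_mul_le (fun _ m => m) (fun _ => Function.bijective_id)
  have h2 := tsum_latticeWeight_mul_le
    (fun i m => if i = 2 then m else k i - m) (fun i => by
      by_cases hi : i = 2
      · simpa [hi] using! Function.bijective_id
      · simpa [hi] using! (Equiv.subLeft (k i)).bijective)
  have h3 : ∑' j, ENNReal.ofReal (kernel j (k - j)) ^ 2 ≤ 10 * Q ^ 3 + 8 * Q ^ 3 := by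
    calc ∑' j, ENNReal.ofReal (kernel j (k - j)) ^ 2
        ≤ ∑' j : Fin 3 → ℤ, (10 * ENNReal.ofReal (latticeWeight (j 0) * latticeWeight (j 1) *
            latticeWeight (j 2)) + 8 * ENNReal.ofReal (latticeWeight (k 0 - j 0) *
            latticeWeight (k 1 - j 1) * latticeWeight (j 2))) := by
          refine ENNReal.tsum_le_tsum fun j => ?_
          rw [← ENNReal.ofReal_pow (kernel_nonneg _ _)]
          refine (ENNReal.ofReal_le_ofReal (kernel_sq_le j (k - j))).trans (le_of_eq ?_)
          rw [ENNReal.ofReal_add, ENNReal.ofReal_mul (p := 10) (by norm_num),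
            ENNReal.ofReal_mul (p := 8) (by norm_num)]
          · simp
          · exact mul_nonneg (by norm_num) (mul_nonneg (mul_nonneg (hw _) (hw _)) (hw _))
          · exact mul_nonneg (by norm_num) (mul_nonneg (mul_nonneg (hw _) (hw _)) (hw _))
      _ ≤ _ := by
          rw [ENNReal.tsum_add, ENNReal.tsum_mul_left, ENNReal.tsum_mul_left]
          refine add_le_add (mul_le_mul_right h1 _) (mul_le_mul_right ?_ _)
          simpa using h2
  refine h3.trans ?_
  have h4 : (10 * Q ^ 3 + 8 * Q ^ 3) = ENNReal.ofReal (18 * Q.toReal ^ 3) := by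
    rw [ENNReal.ofReal_mul (by norm_num), ENNReal.ofReal_pow ENNReal.toReal_nonneg,
      ENNReal.ofReal_toReal hQ, ← add_mul]
    norm_num
  rw [h4]
  apply ENNReal.ofReal_le_ofReal
  nlinarith [pow_nonneg (ENNReal.toReal_nonneg (a := Q)) 3]

/-- The convolution of two sequences against the kernel. -/
def conv (a b : (Fin 3 → ℤ) → ℝ≥0∞) (k : Fin 3 → ℤ) : ℝ≥0∞ :=
  ∑' j, ENNReal.ofReal (kernel j (k - j)) * (a j * b (k - j))

lemma ennreal_tsum_mul_sq_le {ι : Type*} (f g : ι → ℝ≥0∞) :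
    (∑' i, f i * g i) ^ 2 ≤ (∑' i, f i ^ 2) * ∑' i, g i ^ 2 := by
  let _ : MeasurableSpace ι := ⊤
  have h := ENNReal.lintegral_mul_le_Lp_mul_Lq Measure.count Real.HolderConjugate.two_two
    (f := f) (g := g) (measurable_from_top.aemeasurable) (measurable_from_top.aemeasurable)
  simp only [lintegral_count, Pi.mul_apply, ENNReal.rpow_two] at h
  refine (pow_le_pow_left₀ zero_le h 2).trans (le_of_eq ?_)
  rw [mul_pow, ← ENNReal.rpow_natCast, ← ENNReal.rpow_natCast, ← ENNReal.rpow_mul,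
    ← ENNReal.rpow_mul]
  norm_num

/-- A constant in the `ℓ²` convolution estimate. -/
def convConst : ℝ := exists_tsum_kernel_sq_le.choose

lemma one_le_convConst : 1 ≤ convConst := exists_tsum_kernel_sq_le.choose_spec.1

lemma convConst_pos : 0 < convConst := zero_lt_one.trans_le one_le_convConst

/-- Cauchy–Schwarz in `j` puts the whole kernel into one factor, bounded uniformly in `k`; the other
factor `∑ a_j² b_{k-j}²` sums over `k` to a product by Tonelli. -/
lemma tsum_conv_sq_le (a b : (Fin 3 → ℤ) → ℝ≥0∞) :
    ∑' k, conv a b k ^ 2 ≤ ENNReal.ofReal (convConst ^ 2) * ((∑' j, a j ^ 2) * ∑' l, b l ^ 2) := by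
  calc ∑' k, conv a b k ^ 2
      ≤ ∑' k, ENNReal.ofReal (convConst ^ 2) * ∑' j, a j ^ 2 * b (k - j) ^ 2 := by
        refine ENNReal.tsum_le_tsum fun k => ?_
        refine (ennreal_tsum_mul_sq_le _ _).trans ?_
        simp only [mul_pow]
        gcongr
        exact exists_tsum_kernel_sq_le.choose_spec.2 k
    _ = _ := by
        rw [ENNReal.tsum_mul_left, ENNReal.tsum_comm]
        congr 1
        rw [← ENNReal.tsum_mul_right]
        refine tsum_congr fun j => ?_
        rw [ENNReal.tsum_mul_left]
        congr 1
        exact (Equiv.subRight j).tsum_eq (fun l => b l ^ 2)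

/-! ### The symbol of the nonlinearity -/

/-- `ℂ²` with the Hermitian norm. -/
abbrev CVec : Type := EuclideanSpace ℂ (Fin 2)

lemma normSq2_eq (c : CVec) : normSq2 (fun i => c i) = ‖c‖ ^ 2 := by
  simp [normSq2, EuclideanSpace.norm_sq_eq]

/-- `k_h · c` at `k = 2πn`, up to the factor `2π`. -/
def hdot (n : Fin 3 → ℤ) (c : Fin 2 → ℂ) : ℂ := ∑ i : Fin 2, (n i.castSucc : ℂ) * c i

lemma sq_freqNorm (n : Fin 3 → ℤ) :
    freqNorm n ^ 2 = (2 * Real.pi) ^ 2 * ((n 0 : ℝ) ^ 2 + (n 1 : ℝ) ^ 2 + (n 2 : ℝ) ^ 2) := by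
  rw [freqNorm, mul_pow, Real.sq_sqrt (by positivity), Fin.sum_univ_three]

lemma norm_hdot_sq_le (n : Fin 3 → ℤ) (c : CVec) :
    ‖hdot n c‖ ^ 2 ≤ ((n 0 : ℝ) ^ 2 + (n 1 : ℝ) ^ 2) * ‖c‖ ^ 2 := by
  have h1 : ‖hdot n c‖ ≤ |(n 0 : ℝ)| * ‖c 0‖ + |(n 1 : ℝ)| * ‖c 1‖ := by
    simp only [hdot, Fin.sum_univ_two]
    refine (norm_add_le _ _).trans (le_of_eq ?_)
    simp
  refine (pow_le_pow_left₀ (norm_nonneg _) h1 2).trans ?_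
  rw [EuclideanSpace.norm_sq_eq, Fin.sum_univ_two, ← sq_abs (n 0 : ℝ), ← sq_abs (n 1 : ℝ)]
  nlinarith [sq_nonneg (|(n 0 : ℝ)| * ‖c 1‖ - |(n 1 : ℝ)| * ‖c 0‖)]

lemma norm_hdot_le (n : Fin 3 → ℤ) (c : CVec) :
    2 * Real.pi * ‖hdot n c‖ ≤ freqNorm n * ‖c‖ := by
  have h0 : 0 ≤ freqNorm n * ‖c‖ := mul_nonneg (freqNorm_nonneg n) (norm_nonneg c)
  refine (sq_le_sq₀ (by positivity) h0).mp ?_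
  rw [mul_pow, mul_pow (freqNorm n), sq_freqNorm, mul_assoc ((2 * Real.pi) ^ 2)]
  refine mul_le_mul_of_nonneg_left ((norm_hdot_sq_le n c).trans ?_) (by positivity)
  exact mul_le_mul_of_nonneg_right (by nlinarith [sq_nonneg (n 2 : ℝ)]) (sq_nonneg _)

/-- The symbol of the transport operator: `(V·∇_h + w(V)∂_z) e^{il·x}` for `V = c e^{ij·x}` is
`transportSymbol j l c e^{i(j+l)·x}` (for `j₂ = 0` the divergence of `V` is taken to vanish). -/
def transportSymbol (j l : Fin 3 → ℤ) (c : Fin 2 → ℂ) : ℂ :=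
  2 * Real.pi * Complex.I * (hdot l c - hdot j c * ((l 2 : ℂ) / (j 2 : ℂ)))

/-- Both parts differentiate the transported mode `l`. The vertical velocity also costs one
derivative of the transporting mode and gains only the vertical factor `|j_2|⁻¹`, which is the
anisotropy handled by the kernel. -/
lemma norm_transportSymbol_le (j l : Fin 3 → ℤ) (c : CVec) :
    ‖transportSymbol j l c‖ ≤ freqNorm l * (1 + freqNorm j * |(j 2 : ℝ)|⁻¹) * ‖c‖ := by
  have h1 := norm_hdot_le l c
  have h2 := norm_hdot_le j c
  have h3 : |(l 2 : ℝ)| ≤ freqNorm l := by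
    have := two_pi_abs_le_freqNorm l 2
    nlinarith [Real.pi_gt_three, abs_nonneg (l 2 : ℝ)]
  have h4 : ‖transportSymbol j l c‖ ≤
      2 * Real.pi * (‖hdot l c‖ + ‖hdot j c‖ * (|(l 2 : ℝ)| * |(j 2 : ℝ)|⁻¹)) := by
    rw [transportSymbol, norm_mul]
    gcongr
    · simp [abs_of_pos Real.pi_pos]
    · refine (norm_sub_le _ _).trans (le_of_eq ?_)
      simp [div_eq_mul_inv]
  refine h4.trans ?_
  have h5 : (2 * Real.pi * ‖hdot j c‖) * (|(l 2 : ℝ)| * |(j 2 : ℝ)|⁻¹) ≤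
      (freqNorm j * ‖c‖) * (freqNorm l * |(j 2 : ℝ)|⁻¹) := by
    have := freqNorm_nonneg j
    gcongr
  nlinarith

lemma transportSymbol_add (j l : Fin 3 → ℤ) (c d : CVec) :
    transportSymbol j l (c + d : CVec) = transportSymbol j l c + transportSymbol j l d := by
  simp only [transportSymbol, hdot, Fin.sum_univ_two, PiLp.add_apply]; ring

lemma transportSymbol_smul (j l : Fin 3 → ℤ) (r : ℂ) (c : CVec) :
    transportSymbol j l (r • c : CVec) = r * transportSymbol j l c := by
  simp only [transportSymbol, hdot, Fin.sum_univ_two, PiLp.smul_apply, smul_eq_mul]; ring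

/-- The hydrostatic Leray projection on `ℂ²` as a linear map. -/
def lerayLin (n : Fin 3 → ℤ) : CVec →ₗ[ℂ] CVec where
  toFun c := WithLp.toLp 2 (leray n c)
  map_add' c d := by
    ext i
    simp only [leray, PiLp.add_apply, Fin.sum_univ_two]
    split_ifs <;> ring
  map_smul' r c := by
    ext i
    simp only [leray, PiLp.smul_apply, Fin.sum_univ_two, smul_eq_mul, RingHom.id_apply]
    split_ifs <;> ring

lemma lerayLin_apply (n : Fin 3 → ℤ) (c : CVec) (i : Fin 2) : lerayLin n c i = leray n c i := rfl

/-- For `n 2 = 0` the subtracted gradient part has norm at most `‖c‖`; the triangle inequality then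
suffices, without appeal to orthogonality. -/
lemma norm_lerayLin_le (n : Fin 3 → ℤ) (c : CVec) : ‖lerayLin n c‖ ≤ 2 * ‖c‖ := by
  by_cases hn : n 2 = 0
  swap
  · have : lerayLin n c = c := by ext i; simp [lerayLin_apply, leray, hn]
    rw [this]; linarith [norm_nonneg c]
  set q : ℝ := (n 0 : ℝ) ^ 2 + (n 1 : ℝ) ^ 2 with hq
  have hq0 : 0 ≤ q := by positivity
  set v : CVec := WithLp.toLp 2 (fun i => (n i.castSucc : ℂ) * (hdot n c / (q : ℂ))) with hv
  have h1 : lerayLin n c = c - v := by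
    ext i
    simp only [lerayLin_apply, leray, hn, if_true, hv, PiLp.sub_apply, hdot, Fin.sum_univ_two, hq]
    push_cast
    simp [mul_div_assoc]
  have h2 : ‖v‖ ^ 2 ≤ ‖c‖ ^ 2 := by
    have h3 : ‖v‖ ^ 2 = ‖hdot n c‖ ^ 2 * (q / q ^ 2) := by
      rw [EuclideanSpace.norm_sq_eq, Fin.sum_univ_two]
      simp only [hv, norm_mul, norm_div, mul_pow, div_pow, Complex.norm_intCast, sq_abs,
        Complex.norm_real, Real.norm_eq_abs]
      rw [hq]
      simp only [Fin.castSucc_zero, Fin.castSucc_one]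
      ring
    rw [h3]
    rcases hq0.eq_or_lt with h | h
    · simp [← h]
    · have := norm_hdot_sq_le n c
      rw [← hq] at this
      calc ‖hdot n c‖ ^ 2 * (q / q ^ 2) ≤ (q * ‖c‖ ^ 2) * (q / q ^ 2) := by gcongr
        _ = ‖c‖ ^ 2 := by field_simp
  rw [h1]
  have := (sq_le_sq₀ (norm_nonneg v) (norm_nonneg c)).mp h2
  linarith [norm_sub_le c v]

/-- The interaction of the modes `j` and `k - j` that contributes to the mode `k`. -/
def interaction (k j : Fin 3 → ℤ) : CVec →L[ℂ] CVec →L[ℂ] CVec :=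
  LinearMap.mkContinuous₂
    (LinearMap.mk₂ ℂ (fun c d : CVec => transportSymbol j (k - j) c • lerayLin k d)
      (fun c c' d => by rw [transportSymbol_add, add_smul])
      (fun r c d => by rw [transportSymbol_smul, mul_smul])
      (fun c d d' => by rw [map_add, smul_add])
      (fun r c d => by rw [map_smul, smul_comm]))
    (2 * (freqNorm (k - j) * (1 + freqNorm j * |(j 2 : ℝ)|⁻¹))) (fun c d => by
      rw [LinearMap.mk₂_apply, norm_smul]
      have h1 := norm_transportSymbol_le j (k - j) c
      have h2 := norm_lerayLin_le k d
      calc _ ≤ (freqNorm (k - j) * (1 + freqNorm j * |(j 2 : ℝ)|⁻¹) * ‖c‖) * (2 * ‖d‖) :=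
            mul_le_mul h1 h2 (norm_nonneg _) ((norm_nonneg _).trans h1)
        _ = _ := by ring)

lemma interaction_apply (k j : Fin 3 → ℤ) (c d : CVec) :
    interaction k j c d = transportSymbol j (k - j) c • lerayLin k d := rfl

lemma norm_interaction_le (k j : Fin 3 → ℤ) (c d : CVec) :
    ‖interaction k j c d‖ ≤
      2 * (freqNorm (k - j) * (1 + freqNorm j * |(j 2 : ℝ)|⁻¹)) * ‖c‖ * ‖d‖ := by
  rw [interaction_apply, norm_smul]
  have h1 := norm_transportSymbol_le j (k - j) c
  have h2 := norm_lerayLin_le k d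
  calc _ ≤ (freqNorm (k - j) * (1 + freqNorm j * |(j 2 : ℝ)|⁻¹) * ‖c‖) * (2 * ‖d‖) :=
        mul_le_mul h1 h2 (norm_nonneg _) ((norm_nonneg _).trans h1)
    _ = _ := by ring

/-! ### Bounds for the nonlinear term in the rescaled modes -/

/-- The data of the equation for the modes `Z_k = |k|^a e^{r(t)|k|^s} Û_k`: the exponents, the
decay rates `rate k` of the linear part, which dominate `κ|k|^{2s}`, and the difference `ρ` between
the radius of analyticity and the noise. -/
structure ModeFlow where
  s : ℝ
  a : ℝ
  κ : ℝ
  rate : (Fin 3 → ℤ) → ℝ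
  ρ : ℝ≥0 → ℝ
  s_gt : 4 / 5 < s
  s_le : s ≤ 1
  a_gt : 8 / 5 < a
  a_lt : a < 2 * s
  κ_pos : 0 < κ
  rate_zero : rate 0 = 0
  le_rate : ∀ k, k ≠ 0 → κ * freqNorm k ^ (2 * s) ≤ rate k
  ρ_cont : Continuous ρ
  ρ_nonneg : ∀ t, 0 ≤ ρ t

namespace ModeFlow

variable (P : ModeFlow)

/-- The weight with which the modes `j` and `k - j` of `Z` interact. -/
def weight (t : ℝ≥0) (k j : Fin 3 → ℤ) : ℝ :=
  Real.exp (P.ρ t * (freqNorm k ^ P.s - freqNorm j ^ P.s - freqNorm (k - j) ^ P.s)) *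
    (freqNorm j ^ (-P.a) * freqNorm (k - j) ^ (-P.a))

lemma continuous_weight (k j : Fin 3 → ℤ) : Continuous fun t => P.weight t k j := by
  have := P.ρ_cont
  unfold weight
  fun_prop

lemma weight_nonneg (t : ℝ≥0) (k j : Fin 3 → ℤ) : 0 ≤ P.weight t k j :=
  mul_nonneg (Real.exp_pos _).le
    (mul_nonneg (freqNorm_rpow_nonneg _ _) (freqNorm_rpow_nonneg _ _))

/-- Here the Gevrey weight disappears: the exponent is nonpositive by the subadditivity of `|·|^s`
for `s ≤ 1` and by `ρ ≥ 0`, that is, by the choice of good paths. -/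
lemma weight_le (t : ℝ≥0) (k j : Fin 3 → ℤ) :
    P.weight t k j ≤ freqNorm j ^ (-P.a) * freqNorm (k - j) ^ (-P.a) := by
  refine mul_le_of_le_one_left
    (mul_nonneg (freqNorm_rpow_nonneg _ _) (freqNorm_rpow_nonneg _ _)) ?_
  rw [Real.exp_le_one_iff]
  have hs := P.s_gt
  have := freqNorm_rpow_le_add (p := P.s) (by linarith) P.s_le k j
  exact mul_nonpos_of_nonneg_of_nonpos (P.ρ_nonneg t) (by linarith)

/-- The contribution of the modes `j` and `k - j` to the mode `k` of the nonlinearity. -/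
def nlTerm (t : ℝ≥0) (k j : Fin 3 → ℤ) (c d : CVec) : CVec :=
  P.weight t k j • interaction k j c d

lemma nlTerm_sub_left (t : ℝ≥0) (k j : Fin 3 → ℤ) (c c' d : CVec) :
    P.nlTerm t k j (c - c') d = P.nlTerm t k j c d - P.nlTerm t k j c' d := by
  simp [nlTerm, smul_sub]

lemma nlTerm_sub_right (t : ℝ≥0) (k j : Fin 3 → ℤ) (c d d' : CVec) :
    P.nlTerm t k j c (d - d') = P.nlTerm t k j c d - P.nlTerm t k j c d' := by
  simp [nlTerm, smul_sub]

lemma norm_nlTerm_le_aux (t : ℝ≥0) (k j : Fin 3 → ℤ) (c d : CVec) :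
    ‖P.nlTerm t k j c d‖ ≤ 2 * (freqNorm j ^ (-P.a) *
      (freqNorm (k - j) ^ (-P.a) * freqNorm (k - j)) * (1 + freqNorm j * |(j 2 : ℝ)|⁻¹)) *
        (‖c‖ * ‖d‖) := by
  rw [nlTerm, norm_smul, Real.norm_of_nonneg (P.weight_nonneg _ _ _)]
  calc _ ≤ _ := mul_le_mul (P.weight_le t k j) (norm_interaction_le k j c d) (norm_nonneg _)
        (mul_nonneg (freqNorm_rpow_nonneg _ _) (freqNorm_rpow_nonneg _ _))
    _ = _ := by ring

lemma one_add_freqNorm_mul_nonneg (j : Fin 3 → ℤ) : 0 ≤ 1 + freqNorm j * |(j 2 : ℝ)|⁻¹ := by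
  have := freqNorm_nonneg j
  positivity

/-- The hypothesis `a > 8/5` enters twice: directly for the mode `j`, and as `1 - a ≤ -3/5` for the
mode `k - j`, which carries the derivative. -/
lemma norm_nlTerm_le (t : ℝ≥0) (k j : Fin 3 → ℤ) (c d : CVec) :
    ‖P.nlTerm t k j c d‖ ≤ 2 * kernel j (k - j) * (‖c‖ * ‖d‖) := by
  refine (P.norm_nlTerm_le_aux t k j c d).trans ?_
  have ha := P.a_gt
  unfold kernel
  have h1 : freqNorm j ^ (-P.a) ≤ freqNorm j ^ (-(8 / 5) : ℝ) :=
    freqNorm_rpow_le_rpow (by norm_num) (by linarith) (by linarith)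
  have h2 : freqNorm (k - j) ^ (-P.a) * freqNorm (k - j) ≤ freqNorm (k - j) ^ (-(3 / 5) : ℝ) := by
    by_cases hl : k - j = 0
    · simp [hl, Real.zero_rpow]
    · nth_rw 2 [← Real.rpow_one (freqNorm (k - j))]
      rw [← Real.rpow_add (freqNorm_pos hl)]
      exact Real.rpow_le_rpow_of_exponent_le (one_le_freqNorm hl) (by linarith)
  have h3 := one_add_freqNorm_mul_nonneg j
  have := freqNorm_rpow_nonneg j (-(8 / 5))
  have := freqNorm_nonneg (k - j)
  have := freqNorm_rpow_nonneg (k - j) (-P.a)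
  gcongr

/-- Half of the dissipation, a factor `|·|^s`, is left on one of the two interacting modes. Since `0
≤ a - s ≤ 1`, the outer power is distributed over `j` and `k - j`. On the mode that receives it one
needs `-s ≤ s - 8/5`, respectively `1 - s ≤ s - 3/5`; both amount to `s ≥ 4/5`. -/
lemma freqNorm_rpow_mul_norm_nlTerm_le (t : ℝ≥0) (k j : Fin 3 → ℤ) (c d : CVec) :
    freqNorm k ^ (P.a - P.s) * ‖P.nlTerm t k j c d‖ ≤ 2 * kernel j (k - j) *
      ((freqNorm j ^ P.s * ‖c‖) * ‖d‖ + ‖c‖ * (freqNorm (k - j) ^ P.s * ‖d‖)) := by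
  have ha := P.a_gt
  have ha2 := P.a_lt
  have hs := P.s_gt
  have hs1 := P.s_le
  set l := k - j with hl
  set B := 1 + freqNorm j * |(j 2 : ℝ)|⁻¹ with hB
  have hB0 : 0 ≤ B := one_add_freqNorm_mul_nonneg j
  have h0 : freqNorm k ^ (P.a - P.s) ≤ freqNorm j ^ (P.a - P.s) + freqNorm l ^ (P.a - P.s) :=
    freqNorm_rpow_le_add (by linarith) (by linarith) k j
  have hj1 : freqNorm j ^ (-P.a) ≤ freqNorm j ^ (-(8 / 5) : ℝ) :=
    freqNorm_rpow_le_rpow (by norm_num) (by linarith) (by linarith)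
  have hj2 : freqNorm j ^ (P.a - P.s) * freqNorm j ^ (-P.a) ≤
      freqNorm j ^ (-(8 / 5) : ℝ) * freqNorm j ^ P.s := by
    by_cases h : j = 0
    · rw [h, freqNorm_zero, Real.zero_rpow (x := -P.a) (by linarith), Real.zero_rpow (x := -(8 / 5))
        (by norm_num)]; simp
    · rw [← Real.rpow_add (freqNorm_pos h), ← Real.rpow_add (freqNorm_pos h)]
      exact Real.rpow_le_rpow_of_exponent_le (one_le_freqNorm h) (by linarith)
  have hl1 : freqNorm l ^ (-P.a) * freqNorm l ≤ freqNorm l ^ (-(3 / 5) : ℝ) := by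
    by_cases hl : l = 0
    · simp [hl, Real.zero_rpow]
    · nth_rw 2 [← Real.rpow_one (freqNorm l)]
      rw [← Real.rpow_add (freqNorm_pos hl)]
      exact Real.rpow_le_rpow_of_exponent_le (one_le_freqNorm hl) (by linarith)
  have hl2 : freqNorm l ^ (P.a - P.s) * (freqNorm l ^ (-P.a) * freqNorm l) ≤
      freqNorm l ^ (-(3 / 5) : ℝ) * freqNorm l ^ P.s := by
    by_cases h : l = 0
    · rw [h, freqNorm_zero, Real.zero_rpow (x := -P.a) (by linarith), Real.zero_rpow (x := -(3 / 5))
        (by norm_num)]; simp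
    · nth_rw 3 [← Real.rpow_one (freqNorm l)]
      rw [← Real.rpow_add (freqNorm_pos h), ← Real.rpow_add (freqNorm_pos h),
        ← Real.rpow_add (freqNorm_pos h)]
      exact Real.rpow_le_rpow_of_exponent_le (one_le_freqNorm h) (by linarith)
  have n1 := freqNorm_rpow_nonneg j (-P.a)
  have n2 := freqNorm_rpow_nonneg l (-P.a)
  have n3 := freqNorm_nonneg l
  have n4 := freqNorm_rpow_nonneg j (-(8 / 5))
  have n5 := freqNorm_rpow_nonneg l (-(3 / 5))
  have n6 := freqNorm_rpow_nonneg j P.s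
  have n7 := freqNorm_rpow_nonneg l P.s
  have n8 := freqNorm_rpow_nonneg l (P.a - P.s)
  calc freqNorm k ^ (P.a - P.s) * ‖P.nlTerm t k j c d‖
      ≤ (freqNorm j ^ (P.a - P.s) + freqNorm l ^ (P.a - P.s)) *
        (2 * (freqNorm j ^ (-P.a) * (freqNorm l ^ (-P.a) * freqNorm l) * B) * (‖c‖ * ‖d‖)) :=
        mul_le_mul h0 (P.norm_nlTerm_le_aux t k j c d) (norm_nonneg _)
          (add_nonneg (freqNorm_rpow_nonneg _ _) (freqNorm_rpow_nonneg _ _))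
    _ = 2 * (((freqNorm j ^ (P.a - P.s) * freqNorm j ^ (-P.a)) *
          (freqNorm l ^ (-P.a) * freqNorm l) + freqNorm j ^ (-P.a) *
          (freqNorm l ^ (P.a - P.s) * (freqNorm l ^ (-P.a) * freqNorm l))) * B * (‖c‖ * ‖d‖)) := by
        ring
    _ ≤ 2 * (((freqNorm j ^ (-(8 / 5) : ℝ) * freqNorm j ^ P.s) *
          freqNorm l ^ (-(3 / 5) : ℝ) + freqNorm j ^ (-(8 / 5) : ℝ) *
          (freqNorm l ^ (-(3 / 5) : ℝ) * freqNorm l ^ P.s)) * B * (‖c‖ * ‖d‖)) := by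
        gcongr
    _ = _ := by rw [kernel]; ring

/-- The nonlinearity in terms of the modes `Z`, at time `t`. -/
def nl (t : ℝ≥0) (z w : (Fin 3 → ℤ) → CVec) (k : Fin 3 → ℤ) : CVec :=
  ∑' j, P.nlTerm t k j (z j) (w (k - j))

end ModeFlow

/-- The sum `∑ ‖z_k‖²`. -/
def ellSq {E : Type*} [NormedAddCommGroup E] (z : (Fin 3 → ℤ) → E) : ℝ≥0∞ := ∑' k, ‖z k‖ₑ ^ 2

namespace ModeFlow

variable (P : ModeFlow)

lemma enorm_nlTerm_le (t : ℝ≥0) (k j : Fin 3 → ℤ) (c d : CVec) :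
    ‖P.nlTerm t k j c d‖ₑ ≤ 2 * (ENNReal.ofReal (kernel j (k - j)) * (‖c‖ₑ * ‖d‖ₑ)) := by
  have h := ENNReal.ofReal_le_ofReal (P.norm_nlTerm_le t k j c d)
  rw [ofReal_norm, ENNReal.ofReal_mul (mul_nonneg zero_le_two (kernel_nonneg _ _)),
    ENNReal.ofReal_mul zero_le_two, ENNReal.ofReal_mul (norm_nonneg _), ofReal_norm,
    ofReal_norm] at h
  simpa [mul_assoc] using h

lemma tsum_enorm_nlTerm_le (t : ℝ≥0) (z w : (Fin 3 → ℤ) → CVec) (k : Fin 3 → ℤ) :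
    ∑' j, ‖P.nlTerm t k j (z j) (w (k - j))‖ₑ ≤
      2 * conv (fun j => ‖z j‖ₑ) (fun j => ‖w j‖ₑ) k := by
  rw [conv, ← ENNReal.tsum_mul_left]
  exact ENNReal.tsum_le_tsum fun j => P.enorm_nlTerm_le t k j _ _

end ModeFlow

lemma conv_ne_top {a b : (Fin 3 → ℤ) → ℝ≥0∞} (ha : ∑' j, a j ^ 2 ≠ ∞) (hb : ∑' j, b j ^ 2 ≠ ∞)
    (k : Fin 3 → ℤ) : conv a b k ≠ ∞ := by
  have h := ne_top_of_le_ne_top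
    (ENNReal.mul_ne_top ENNReal.ofReal_ne_top (ENNReal.mul_ne_top ha hb)) (tsum_conv_sq_le a b)
  have := ENNReal.ne_top_of_tsum_ne_top h k
  simpa using this

lemma enorm_tsum_le {ι E : Type*} [NormedAddCommGroup E] [CompleteSpace E] (f : ι → E) :
    ‖∑' i, f i‖ₑ ≤ ∑' i, ‖f i‖ₑ := by
  by_cases h : ∑' i, ‖f i‖ₑ = ∞
  · simp [h]
  have hs : Summable fun i => ‖f i‖ := by
    simpa using ENNReal.summable_toReal h
  rw [← ofReal_norm]
  refine (ENNReal.ofReal_le_ofReal (norm_tsum_le_tsum_norm hs)).trans (le_of_eq ?_)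
  rw [ENNReal.ofReal_tsum_of_nonneg (fun _ => norm_nonneg _) hs]
  simp

lemma summable_of_tsum_enorm_ne_top {ι E : Type*} [NormedAddCommGroup E] [CompleteSpace E]
    {f : ι → E} (h : ∑' i, ‖f i‖ₑ ≠ ∞) : Summable f :=
  Summable.of_norm (by simpa using ENNReal.summable_toReal h)

namespace ModeFlow

variable (P : ModeFlow)

lemma summable_nlTerm (t : ℝ≥0) {z w : (Fin 3 → ℤ) → CVec} (hz : ellSq z ≠ ∞) (hw : ellSq w ≠ ∞)
    (k : Fin 3 → ℤ) : Summable fun j => P.nlTerm t k j (z j) (w (k - j)) :=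
  summable_of_tsum_enorm_ne_top (ne_top_of_le_ne_top
    (ENNReal.mul_ne_top (by simp) (conv_ne_top hz hw k)) (P.tsum_enorm_nlTerm_le t z w k))

lemma enorm_nl_le (t : ℝ≥0) (z w : (Fin 3 → ℤ) → CVec) (k : Fin 3 → ℤ) :
    ‖P.nl t z w k‖ₑ ≤ 2 * conv (fun j => ‖z j‖ₑ) (fun j => ‖w j‖ₑ) k :=
  (enorm_tsum_le _).trans (P.tsum_enorm_nlTerm_le t z w k)

lemma nl_sub_nl (t : ℝ≥0) {z w : (Fin 3 → ℤ) → CVec} (hz : ellSq z ≠ ∞) (hw : ellSq w ≠ ∞)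
    (hzw : ellSq (z - w) ≠ ∞) (k : Fin 3 → ℤ) :
    P.nl t z z k - P.nl t w w k = P.nl t (z - w) z k + P.nl t w (z - w) k := by
  rw [nl, nl, nl, nl, ← (P.summable_nlTerm t hz hz k).tsum_sub (P.summable_nlTerm t hw hw k),
    ← (P.summable_nlTerm t hzw hz k).tsum_add (P.summable_nlTerm t hw hzw k)]
  refine tsum_congr fun j => ?_
  rw [Pi.sub_apply, Pi.sub_apply, nlTerm_sub_left, nlTerm_sub_right]
  abel

lemma ofReal_freqNorm_mul_enorm_nl_le (t : ℝ≥0) (z : (Fin 3 → ℤ) → CVec) (k : Fin 3 → ℤ) :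
    ENNReal.ofReal (freqNorm k ^ (P.a - P.s)) * ‖P.nl t z z k‖ₑ ≤
      2 * (conv (fun j => ENNReal.ofReal (freqNorm j ^ P.s) * ‖z j‖ₑ) (fun j => ‖z j‖ₑ) k +
        conv (fun j => ‖z j‖ₑ) (fun j => ENNReal.ofReal (freqNorm j ^ P.s) * ‖z j‖ₑ) k) := by
  refine (mul_le_mul_right (enorm_tsum_le _) _).trans ?_
  rw [← ENNReal.tsum_mul_left, conv, conv, ← ENNReal.tsum_add, ← ENNReal.tsum_mul_left]
  refine ENNReal.tsum_le_tsum fun j => ?_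
  have h := ENNReal.ofReal_le_ofReal
    (P.freqNorm_rpow_mul_norm_nlTerm_le t k j (z j) (z (k - j)))
  have n1 := freqNorm_rpow_nonneg j P.s
  have n2 := freqNorm_rpow_nonneg (k - j) P.s
  rw [ENNReal.ofReal_mul (freqNorm_rpow_nonneg _ _), ofReal_norm,
    ENNReal.ofReal_mul (mul_nonneg zero_le_two (kernel_nonneg _ _)),
    ENNReal.ofReal_mul zero_le_two, ENNReal.ofReal_add (by positivity) (by positivity),
    ENNReal.ofReal_mul (by positivity), ENNReal.ofReal_mul (by positivity),
    ENNReal.ofReal_mul (by positivity), ENNReal.ofReal_mul (by positivity),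
    ofReal_norm, ofReal_norm] at h
  refine h.trans (le_of_eq ?_)
  rw [ENNReal.ofReal_ofNat]
  ring

end ModeFlow

/-! ### Quadratic fixed point problems -/

section FixedPoint

variable {X : Type*} [NormedAddCommGroup X]

lemma norm_quadratic_sub_le {T : X → X → X}
    (hl : ∀ x y z, T (x - y) z = T x z - T y z) (hr : ∀ x y z, T x (y - z) = T x y - T x z)
    {c R : ℝ} (hc0 : 0 ≤ c) (hc : ∀ x y, ‖T x y‖ ≤ c * ‖x‖ * ‖y‖) {x y : X} (hx : ‖x‖ ≤ R)
    (hy : ‖y‖ ≤ R) : ‖T x x - T y y‖ ≤ 2 * c * R * ‖x - y‖ := by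
  have h1 : T x x - T y y = T (x - y) x + T y (x - y) := by rw [hl, hr]; abel
  rw [h1]
  have h2 : c * ‖x - y‖ * ‖x‖ ≤ c * ‖x - y‖ * R := by gcongr
  have h3 : c * ‖y‖ * ‖x - y‖ ≤ c * R * ‖x - y‖ := by gcongr
  linarith [norm_add_le (T (x - y) x) (T y (x - y)), hc (x - y) x, hc y (x - y)]

/-- A quadratic equation `x = x₀ + T(x,x)` with small `x₀` has a small solution, in every closed
set which the equation preserves. -/
lemma exists_quadratic_fixedPoint [CompleteSpace X] {T : X → X → X}
    (hl : ∀ x y z, T (x - y) z = T x z - T y z) (hr : ∀ x y z, T x (y - z) = T x y - T x z)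
    {c : ℝ} (hc0 : 0 ≤ c) (hc : ∀ x y, ‖T x y‖ ≤ c * ‖x‖ * ‖y‖) {x₀ : X} (hx₀ : 8 * c * ‖x₀‖ ≤ 1)
    {S : Set X} (hS : IsClosed S) (h₀ : x₀ ∈ S) (hmaps : ∀ x ∈ S, x₀ + T x x ∈ S) :
    ∃ x ∈ S, ‖x‖ ≤ 2 * ‖x₀‖ ∧ x₀ + T x x = x := by
  set B : Set X := S ∩ Metric.closedBall 0 (2 * ‖x₀‖)
  have hB : IsComplete B := (hS.inter Metric.isClosed_closedBall).isComplete
  have hmem : ∀ x ∈ B, ‖x‖ ≤ 2 * ‖x₀‖ := fun x hx => by simpa using hx.2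
  have hm : Set.MapsTo (fun x => x₀ + T x x) B B := by
    intro x hx
    refine ⟨hmaps x hx.1, ?_⟩
    have h1 := hmem x hx
    have h2 : c * ‖x‖ * ‖x‖ ≤ c * (2 * ‖x₀‖) * (2 * ‖x₀‖) := by gcongr
    have h3 : 0 ≤ ‖x₀‖ := norm_nonneg _
    simp only [Metric.mem_closedBall, dist_zero_right]
    nlinarith [norm_add_le x₀ (T x x), hc x x]
  -- On the ball of radius `2‖x₀‖` the Lipschitz constant is `4c‖x₀‖`, which is at most `1/2`
  -- because `8c‖x₀‖ ≤ 1`.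
  have hK : ContractingWith (1 / 2 : ℝ≥0) (hm.restrict (fun x => x₀ + T x x) B B) := by
    refine ⟨by rw [← NNReal.coe_lt_coe]; norm_num, LipschitzWith.of_dist_le_mul ?_⟩
    rintro ⟨x, hx⟩ ⟨y, hy⟩
    simp only [Subtype.dist_eq, Set.MapsTo.val_restrict_apply, dist_add_left]
    rw [dist_eq_norm, dist_eq_norm]
    have := norm_quadratic_sub_le hl hr hc0 hc (hmem x hx) (hmem y hy)
    have h4 : 0 ≤ ‖x - y‖ := norm_nonneg _
    push_cast
    nlinarith
  have h0B : x₀ ∈ B := ⟨h₀, by simpa using by linarith [norm_nonneg x₀]⟩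
  obtain ⟨x, hx, hfix, -⟩ := hK.exists_fixedPoint' hB hm h0B (edist_ne_top _ _)
  exact ⟨x, hx.1, hmem x hx, hfix⟩

/-- The solution of a quadratic equation is close to that of the projected equation. -/
lemma norm_sub_le_of_projected {T : X → X → X}
    (hl : ∀ x y z, T (x - y) z = T x z - T y z) (hr : ∀ x y z, T x (y - z) = T x y - T x z)
    {c : ℝ} (hc0 : 0 ≤ c) (hc : ∀ x y, ‖T x y‖ ≤ c * ‖x‖ * ‖y‖) {x₀ : X} (hx₀ : 8 * c * ‖x₀‖ ≤ 1)
    {p : X → X} (hp : ∀ x y, ‖p x - p y‖ ≤ ‖x - y‖) {x y : X} (hx : ‖x‖ ≤ 2 * ‖x₀‖)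
    (hy : ‖y‖ ≤ 2 * ‖x₀‖) (hfx : x₀ + T x x = x) (hfy : p (x₀ + T y y) = y) :
    ‖y - x‖ ≤ 2 * ‖p x - x‖ := by
  have h1 := hp (x₀ + T y y) (x₀ + T x x)
  rw [hfx, hfy] at h1
  have h2 := norm_quadratic_sub_le hl hr hc0 hc hy hx
  have h3 : x₀ + T y y - x = T y y - T x x := by nth_rw 1 [← hfx]; abel
  rw [h3] at h1
  -- By `h1`, `h2` and smallness the first term on the right is at most half of the left side and is
  -- absorbed.
  have h4 : ‖y - x‖ ≤ ‖y - p x‖ + ‖p x - x‖ := norm_sub_le_norm_sub_add_norm_sub _ _ _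
  have h5 : 0 ≤ ‖y - x‖ := norm_nonneg _
  nlinarith

end FixedPoint

/-! ### The space of trajectories -/

/-- Bounded continuous trajectories of a mode. -/
abbrev Traj : Type := ℝ≥0 →ᵇ CVec

/-- The space of families of trajectories with `∑ sup_t |Z_k(t)|² < ∞`. -/
abbrev ModeSpace : Type := lp (fun _ : Fin 3 → ℤ => Traj) 2

/-! ### Square summable families -/

section ellSq

variable {E : Type*} [NormedAddCommGroup E]

lemma ellSq_eq_ofReal_tsum {z : (Fin 3 → ℤ) → E} (hz : Summable fun k => ‖z k‖ ^ 2) :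
    ellSq z = ENNReal.ofReal (∑' k, ‖z k‖ ^ 2) := by
  rw [ENNReal.ofReal_tsum_of_nonneg (fun k => sq_nonneg _) hz]
  refine tsum_congr fun k => ?_
  rw [ENNReal.ofReal_pow (norm_nonneg _), ofReal_norm]

lemma ellSq_ne_top_iff {z : (Fin 3 → ℤ) → E} :
    ellSq z ≠ ∞ ↔ Summable fun k => ‖z k‖ ^ 2 := by
  refine ⟨fun h => ?_, fun h => by rw [ellSq_eq_ofReal_tsum h]; exact ENNReal.ofReal_ne_top⟩
  simpa using ENNReal.summable_toReal h

lemma memℓp_two_iff {z : (Fin 3 → ℤ) → E} : Memℓp (E := fun _ => E) z 2 ↔ ellSq z ≠ ∞ := by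
  rw [ellSq_ne_top_iff, memℓp_gen_iff (by norm_num)]
  simp

lemma ellSq_mono {F : Type*} [NormedAddCommGroup F] {z : (Fin 3 → ℤ) → E}
    {w : (Fin 3 → ℤ) → F} (h : ∀ k, ‖z k‖ₑ ≤ ‖w k‖ₑ) : ellSq z ≤ ellSq w :=
  ENNReal.tsum_le_tsum fun k => pow_le_pow_left₀ (zero_le) (h k) 2

lemma ellSq_sub_ne_top {z w : (Fin 3 → ℤ) → E} (hz : ellSq z ≠ ∞) (hw : ellSq w ≠ ∞) :
    ellSq (z - w) ≠ ∞ :=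
  memℓp_two_iff.mp ((memℓp_two_iff.mpr hz).sub (memℓp_two_iff.mpr hw))

lemma lp_norm_sq (x : lp (fun _ : Fin 3 → ℤ => E) 2) : ‖x‖ ^ 2 = ∑' k, ‖x k‖ ^ 2 := by
  have := lp.norm_rpow_eq_tsum (p := 2) (by norm_num) x
  simpa using this

lemma ellSq_coe (x : lp (fun _ : Fin 3 → ℤ => E) 2) :
    ellSq (x : (Fin 3 → ℤ) → E) = ENNReal.ofReal (‖x‖ ^ 2) := by
  rw [lp_norm_sq, ellSq_eq_ofReal_tsum]
  exact ellSq_ne_top_iff.mp (memℓp_two_iff.mp (lp.memℓp x))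

lemma ellSq_coe_ne_top (x : lp (fun _ : Fin 3 → ℤ => E) 2) :
    ellSq (x : (Fin 3 → ℤ) → E) ≠ ∞ := by
  rw [ellSq_coe]; exact ENNReal.ofReal_ne_top

lemma lp_norm_le_of_ellSq_le {x : lp (fun _ : Fin 3 → ℤ => E) 2} {R : ℝ} (hR : 0 ≤ R)
    (h : ellSq (x : (Fin 3 → ℤ) → E) ≤ ENNReal.ofReal (R ^ 2)) : ‖x‖ ≤ R := by
  rw [ellSq_coe, ENNReal.ofReal_le_ofReal_iff (sq_nonneg R)] at h
  exact (sq_le_sq₀ (norm_nonneg x) hR).mp h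

end ellSq

lemma ellSq_eval_le (z : (Fin 3 → ℤ) → Traj) (t : ℝ≥0) : ellSq (fun k => z k t) ≤ ellSq z :=
  ellSq_mono fun k => by
    rw [← ofReal_norm, ← ofReal_norm]
    exact ENNReal.ofReal_le_ofReal ((z k).norm_coe_le_norm t)

/-! ### The Duhamel operator -/

/-- The solution of `y' = -λy + f`, `y(0) = 0`. -/
def duhamelFun (lam : ℝ) (f : Traj) (τ : ℝ) : CVec :=
  Real.exp (-lam * τ) • ∫ u in (0 : ℝ)..τ, Real.exp (lam * u) • f u.toNNReal

lemma continuous_duhamel_integrand (lam : ℝ) (f : Traj) :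
    Continuous fun u : ℝ => Real.exp (lam * u) • f u.toNNReal := by
  have := f.continuous
  have h2 := continuous_real_toNNReal
  fun_prop

lemma hasDerivAt_duhamelFun (lam : ℝ) (f : Traj) (τ : ℝ) :
    HasDerivAt (duhamelFun lam f) (-lam • duhamelFun lam f τ + f τ.toNNReal) τ := by
  have hc := continuous_duhamel_integrand lam f
  have h1 := intervalIntegral.integral_hasDerivAt_right (hc.intervalIntegrable 0 τ)
    (hc.stronglyMeasurableAtFilter _ _) hc.continuousAt
  have h2 : HasDerivAt (fun τ : ℝ => Real.exp (-lam * τ)) (Real.exp (-lam * τ) * -lam) τ := by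
    simpa using ((hasDerivAt_id τ).const_mul (-lam)).exp
  convert! h2.smul h1 using 1
  rw [duhamelFun, smul_smul, smul_smul, ← Real.exp_add, add_comm]
  simp [mul_comm]

lemma duhamelFun_sub (lam : ℝ) (f g : Traj) (τ : ℝ) :
    duhamelFun lam (f - g) τ = duhamelFun lam f τ - duhamelFun lam g τ := by
  simp only [duhamelFun, BoundedContinuousFunction.sub_apply, smul_sub]
  rw [intervalIntegral.integral_sub
    ((continuous_duhamel_integrand lam f).intervalIntegrable _ _)
    ((continuous_duhamel_integrand lam g).intervalIntegrable _ _), smul_sub]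

/-- The exponential kernel has integral at most `1/λ` whatever the length of the time interval. This
makes the fixed point argument global in time and gains as many derivatives as the rate has. -/
lemma norm_duhamelFun_le {lam : ℝ} (hlam : 0 < lam) (f : Traj) {τ : ℝ} (hτ : 0 ≤ τ) :
    ‖duhamelFun lam f τ‖ ≤ lam⁻¹ * ‖f‖ := by
  have h1 : ‖∫ u in (0 : ℝ)..τ, Real.exp (lam * u) • f u.toNNReal‖ ≤
      ∫ u in (0 : ℝ)..τ, Real.exp (lam * u) * ‖f‖ := by
    refine intervalIntegral.norm_integral_le_of_norm_le hτ (Filter.Eventually.of_forall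
      fun u _ => ?_) (by apply Continuous.intervalIntegrable; fun_prop)
    rw [norm_smul, Real.norm_of_nonneg (Real.exp_pos _).le]
    gcongr
    exact f.norm_coe_le_norm _
  have h2 : lam * ∫ u in (0 : ℝ)..τ, Real.exp (lam * u) = Real.exp (lam * τ) - 1 := by
    rw [intervalIntegral.mul_integral_comp_mul_left, integral_exp]; simp
  rw [intervalIntegral.integral_mul_const, (eq_inv_mul_iff_mul_eq₀ hlam.ne').mpr h2] at h1
  rw [duhamelFun, norm_smul, Real.norm_of_nonneg (Real.exp_pos _).le]
  calc Real.exp (-lam * τ) * _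
      ≤ Real.exp (-lam * τ) * (lam⁻¹ * (Real.exp (lam * τ) - 1) * ‖f‖) := by gcongr
    _ = lam⁻¹ * ‖f‖ * (1 - Real.exp (-lam * τ)) := by
        have : Real.exp (-lam * τ) * Real.exp (lam * τ) = 1 := by rw [← Real.exp_add]; simp
        linear_combination lam⁻¹ * ‖f‖ * this
    _ ≤ lam⁻¹ * ‖f‖ := mul_le_of_le_one_right (by positivity)
        (by linarith [Real.exp_pos (-lam * τ)])

/-- The Duhamel operator on trajectories (zero for rates that are not positive). -/
def duhamel (lam : ℝ) (f : Traj) : Traj :=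
  if h : 0 < lam then
    BoundedContinuousFunction.ofNormedAddCommGroup (fun t : ℝ≥0 => duhamelFun lam f t)
      ((continuous_iff_continuousAt.mpr fun τ => (hasDerivAt_duhamelFun lam f τ).continuousAt).comp
        NNReal.continuous_coe) (lam⁻¹ * ‖f‖) (fun t => norm_duhamelFun_le h f t.2)
  else 0

lemma duhamel_apply {lam : ℝ} (h : 0 < lam) (f : Traj) (t : ℝ≥0) :
    duhamel lam f t = duhamelFun lam f t := by
  simp [duhamel, h]

lemma norm_duhamel_le (lam : ℝ) (f : Traj) : ‖duhamel lam f‖ ≤ |lam⁻¹| * ‖f‖ := by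
  by_cases h : 0 < lam
  · rw [abs_of_pos (inv_pos.mpr h), duhamel, dif_pos h]
    exact BoundedContinuousFunction.norm_ofNormedAddCommGroup_le _ (by positivity)
      (fun t => norm_duhamelFun_le h f t.2)
  · rw [duhamel, dif_neg h, norm_zero]
    positivity

lemma duhamel_sub (lam : ℝ) (f g : Traj) :
    duhamel lam (f - g) = duhamel lam f - duhamel lam g := by
  by_cases h : 0 < lam
  · ext1 t
    simp only [BoundedContinuousFunction.sub_apply, duhamel_apply h, duhamelFun_sub]
  · simp [duhamel, h]

/-- The solution of `y' = -λy`, `y(0) = c` (zero for rates that are not positive). -/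
def decayTraj (lam : ℝ) (c : CVec) : Traj :=
  if h : 0 < lam then
    BoundedContinuousFunction.ofNormedAddCommGroup (fun t : ℝ≥0 => Real.exp (-lam * t) • c)
      (by fun_prop) ‖c‖ (fun t => by
        rw [norm_smul, Real.norm_of_nonneg (Real.exp_pos _).le]
        refine mul_le_of_le_one_left (norm_nonneg c) (Real.exp_le_one_iff.mpr ?_)
        nlinarith [t.2, mul_nonneg h.le t.2])
  else 0

lemma decayTraj_apply {lam : ℝ} (h : 0 < lam) (c : CVec) (t : ℝ≥0) :
    decayTraj lam c t = Real.exp (-lam * t) • c := by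
  simp [decayTraj, h]

lemma norm_decayTraj_le (lam : ℝ) (c : CVec) : ‖decayTraj lam c‖ ≤ ‖c‖ := by
  by_cases h : 0 < lam
  · refine (BoundedContinuousFunction.norm_le (norm_nonneg c)).mpr fun t => ?_
    rw [decayTraj_apply h, norm_smul, Real.norm_of_nonneg (Real.exp_pos _).le]
    refine mul_le_of_le_one_left (norm_nonneg c) (Real.exp_le_one_iff.mpr ?_)
    nlinarith [t.2, mul_nonneg h.le t.2]
  · simp [decayTraj, h]

/-! ### The integral equation -/

namespace ModeFlow

variable (P : ModeFlow)

lemma rate_pos {k : Fin 3 → ℤ} (hk : k ≠ 0) : 0 < P.rate k :=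
  (mul_pos P.κ_pos (Real.rpow_pos_of_pos (freqNorm_pos hk) _)).trans_le (P.le_rate k hk)

/-- The gain from Duhamel's formula compensates the factor `|k|^a` of the equation because `a < 2s`
and nonzero frequencies have `|k| ≥ 1`. -/
lemma freqNorm_rpow_mul_inv_rate_le (k : Fin 3 → ℤ) :
    freqNorm k ^ P.a * |(P.rate k)⁻¹| ≤ P.κ⁻¹ := by
  have ha := P.a_gt
  have hκ := P.κ_pos
  by_cases hk : k = 0
  · rw [hk, freqNorm_zero, Real.zero_rpow (by linarith), zero_mul]
    exact (inv_pos.mpr hκ).le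
  have hr := P.rate_pos hk
  rw [abs_of_pos (inv_pos.mpr hr), ← div_eq_mul_inv, div_le_iff₀ hr, inv_mul_eq_div,
    le_div_iff₀ hκ, mul_comm]
  refine le_trans ?_ (P.le_rate k hk)
  exact mul_le_mul_of_nonneg_left (Real.rpow_le_rpow_of_exponent_le (one_le_freqNorm hk)
    P.a_lt.le) hκ.le

/-- `nlTerm` on trajectories. -/
def nlTermTraj (k j : Fin 3 → ℤ) (f g : Traj) : Traj :=
  BoundedContinuousFunction.ofNormedAddCommGroup (fun t => P.nlTerm t k j (f t) (g t))
    (by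
      have h1 := P.continuous_weight k j
      have h2 := f.continuous
      have h3 := g.continuous
      unfold nlTerm
      fun_prop)
    (2 * kernel j (k - j) * (‖f‖ * ‖g‖)) (fun t => by
      refine (P.norm_nlTerm_le t k j _ _).trans ?_
      have := kernel_nonneg j (k - j)
      gcongr
      · exact f.norm_coe_le_norm t
      · exact g.norm_coe_le_norm t)

lemma enorm_nlTermTraj_le (k j : Fin 3 → ℤ) (f g : Traj) :
    ‖P.nlTermTraj k j f g‖ₑ ≤ 2 * (ENNReal.ofReal (kernel j (k - j)) * (‖f‖ₑ * ‖g‖ₑ)) := by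
  have h0 := kernel_nonneg j (k - j)
  have h : ‖P.nlTermTraj k j f g‖ ≤ 2 * kernel j (k - j) * (‖f‖ * ‖g‖) :=
    BoundedContinuousFunction.norm_ofNormedAddCommGroup_le _ (by positivity) _
  replace h := ENNReal.ofReal_le_ofReal h
  rw [ofReal_norm, ENNReal.ofReal_mul (by positivity),
    ENNReal.ofReal_mul zero_le_two, ENNReal.ofReal_mul (norm_nonneg _), ofReal_norm,
    ofReal_norm] at h
  simpa [mul_assoc] using h

/-- The nonlinearity on trajectories. -/
def nlTraj (z w : (Fin 3 → ℤ) → Traj) (k : Fin 3 → ℤ) : Traj :=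
  ∑' j, P.nlTermTraj k j (z j) (w (k - j))

lemma tsum_enorm_nlTermTraj_le (z w : (Fin 3 → ℤ) → Traj) (k : Fin 3 → ℤ) :
    ∑' j, ‖P.nlTermTraj k j (z j) (w (k - j))‖ₑ ≤
      2 * conv (fun j => ‖z j‖ₑ) (fun j => ‖w j‖ₑ) k := by
  rw [conv, ← ENNReal.tsum_mul_left]
  exact ENNReal.tsum_le_tsum fun j => P.enorm_nlTermTraj_le k j _ _

lemma summable_nlTermTraj {z w : (Fin 3 → ℤ) → Traj} (hz : ellSq z ≠ ∞) (hw : ellSq w ≠ ∞)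
    (k : Fin 3 → ℤ) : Summable fun j => P.nlTermTraj k j (z j) (w (k - j)) :=
  summable_of_tsum_enorm_ne_top (ne_top_of_le_ne_top
    (ENNReal.mul_ne_top (by simp) (conv_ne_top hz hw k)) (P.tsum_enorm_nlTermTraj_le z w k))

lemma enorm_nlTraj_le (z w : (Fin 3 → ℤ) → Traj) (k : Fin 3 → ℤ) :
    ‖P.nlTraj z w k‖ₑ ≤ 2 * conv (fun j => ‖z j‖ₑ) (fun j => ‖w j‖ₑ) k :=
  (enorm_tsum_le _).trans (P.tsum_enorm_nlTermTraj_le z w k)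

lemma nlTraj_apply {z w : (Fin 3 → ℤ) → Traj} (hz : ellSq z ≠ ∞) (hw : ellSq w ≠ ∞)
    (k : Fin 3 → ℤ) (t : ℝ≥0) :
    P.nlTraj z w k t = P.nl t (fun j => z j t) (fun j => w j t) k :=
  (BoundedContinuousFunction.evalCLM ℝ t).map_tsum (P.summable_nlTermTraj hz hw k)

lemma ellSq_nlTraj_le (z w : (Fin 3 → ℤ) → Traj) :
    ellSq (P.nlTraj z w) ≤ ENNReal.ofReal ((2 * convConst) ^ 2) * (ellSq z * ellSq w) := by
  have h := tsum_conv_sq_le (fun j => ‖z j‖ₑ) (fun j => ‖w j‖ₑ)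
  calc ellSq (P.nlTraj z w)
      ≤ ∑' k, 4 * conv (fun j => ‖z j‖ₑ) (fun j => ‖w j‖ₑ) k ^ 2 := by
        refine ENNReal.tsum_le_tsum fun k => ?_
        refine (pow_le_pow_left₀ zero_le (P.enorm_nlTraj_le z w k) 2).trans (le_of_eq ?_)
        rw [mul_pow]; norm_num
    _ ≤ 4 * (ENNReal.ofReal (convConst ^ 2) * (ellSq z * ellSq w)) := by
        rw [ENNReal.tsum_mul_left]
        exact mul_le_mul_right h _
    _ = _ := by
        rw [mul_pow, ENNReal.ofReal_mul (by positivity), ← mul_assoc]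
        norm_num

/-- The modes of the bilinear Duhamel term. -/
def duhamelTerm (z w : (Fin 3 → ℤ) → Traj) (k : Fin 3 → ℤ) : Traj :=
  -(freqNorm k ^ P.a) • duhamel (P.rate k) (P.nlTraj z w k)

lemma norm_duhamelTerm_le (z w : (Fin 3 → ℤ) → Traj) (k : Fin 3 → ℤ) :
    ‖P.duhamelTerm z w k‖ ≤ P.κ⁻¹ * ‖P.nlTraj z w k‖ := by
  rw [duhamelTerm, norm_smul, norm_neg, Real.norm_of_nonneg (freqNorm_rpow_nonneg _ _)]
  calc _ ≤ freqNorm k ^ P.a * (|(P.rate k)⁻¹| * ‖P.nlTraj z w k‖) :=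
        mul_le_mul_of_nonneg_left (norm_duhamel_le _ _) (freqNorm_rpow_nonneg _ _)
    _ = (freqNorm k ^ P.a * |(P.rate k)⁻¹|) * ‖P.nlTraj z w k‖ := by ring
    _ ≤ _ := mul_le_mul_of_nonneg_right (P.freqNorm_rpow_mul_inv_rate_le k) (norm_nonneg _)

lemma ellSq_duhamelTerm_le (z w : ModeSpace) :
    ellSq (P.duhamelTerm z w) ≤
      ENNReal.ofReal ((P.κ⁻¹ * (2 * convConst) * ‖z‖ * ‖w‖) ^ 2) := by
  have hκ := P.κ_pos
  have hC := convConst_pos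
  calc ellSq (P.duhamelTerm z w) ≤ ∑' k, ENNReal.ofReal (P.κ⁻¹ ^ 2) * ‖P.nlTraj z w k‖ₑ ^ 2 := by
        refine ENNReal.tsum_le_tsum fun k => ?_
        have h := ENNReal.ofReal_le_ofReal (P.norm_duhamelTerm_le z w k)
        rw [ofReal_norm, ENNReal.ofReal_mul (by positivity), ofReal_norm] at h
        refine (pow_le_pow_left₀ zero_le h 2).trans (le_of_eq ?_)
        rw [mul_pow, ENNReal.ofReal_pow (by positivity)]
    _ ≤ ENNReal.ofReal (P.κ⁻¹ ^ 2) *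
        (ENNReal.ofReal ((2 * convConst) ^ 2) * (ellSq (E := Traj) z * ellSq (E := Traj) w)) := by
        rw [ENNReal.tsum_mul_left]
        exact mul_le_mul_right (P.ellSq_nlTraj_le z w) _
    _ = _ := by
        rw [ellSq_coe, ellSq_coe, ← ENNReal.ofReal_mul (by positivity),
          ← ENNReal.ofReal_mul (by positivity), ← ENNReal.ofReal_mul (by positivity)]
        congr 1; ring

/-- The bilinear Duhamel term as an operation on `ModeSpace`. -/
def duhamelOp (z w : ModeSpace) : ModeSpace :=
  ⟨P.duhamelTerm z w, memℓp_two_iff.mpr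
    (ne_top_of_le_ne_top ENNReal.ofReal_ne_top (P.ellSq_duhamelTerm_le z w))⟩

lemma norm_duhamelOp_le (z w : ModeSpace) :
    ‖P.duhamelOp z w‖ ≤ P.κ⁻¹ * (2 * convConst) * ‖z‖ * ‖w‖ := by
  have hκ := P.κ_pos
  have hC := convConst_pos
  exact lp_norm_le_of_ellSq_le (by positivity) (P.ellSq_duhamelTerm_le z w)

lemma nlTraj_sub_left (x y z : ModeSpace) (k : Fin 3 → ℤ) :
    P.nlTraj (x - y : ModeSpace) z k = P.nlTraj x z k - P.nlTraj y z k := by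
  rw [nlTraj, nlTraj, nlTraj, ← (P.summable_nlTermTraj (ellSq_coe_ne_top x) (ellSq_coe_ne_top z)
    k).tsum_sub (P.summable_nlTermTraj (ellSq_coe_ne_top y) (ellSq_coe_ne_top z) k)]
  refine tsum_congr fun j => ?_
  ext1 t
  exact P.nlTerm_sub_left t k j _ _ _

lemma nlTraj_sub_right (x y z : ModeSpace) (k : Fin 3 → ℤ) :
    P.nlTraj x (y - z : ModeSpace) k = P.nlTraj x y k - P.nlTraj x z k := by
  rw [nlTraj, nlTraj, nlTraj, ← (P.summable_nlTermTraj (ellSq_coe_ne_top x) (ellSq_coe_ne_top y)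
    k).tsum_sub (P.summable_nlTermTraj (ellSq_coe_ne_top x) (ellSq_coe_ne_top z) k)]
  refine tsum_congr fun j => ?_
  ext1 t
  exact P.nlTerm_sub_right t k j _ _ _

lemma duhamelOp_sub_left (x y z : ModeSpace) :
    P.duhamelOp (x - y) z = P.duhamelOp x z - P.duhamelOp y z := by
  ext1
  funext k
  change P.duhamelTerm _ _ k = P.duhamelTerm _ _ k - P.duhamelTerm _ _ k
  rw [duhamelTerm, nlTraj_sub_left, duhamel_sub, smul_sub]
  rfl

lemma duhamelOp_sub_right (x y z : ModeSpace) :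
    P.duhamelOp x (y - z) = P.duhamelOp x y - P.duhamelOp x z := by
  ext1
  funext k
  change P.duhamelTerm _ _ k = P.duhamelTerm _ _ k - P.duhamelTerm _ _ k
  rw [duhamelTerm, nlTraj_sub_right, duhamel_sub, smul_sub]
  rfl

/-- The solution of the linear equation with initial value `y`. -/
def linearFlow (y : lp (fun _ : Fin 3 → ℤ => CVec) 2) : ModeSpace :=
  ⟨fun k => decayTraj (P.rate k) (y k), memℓp_two_iff.mpr (ne_top_of_le_ne_top
    (ellSq_coe_ne_top y) (ellSq_mono fun k => by
      rw [← ofReal_norm, ← ofReal_norm]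
      exact ENNReal.ofReal_le_ofReal (norm_decayTraj_le _ _)))⟩

lemma norm_linearFlow_le (y : lp (fun _ : Fin 3 → ℤ => CVec) 2) : ‖P.linearFlow y‖ ≤ ‖y‖ := by
  refine lp_norm_le_of_ellSq_le (norm_nonneg y) ?_
  rw [← ellSq_coe]
  refine ellSq_mono fun k => ?_
  rw [← ofReal_norm, ← ofReal_norm]
  exact ENNReal.ofReal_le_ofReal (norm_decayTraj_le _ _)

/-- The rate of the zero mode vanishes, so the default values of `decayTraj` and `duhamel` apply;
this matches the mean-zero condition. -/
lemma rhs_apply_zero (y : lp (fun _ : Fin 3 → ℤ => CVec) 2) (z : ModeSpace) :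
    (P.linearFlow y + P.duhamelOp z z) 0 = 0 := by
  change decayTraj (P.rate 0) (y 0) + P.duhamelTerm z z 0 = 0
  rw [decayTraj, duhamelTerm, duhamel, P.rate_zero, dif_neg (lt_irrefl 0), dif_neg (lt_irrefl 0)]
  ext1 t
  change (0 : CVec) + -(freqNorm 0 ^ P.a) • (0 : CVec) = 0
  rw [smul_zero, zero_add]

lemma rhs_apply (y : lp (fun _ : Fin 3 → ℤ => CVec) 2) (z : ModeSpace) {k : Fin 3 → ℤ}
    (hk : k ≠ 0) (t : ℝ≥0) :
    (P.linearFlow y + P.duhamelOp z z) k t = Real.exp (-P.rate k * t) • y k -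
      (freqNorm k ^ P.a) • duhamelFun (P.rate k) (P.nlTraj z z k) t := by
  change decayTraj (P.rate k) (y k) t + (-(freqNorm k ^ P.a) • duhamel (P.rate k) _ t) = _
  rw [decayTraj_apply (P.rate_pos hk), duhamel_apply (P.rate_pos hk), neg_smul, sub_eq_add_neg]

lemma rhs_apply_time_zero (y : lp (fun _ : Fin 3 → ℤ => CVec) 2) (hy : y 0 = 0) (z : ModeSpace)
    (k : Fin 3 → ℤ) : (P.linearFlow y + P.duhamelOp z z) k 0 = y k := by
  by_cases hk : k = 0
  · rw [hk, rhs_apply_zero, hy]; rfl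
  · rw [P.rhs_apply y z hk]
    simp [duhamelFun]

lemma hasDerivWithinAt_rhs (y : lp (fun _ : Fin 3 → ℤ => CVec) 2) (z : ModeSpace)
    (k : Fin 3 → ℤ) (t : ℝ≥0) :
    HasDerivWithinAt (fun τ : ℝ => (P.linearFlow y + P.duhamelOp z z) k τ.toNNReal)
      (-P.rate k • (P.linearFlow y + P.duhamelOp z z) k t -
        (freqNorm k ^ P.a) • P.nl t (fun j => z j t) (fun j => z j t) k) (Set.Ici 0) t := by
  have ha := P.a_gt
  by_cases hk : k = 0
  · subst hk
    rw [rhs_apply_zero]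
    simpa [Real.zero_rpow (x := P.a) (by linarith)] using
      hasDerivWithinAt_const (t : ℝ) (Set.Ici 0) (0 : CVec)
  rw [← P.nlTraj_apply (ellSq_coe_ne_top z) (ellSq_coe_ne_top z), P.rhs_apply y z hk]
  have h1 : HasDerivAt (fun τ : ℝ => Real.exp (-P.rate k * τ) • y k)
      ((Real.exp (-P.rate k * t) * -P.rate k) • y k) t := by
    have : HasDerivAt (fun τ : ℝ => Real.exp (-P.rate k * τ))
        (Real.exp (-P.rate k * t) * -P.rate k) t := by
      simpa using ((hasDerivAt_id (t : ℝ)).const_mul (-P.rate k)).exp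
    exact this.smul_const (y k)
  have h2 := (hasDerivAt_duhamelFun (P.rate k) (P.nlTraj z z k) t).const_smul (freqNorm k ^ P.a)
  have h3 := (h1.sub h2).hasDerivWithinAt (s := Set.Ici 0)
  refine (h3.congr_deriv ?_).congr (fun τ hτ => ?_) ?_
  · rw [Real.toNNReal_coe]
    module
  · rw [P.rhs_apply y z hk, Real.coe_toNNReal τ hτ]; rfl
  · rw [Real.toNNReal_coe, P.rhs_apply y z hk]; rfl

end ModeFlow

/-! ### Truncation -/

section Truncation

variable {E : Type*} [NormedAddCommGroup E]

lemma truncation_memℓp (S : Finset (Fin 3 → ℤ)) (x : lp (fun _ : Fin 3 → ℤ => E) 2) :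
    Memℓp (E := fun _ => E) (fun k => if k ∈ S then x k else 0) 2 :=
  memℓp_two_iff.mpr (ne_top_of_le_ne_top (ellSq_coe_ne_top x) (ellSq_mono fun k => by
    split_ifs <;> simp))

/-- The restriction of a sequence to finitely many modes. -/
def truncation (S : Finset (Fin 3 → ℤ)) (x : lp (fun _ : Fin 3 → ℤ => E) 2) :
    lp (fun _ : Fin 3 → ℤ => E) 2 :=
  ⟨fun k => if k ∈ S then x k else 0, truncation_memℓp S x⟩

lemma truncation_apply (S : Finset (Fin 3 → ℤ)) (x : lp (fun _ : Fin 3 → ℤ => E) 2)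
    (k : Fin 3 → ℤ) : truncation S x k = if k ∈ S then x k else 0 := rfl

lemma truncation_sub (S : Finset (Fin 3 → ℤ)) (x y : lp (fun _ : Fin 3 → ℤ => E) 2) :
    truncation S (x - y) = truncation S x - truncation S y := by
  ext1; funext k
  simp only [truncation_apply, lp.coeFn_sub, Pi.sub_apply]
  split_ifs <;> simp

lemma truncation_add (S : Finset (Fin 3 → ℤ)) (x y : lp (fun _ : Fin 3 → ℤ => E) 2) :
    truncation S (x + y) = truncation S x + truncation S y := by
  ext1; funext k
  simp only [truncation_apply, lp.coeFn_add, Pi.add_apply]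
  split_ifs <;> simp

lemma norm_truncation_le (S : Finset (Fin 3 → ℤ)) (x : lp (fun _ : Fin 3 → ℤ => E) 2) :
    ‖truncation S x‖ ≤ ‖x‖ := by
  refine lp_norm_le_of_ellSq_le (norm_nonneg x) ?_
  rw [← ellSq_coe]
  refine ellSq_mono fun k => ?_
  rw [truncation_apply]
  split_ifs <;> simp

lemma tendsto_truncation (x : lp (fun _ : Fin 3 → ℤ => E) 2) :
    Filter.Tendsto (fun S => truncation S x) Filter.atTop (nhds x) := by
  classical
  have h := lp.hasSum_single (p := 2) (by norm_num) x
  refine h.congr fun S => ?_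
  ext1; funext k
  rw [lp.coeFn_sum, Finset.sum_apply]
  simp [truncation_apply, lp.single_apply, Pi.single_apply]

end Truncation

/-! ### The energy estimate -/

lemma ennreal_add_sq_le (a b : ℝ≥0∞) : (a + b) ^ 2 ≤ 2 * (a ^ 2 + b ^ 2) := by
  have h := ENNReal.rpow_add_le_mul_rpow_add_rpow a b (p := 2) (by norm_num)
  norm_num at h
  simpa using h

namespace ModeFlow

variable (P : ModeFlow)

/-- The `ℓ²` convolution bound is applied to both placements of the factor `|·|^s`. The elementary
bound `(a + b)² ≤ 2(a² + b²)` and the factor `2` of the nonlinearity account for the constant `4`.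
-/
lemma tsum_weighted_nl_sq_le (t : ℝ≥0) (z : (Fin 3 → ℤ) → CVec) :
    ∑' k, (ENNReal.ofReal (freqNorm k ^ (P.a - P.s)) * ‖P.nl t z z k‖ₑ) ^ 2 ≤
      ENNReal.ofReal ((4 * convConst) ^ 2) *
        ((∑' k, (ENNReal.ofReal (freqNorm k ^ P.s) * ‖z k‖ₑ) ^ 2) * ellSq z) := by
  set x : (Fin 3 → ℤ) → ℝ≥0∞ := fun k => ENNReal.ofReal (freqNorm k ^ P.s) * ‖z k‖ₑ
  set w : (Fin 3 → ℤ) → ℝ≥0∞ := fun k => ‖z k‖ₑ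
  have h1 := tsum_conv_sq_le x w
  have h2 := tsum_conv_sq_le w x
  calc _ ≤ ∑' k, 8 * (conv x w k ^ 2 + conv w x k ^ 2) := by
        refine ENNReal.tsum_le_tsum fun k => ?_
        refine (pow_le_pow_left₀ zero_le (P.ofReal_freqNorm_mul_enorm_nl_le t z k) 2).trans ?_
        rw [mul_pow]
        refine (mul_le_mul_right (ennreal_add_sq_le (conv x w k) (conv w x k)) _).trans
          (le_of_eq ?_)
        rw [← mul_assoc]; norm_num
    _ ≤ 8 * (ENNReal.ofReal (convConst ^ 2) * ((∑' k, x k ^ 2) * ∑' k, w k ^ 2) +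
          ENNReal.ofReal (convConst ^ 2) * ((∑' k, w k ^ 2) * ∑' k, x k ^ 2)) := by
        rw [ENNReal.tsum_mul_left, ENNReal.tsum_add]
        exact mul_le_mul_right (add_le_add h1 h2) _
    _ = _ := by
        rw [mul_pow, ENNReal.ofReal_mul (by positivity), mul_comm (∑' k, w k ^ 2), ← two_mul,
          ← mul_assoc, ← mul_assoc]
        norm_num
        rfl

/-- Write `|k|^a = |k|^s |k|^{a-s}` and apply Cauchy–Schwarz: the first factor is the square root of
the dissipation `X`, the second is at most `4CR√X`. Finite support makes `X` finite. -/
lemma sum_energy_le (t : ℝ≥0) {z : (Fin 3 → ℤ) → CVec} {S : Finset (Fin 3 → ℤ)}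
    (hS : ∀ k ∉ S, z k = 0) {R : ℝ} (hR : 0 ≤ R) (hz : ellSq z ≤ ENNReal.ofReal (R ^ 2)) :
    ∑ k ∈ S, freqNorm k ^ P.a * (‖z k‖ * ‖P.nl t z z k‖) ≤
      4 * convConst * R * ∑ k ∈ S, freqNorm k ^ (2 * P.s) * ‖z k‖ ^ 2 := by
  have hs := P.s_gt
  have ha := P.a_gt
  have hs1 := P.s_le
  have hC := convConst_pos
  set X : ℝ := ∑ k ∈ S, freqNorm k ^ (2 * P.s) * ‖z k‖ ^ 2 with hX
  have hsq : ∀ k, freqNorm k ^ (2 * P.s) * ‖z k‖ ^ 2 = (freqNorm k ^ P.s * ‖z k‖) ^ 2 := by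
    intro k
    rw [mul_pow, ← Real.rpow_natCast (freqNorm k ^ P.s), ← Real.rpow_mul (freqNorm_nonneg k)]
    push_cast
    rw [mul_comm P.s]
  have hX0 : 0 ≤ X := Finset.sum_nonneg fun k _ => by rw [hsq]; positivity
  have hxx : ∑' k, (ENNReal.ofReal (freqNorm k ^ P.s) * ‖z k‖ₑ) ^ 2 = ENNReal.ofReal X := by
    rw [tsum_eq_sum (s := S) (fun k hk => by simp [hS k hk]), hX,
      ENNReal.ofReal_sum_of_nonneg (fun k _ => by rw [hsq]; positivity)]
    refine Finset.sum_congr rfl fun k _ => ?_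
    rw [hsq, ENNReal.ofReal_pow (mul_nonneg (freqNorm_rpow_nonneg _ _) (norm_nonneg _)),
      ENNReal.ofReal_mul (freqNorm_rpow_nonneg _ _), ofReal_norm]
  have hf : ∑ k ∈ S, (freqNorm k ^ (P.a - P.s) * ‖P.nl t z z k‖) ^ 2 ≤
      (4 * convConst) ^ 2 * (X * R ^ 2) := by
    have h := (P.tsum_weighted_nl_sq_le t z).trans (mul_le_mul_right (mul_le_mul_right hz _) _)
    rw [hxx, ← ENNReal.ofReal_mul hX0, ← ENNReal.ofReal_mul (by positivity)] at h
    rw [← ENNReal.ofReal_le_ofReal_iff (by positivity)]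
    refine le_trans ?_ h
    rw [ENNReal.ofReal_sum_of_nonneg (fun k _ => by positivity)]
    refine le_trans (Finset.sum_le_sum fun k _ => le_of_eq ?_) (ENNReal.sum_le_tsum S)
    rw [ENNReal.ofReal_pow (mul_nonneg (freqNorm_rpow_nonneg _ _) (norm_nonneg _)),
      ENNReal.ofReal_mul (freqNorm_rpow_nonneg _ _), ofReal_norm]
  have hcs := Finset.sum_mul_sq_le_sq_mul_sq S (fun k => freqNorm k ^ P.s * ‖z k‖)
    (fun k => freqNorm k ^ (P.a - P.s) * ‖P.nl t z z k‖)
  have hsplit : ∀ k, freqNorm k ^ P.a * (‖z k‖ * ‖P.nl t z z k‖) =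
      (freqNorm k ^ P.s * ‖z k‖) * (freqNorm k ^ (P.a - P.s) * ‖P.nl t z z k‖) := by
    intro k
    have : freqNorm k ^ P.a = freqNorm k ^ P.s * freqNorm k ^ (P.a - P.s) := by
      rw [← Real.rpow_add_of_nonneg (freqNorm_nonneg k) (by linarith) (by linarith)]
      congr 1; ring
    rw [this]; ring
  simp_rw [hsplit]
  refine le_trans (le_abs_self _) (abs_le_of_sq_le_sq (hcs.trans ?_) (by positivity))
  simp_rw [← hsq]
  rw [← hX]
  calc X * _ ≤ X * ((4 * convConst) ^ 2 * (X * R ^ 2)) := mul_le_mul_of_nonneg_left hf hX0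
    _ = _ := by ring

/-- The energy of finitely many modes does not increase along the truncated flow. -/
lemma antitoneOn_energy {z : ℝ≥0 → (Fin 3 → ℤ) → CVec} {S : Finset (Fin 3 → ℤ)}
    (hS : ∀ t, ∀ k ∉ S, z t k = 0) {R : ℝ} (hR : 0 ≤ R)
    (hz : ∀ t, ellSq (z t) ≤ ENNReal.ofReal (R ^ 2)) (hRκ : 8 * convConst * R ≤ P.κ)
    (hder : ∀ k ∈ S, ∀ t : ℝ≥0, HasDerivWithinAt (fun τ : ℝ => z τ.toNNReal k)
      (-P.rate k • z t k - (freqNorm k ^ P.a) • P.nl t (z t) (z t) k) (Set.Ici 0) t)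
    {p p' : (Fin 3 → ℤ) → ℝ → ℝ} (hp : ∀ k τ, HasDerivAt (p k) (p' k τ) τ)
    (hp' : ∀ k τ, p' k τ ≤ 0) (hp1 : ∀ k τ, 0 ≤ τ → 1 ≤ p k τ) (hp2 : ∀ k τ, 0 ≤ τ → p k τ ≤ 2) :
    AntitoneOn (fun τ : ℝ => ∑ k ∈ S, p k τ * ‖z τ.toNNReal k‖ ^ 2) (Set.Ici 0) := by
  have hd : ∀ τ : ℝ, 0 ≤ τ → HasDerivWithinAt
      (fun τ : ℝ => ∑ k ∈ S, p k τ * ‖z τ.toNNReal k‖ ^ 2)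
      (∑ k ∈ S, (p' k τ * ‖z τ.toNNReal k‖ ^ 2 + p k τ * (2 * inner ℝ (z τ.toNNReal k)
        (-P.rate k • z τ.toNNReal k - (freqNorm k ^ P.a) •
          P.nl τ.toNNReal (z τ.toNNReal) (z τ.toNNReal) k)))) (Set.Ici 0) τ := by
    intro τ hτ
    refine HasDerivWithinAt.fun_sum fun k hk => ?_
    have h := hder k hk τ.toNNReal
    rw [Real.coe_toNNReal τ hτ] at h
    exact (hp k τ).hasDerivWithinAt.mul h.norm_sq
  refine antitoneOn_of_hasDerivWithinAt_nonpos (convex_Ici 0)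
    (fun τ hτ => (hd τ hτ).continuousWithinAt)
    (fun τ hτ => (hd τ (interior_subset hτ)).mono interior_subset) (fun τ hτ => ?_)
  have hτ0 : 0 ≤ τ := interior_subset hτ
  set t := τ.toNNReal
  -- The term with `p'` is dropped; `p ≥ 1` is used for the damping and `p ≤ 2` for the nonlinear
  -- term.
  have hk : ∀ k ∈ S, p' k τ * ‖z t k‖ ^ 2 + p k τ * (2 * inner ℝ (z t k)
      (-P.rate k • z t k - (freqNorm k ^ P.a) • P.nl t (z t) (z t) k)) ≤
      -2 * P.κ * (freqNorm k ^ (2 * P.s) * ‖z t k‖ ^ 2) +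
        4 * (freqNorm k ^ P.a * (‖z t k‖ * ‖P.nl t (z t) (z t) k‖)) := by
    intro k _
    have hs := P.s_gt
    have h1 := hp1 k τ hτ0
    have h2 := hp2 k τ hτ0
    have h3 := mul_nonpos_of_nonpos_of_nonneg (hp' k τ) (sq_nonneg ‖z t k‖)
    have hr : P.κ * freqNorm k ^ (2 * P.s) ≤ P.rate k := by
      by_cases hk : k = 0
      · rw [hk, freqNorm_zero, Real.zero_rpow (by linarith), P.rate_zero, mul_zero]
      · exact P.le_rate k hk
    have hi : inner ℝ (z t k) (-P.rate k • z t k - (freqNorm k ^ P.a) •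
        P.nl t (z t) (z t) k) = -(P.rate k * ‖z t k‖ ^ 2) -
          freqNorm k ^ P.a * inner ℝ (z t k) (P.nl t (z t) (z t) k) := by
      rw [inner_sub_right, real_inner_smul_right, real_inner_smul_right,
        real_inner_self_eq_norm_sq]; ring
    rw [hi]
    have hcs := abs_le.mp (abs_real_inner_le_norm (z t k) (P.nl t (z t) (z t) k))
    have hN := freqNorm_rpow_nonneg k P.a
    set A := freqNorm k ^ P.a * (‖z t k‖ * ‖P.nl t (z t) (z t) k‖)
    have hA : 0 ≤ A := by positivity
    have h4 : -(freqNorm k ^ P.a * inner ℝ (z t k) (P.nl t (z t) (z t) k)) ≤ A := by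
      rw [← mul_neg]
      exact mul_le_mul_of_nonneg_left (by linarith [hcs.1]) hN
    set B := P.κ * freqNorm k ^ (2 * P.s) * ‖z t k‖ ^ 2
    have hB : 0 ≤ B := mul_nonneg (mul_nonneg P.κ_pos.le (freqNorm_rpow_nonneg _ _)) (sq_nonneg _)
    have h5 : B ≤ P.rate k * ‖z t k‖ ^ 2 := mul_le_mul_of_nonneg_right hr (sq_nonneg _)
    have h6 : p k τ * (2 * (-(P.rate k * ‖z t k‖ ^ 2) -
        freqNorm k ^ P.a * inner ℝ (z t k) (P.nl t (z t) (z t) k))) ≤ p k τ * (2 * (-B + A)) :=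
      mul_le_mul_of_nonneg_left (by linarith) (by linarith)
    have h7 : -2 * P.κ * (freqNorm k ^ (2 * P.s) * ‖z t k‖ ^ 2) = -2 * B := by ring
    rw [h7]
    nlinarith
  refine (Finset.sum_le_sum hk).trans ?_
  rw [Finset.sum_add_distrib, ← Finset.mul_sum, ← Finset.mul_sum]
  -- The total is at most `(-2κ + 16CR)X`, which is nonpositive by `hRκ`.
  have he := P.sum_energy_le t (hS t) hR (hz t)
  have hX : 0 ≤ ∑ k ∈ S, freqNorm k ^ (2 * P.s) * ‖z t k‖ ^ 2 :=
    Finset.sum_nonneg fun k _ => mul_nonneg (freqNorm_rpow_nonneg _ _) (sq_nonneg _)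
  nlinarith

/-! ### Existence and monotonicity by Galerkin approximation -/

/-- The family `√p_k Z_k(t)` as an element of `ℓ²`. -/
def weightedEval (p : (Fin 3 → ℤ) → ℝ) (hp : ∀ k, p k ≤ 2) (t : ℝ≥0) (z : ModeSpace) :
    lp (fun _ : Fin 3 → ℤ => CVec) 2 :=
  ⟨fun k => √(p k) • z k t, memℓp_two_iff.mpr (by
    have h : ellSq (fun k => (2 : ℝ) • z k t) ≠ ∞ := by
      have h1 : ellSq (E := CVec) (fun k => z k t) ≠ ∞ :=
        ne_top_of_le_ne_top (ellSq_coe_ne_top z) (ellSq_eval_le z t)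
      rw [ellSq_ne_top_iff] at h1 ⊢
      simpa [norm_smul, mul_pow] using h1.mul_left (2 ^ 2)
    refine ne_top_of_le_ne_top h (ellSq_mono fun k => ?_)
    rw [enorm_smul, enorm_smul]
    gcongr
    rw [Real.enorm_eq_ofReal (Real.sqrt_nonneg _), Real.enorm_eq_ofReal zero_le_two]
    exact ENNReal.ofReal_le_ofReal (Real.sqrt_le_iff.mpr ⟨by norm_num, by linarith [hp k]⟩))⟩

lemma norm_weightedEval_sq {p : (Fin 3 → ℤ) → ℝ} (hp0 : ∀ k, 0 ≤ p k) (hp : ∀ k, p k ≤ 2)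
    (t : ℝ≥0) (z : ModeSpace) :
    ‖weightedEval p hp t z‖ ^ 2 = ∑' k, p k * ‖z k t‖ ^ 2 := by
  rw [lp_norm_sq]
  refine tsum_congr fun k => ?_
  change ‖√(p k) • z k t‖ ^ 2 = _
  rw [norm_smul, mul_pow, Real.norm_of_nonneg (Real.sqrt_nonneg _), Real.sq_sqrt (hp0 k)]

/-- This carries the weighted energy at a fixed time to the limit of the Galerkin solutions. -/
lemma continuous_weightedEval (p : (Fin 3 → ℤ) → ℝ) (hp : ∀ k, p k ≤ 2)
    (t : ℝ≥0) : Continuous (weightedEval p hp t) := by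
  refine LipschitzWith.continuous (K := 2) (LipschitzWith.of_dist_le_mul fun z w => ?_)
  rw [dist_eq_norm, dist_eq_norm]
  refine lp_norm_le_of_ellSq_le (by positivity) ?_
  rw [mul_pow, ENNReal.ofReal_mul (by positivity), ← ellSq_coe, ellSq, ellSq,
    ← ENNReal.tsum_mul_left]
  refine ENNReal.tsum_le_tsum fun k => ?_
  change ‖√(p k) • z k t - √(p k) • w k t‖ₑ ^ 2 ≤ _
  rw [← smul_sub, enorm_smul, mul_pow]
  have h1 : ‖√(p k)‖ₑ ≤ ENNReal.ofReal 2 := by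
    rw [Real.enorm_eq_ofReal (Real.sqrt_nonneg _)]
    exact ENNReal.ofReal_le_ofReal (Real.sqrt_le_iff.mpr ⟨by norm_num, by linarith [hp k]⟩)
  have h2 : ‖z k t - w k t‖ₑ ≤ ‖(z - w : ModeSpace) k‖ₑ := by
    rw [← ofReal_norm, ← ofReal_norm]
    exact ENNReal.ofReal_le_ofReal (((z - w : ModeSpace) k).norm_coe_le_norm t)
  rw [NNReal.coe_ofNat, ENNReal.ofReal_pow zero_le_two]
  gcongr

/-- Existence and monotonicity for small initial data. -/
theorem exists_solution (y : lp (fun _ : Fin 3 → ℤ => CVec) 2)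
    (hsmall : 16 * convConst * ‖y‖ ≤ P.κ) {K : Set ModeSpace} (hK : IsClosed K)
    (h₀ : P.linearFlow y ∈ K) (hmaps : ∀ z ∈ K, P.linearFlow y + P.duhamelOp z z ∈ K) :
    ∃ z ∈ K, P.linearFlow y + P.duhamelOp z z = z ∧
      ∀ p p' : (Fin 3 → ℤ) → ℝ → ℝ, (∀ k τ, HasDerivAt (p k) (p' k τ) τ) →
        (∀ k τ, p' k τ ≤ 0) → (∀ k τ, 0 ≤ τ → 1 ≤ p k τ) → (∀ k τ, 0 ≤ τ → p k τ ≤ 2) →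
        Antitone fun t : ℝ≥0 => ∑' k, p k t * ‖z k t‖ ^ 2 := by
  have hκ := P.κ_pos
  have hC := convConst_pos
  set x₀ := P.linearFlow y with hx₀
  have hx₀y : ‖x₀‖ ≤ ‖y‖ := P.norm_linearFlow_le y
  have hc0 : 0 ≤ P.κ⁻¹ * (2 * convConst) := by positivity
  have hsm : ∀ x : ModeSpace, ‖x‖ ≤ ‖x₀‖ → 8 * (P.κ⁻¹ * (2 * convConst)) * ‖x‖ ≤ 1 := by
    intro x hx
    have : 16 * convConst * ‖x‖ ≤ P.κ :=
      (mul_le_mul_of_nonneg_left (hx.trans hx₀y) (by positivity)).trans hsmall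
    calc 8 * (P.κ⁻¹ * (2 * convConst)) * ‖x‖ = P.κ⁻¹ * (16 * convConst * ‖x‖) := by ring
      _ ≤ P.κ⁻¹ * P.κ := by gcongr
      _ = 1 := inv_mul_cancel₀ hκ.ne'
  obtain ⟨z, hzK, hzn, hzfix⟩ := exists_quadratic_fixedPoint P.duhamelOp_sub_left
    P.duhamelOp_sub_right hc0 P.norm_duhamelOp_le (hsm x₀ le_rfl) hK h₀ hmaps
  refine ⟨z, hzK, hzfix, fun p p' hp hp' hp1 hp2 => ?_⟩
  -- Galerkin solutions: truncation does not increase norms, so the same smallness condition serves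
  -- for every finite set of modes.
  have hgal : ∀ S : Finset (Fin 3 → ℤ), ∃ w : ModeSpace, ‖w‖ ≤ 2 * ‖x₀‖ ∧
      truncation S (x₀ + P.duhamelOp w w) = w := by
    intro S
    have hn := norm_truncation_le S x₀
    obtain ⟨w, -, hw, hfix⟩ := exists_quadratic_fixedPoint
      (T := fun u v => truncation S (P.duhamelOp u v)) (x₀ := truncation S x₀)
      (fun u v w => by rw [P.duhamelOp_sub_left, truncation_sub])
      (fun u v w => by rw [P.duhamelOp_sub_right, truncation_sub]) hc0
      (fun u v => (norm_truncation_le S _).trans (P.norm_duhamelOp_le u v)) (hsm _ hn)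
      isClosed_univ (Set.mem_univ _) (fun _ _ => Set.mem_univ _)
    exact ⟨w, hw.trans (by linarith), by rw [truncation_add, hfix]⟩
  choose w hwn hwfix using hgal
  have hlim : Filter.Tendsto w Filter.atTop (nhds z) := by
    rw [tendsto_iff_norm_sub_tendsto_zero]
    have h1 : Filter.Tendsto (fun S => 2 * ‖truncation S z - z‖) Filter.atTop (nhds 0) := by
      simpa using (tendsto_iff_norm_sub_tendsto_zero.mp (tendsto_truncation z)).const_mul 2
    refine squeeze_zero (fun S => norm_nonneg _) (fun S => ?_) h1
    exact norm_sub_le_of_projected P.duhamelOp_sub_left P.duhamelOp_sub_right hc0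
      P.norm_duhamelOp_le (hsm x₀ le_rfl)
      (fun u v => by rw [← truncation_sub]; exact norm_truncation_le S _) hzn (hwn S) hzfix
      (hwfix S)
  have hp0 : ∀ (t : ℝ≥0) k, 0 ≤ p k t := fun t k => zero_le_one.trans (hp1 k t t.2)
  have hlimt : ∀ t : ℝ≥0, Filter.Tendsto (fun S => ∑' k, p k t * ‖w S k t‖ ^ 2) Filter.atTop
      (nhds (∑' k, p k t * ‖z k t‖ ^ 2)) := by
    intro t
    have h := ((continuous_weightedEval (fun k => p k t) (fun k => hp2 k t t.2) t).norm.pow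
      2).tendsto z |>.comp hlim
    refine (h.congr fun S => ?_).trans (le_of_eq (congrArg nhds ?_))
    · exact norm_weightedEval_sq (hp0 t) _ t (w S)
    · exact norm_weightedEval_sq (hp0 t) _ t z
  intro t₁ t₂ ht
  refine le_of_tendsto_of_tendsto' (hlimt t₂) (hlimt t₁) fun S => ?_
  have hwS : ∀ t, ∀ k ∉ S, w S k t = 0 := by
    intro t k hk
    rw [← hwfix S, truncation_apply, if_neg hk]; rfl
  -- The radius `R = 2‖x₀‖` gives `8CR ≤ 16C‖y‖ ≤ κ`: the condition for the contraction is also the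
  -- one needed for monotonicity.
  have hanti := P.antitoneOn_energy (z := fun t k => w S k t) (S := S) hwS
    (R := 2 * ‖x₀‖) (by positivity)
    (fun t => (ellSq_eval_le (w S) t).trans (by
      rw [ellSq_coe]
      exact ENNReal.ofReal_le_ofReal (pow_le_pow_left₀ (norm_nonneg _) (hwn S) 2)))
    (by nlinarith) (fun k hk t => by
      have h := P.hasDerivWithinAt_rhs y (w S) k t
      have he : ∀ u, (x₀ + P.duhamelOp (w S) (w S)) k u = w S k u := fun u => by
        conv_rhs => rw [← hwfix S, truncation_apply, if_pos hk]
      rw [← hx₀] at h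
      simpa only [he] using h) hp hp' hp1 hp2
  have hts : ∀ t : ℝ≥0, ∑' k, p k t * ‖w S k t‖ ^ 2 = ∑ k ∈ S, p k t * ‖w S k t‖ ^ 2 :=
    fun t => tsum_eq_sum fun k hk => by simp [hwS t k hk]
  rw [hts, hts]
  simpa using hanti (Set.mem_Ici.mpr t₁.2) (Set.mem_Ici.mpr t₂.2) (NNReal.coe_le_coe.mpr ht)

end ModeFlow

/-! ### Uniqueness -/

/-- Integrating gives `0 ≤ φ(T) ≤ b ∫ (δG - φ)`, and `b > 0` is divided out. The resulting bound
does not see the damping rate, so it can be summed over modes whose rates are unbounded. -/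
lemma lintegral_le_of_deriv_le {T b δ B : ℝ} (hT : 0 ≤ T) (hb : 0 < b)
    {φ φ' G : ℝ → ℝ} (hφ0 : φ 0 = 0) (hφ : ∀ τ, 0 ≤ φ τ) (hc : Continuous φ)
    (hd : ∀ τ ∈ Set.Ioo 0 T, HasDerivWithinAt φ (φ' τ) (Set.Ioi τ) τ) (hG : Measurable G)
    (hG0 : ∀ τ, 0 ≤ G τ) (hGB : ∀ τ ∈ Set.Icc 0 T, G τ ≤ B) (hδ : 0 ≤ δ)
    (h : ∀ τ ∈ Set.Ioo 0 T, φ' τ ≤ b * (δ * G τ - φ τ)) :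
    ∫⁻ τ in Set.Icc 0 T, ENNReal.ofReal (φ τ) ≤
      ENNReal.ofReal δ * ∫⁻ τ in Set.Icc 0 T, ENNReal.ofReal (G τ) := by
  have hGi : IntegrableOn G (Set.Icc 0 T) := by
    refine Measure.integrableOn_of_bounded (M := B) (by simp) hG.aestronglyMeasurable ?_
    filter_upwards [ae_restrict_mem measurableSet_Icc] with τ hτ
    rw [Real.norm_of_nonneg (hG0 τ)]
    exact hGB τ hτ
  have hφi : IntegrableOn φ (Set.Icc 0 T) := hc.continuousOn.integrableOn_Icc
  have h1 := intervalIntegral.sub_le_integral_of_hasDeriv_right_of_le hT hc.continuousOn hd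
    (((hGi.const_mul δ).sub hφi).const_mul b) h
  rw [intervalIntegral.integral_of_le hT, ← integral_Icc_eq_integral_Ioc, integral_const_mul,
    hφ0, sub_zero] at h1
  have h2 : ∫ τ in Set.Icc 0 T, (δ * G τ - φ τ) =
      δ * (∫ τ in Set.Icc 0 T, G τ) - ∫ τ in Set.Icc 0 T, φ τ := by
    rw [integral_sub (hGi.const_mul δ) hφi, integral_const_mul]
  change φ T ≤ b * ∫ τ in Set.Icc 0 T, (δ * G τ - φ τ) at h1
  have h3 : 0 ≤ ∫ τ in Set.Icc 0 T, (δ * G τ - φ τ) :=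
    (mul_nonneg_iff_of_pos_left hb).mp ((hφ T).trans h1)
  rw [h2] at h3
  rw [← ofReal_integral_eq_lintegral_ofReal hφi (Filter.Eventually.of_forall hφ),
    ← ofReal_integral_eq_lintegral_ofReal hGi (Filter.Eventually.of_forall hG0),
    ← ENNReal.ofReal_mul hδ]
  exact ENNReal.ofReal_le_ofReal (by linarith)

lemma continuous_toNNReal_of_continuousOn {E : Type*} [TopologicalSpace E] {f : ℝ≥0 → E}
    (h : ContinuousOn (fun τ : ℝ => f τ.toNNReal) (Set.Ici 0)) :
    Continuous fun τ : ℝ => f τ.toNNReal := by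
  have h1 : Continuous fun τ : ℝ => f (max τ 0).toNNReal :=
    h.comp_continuous (by fun_prop) fun τ => le_max_right τ 0
  refine h1.congr fun τ => ?_
  congr 1
  ext
  simp

lemma ellSq_sub_le {E : Type*} [NormedAddCommGroup E] (z w : (Fin 3 → ℤ) → E) :
    ellSq (z - w) ≤ 2 * (ellSq z + ellSq w) := by
  rw [ellSq, ellSq, ellSq, ← ENNReal.tsum_add, ← ENNReal.tsum_mul_left]
  exact ENNReal.tsum_le_tsum fun k =>
    (pow_le_pow_left₀ zero_le enorm_sub_le 2).trans (ennreal_add_sq_le _ _)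

namespace ModeFlow

variable (P : ModeFlow)

/-- Since `a < 2s`, the quotient `|k|^{a-2s}` is below `εκ` beyond some radius `R`; smaller
frequencies are covered by `μ = R^a/ε`. -/
lemma exists_absorption {ε : ℝ} (hε : 0 < ε) : ∃ μ : ℝ, 0 < μ ∧ ∀ k : Fin 3 → ℤ,
    freqNorm k ^ P.a ≤ ε * (μ + P.κ * freqNorm k ^ (2 * P.s)) := by
  have hκ := P.κ_pos
  have ha := P.a_gt
  have ha2 := P.a_lt
  have h1 := (tendsto_rpow_neg_atTop (y := 2 * P.s - P.a) (by linarith)).eventually_lt_const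
    (mul_pos hε hκ)
  obtain ⟨R, hR1⟩ := (h1.and (Filter.eventually_ge_atTop 1)).exists_forall_of_atTop
  have hRp : 0 < R := by linarith [(hR1 R le_rfl).2]
  refine ⟨R ^ P.a / ε, by positivity, fun k => ?_⟩
  have hN := freqNorm_rpow_nonneg k (2 * P.s)
  by_cases hk : freqNorm k ≤ R
  · have h2 := Real.rpow_le_rpow (freqNorm_nonneg k) hk (by linarith : 0 ≤ P.a)
    rw [mul_add, mul_div_cancel₀ _ hε.ne']
    have : 0 ≤ ε * (P.κ * freqNorm k ^ (2 * P.s)) := by positivity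
    linarith
  · push Not at hk
    have hkp : 0 < freqNorm k := hRp.trans hk
    have h3 := (hR1 _ hk.le).1
    have h4 : freqNorm k ^ P.a = freqNorm k ^ (-(2 * P.s - P.a)) * freqNorm k ^ (2 * P.s) := by
      rw [← Real.rpow_add hkp]; congr 1; ring
    have h5 : freqNorm k ^ (-(2 * P.s - P.a)) * freqNorm k ^ (2 * P.s) ≤
        ε * P.κ * freqNorm k ^ (2 * P.s) := by gcongr
    have : 0 ≤ R ^ P.a := by positivity
    rw [mul_add, mul_div_cancel₀ _ hε.ne', h4]
    linarith

/-- The equation satisfied by the modes. -/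
def IsModeSolution (z : ℝ≥0 → (Fin 3 → ℤ) → CVec) : Prop :=
  ∀ k, ∀ t : ℝ≥0, HasDerivWithinAt (fun τ : ℝ => z τ.toNNReal k)
    (-P.rate k • z t k - (freqNorm k ^ P.a) • P.nl t (z t) (z t) k) (Set.Ici 0) t

variable {P}

lemma IsModeSolution.continuous {z : ℝ≥0 → (Fin 3 → ℤ) → CVec} (hz : P.IsModeSolution z)
    (k : Fin 3 → ℤ) : Continuous fun τ : ℝ => z τ.toNNReal k := by
  refine continuous_toNNReal_of_continuousOn (f := fun t => z t k) fun τ hτ => ?_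
  have := (hz k τ.toNNReal).continuousWithinAt
  rwa [Real.coe_toNNReal τ hτ] at this

/-- A majorant of the difference of the nonlinearities of `z` and `w`. -/
def nlDiffBound (z w : (Fin 3 → ℤ) → CVec) (k : Fin 3 → ℤ) : ℝ≥0∞ :=
  2 * conv (fun j => ‖z j - w j‖ₑ) (fun j => ‖z j‖ₑ) k +
    2 * conv (fun j => ‖w j‖ₑ) (fun j => ‖z j - w j‖ₑ) k

lemma enorm_nl_sub_nl_le (t : ℝ≥0) {z w : (Fin 3 → ℤ) → CVec} (hz : ellSq z ≠ ∞)
    (hw : ellSq w ≠ ∞) (k : Fin 3 → ℤ) :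
    ‖P.nl t z z k - P.nl t w w k‖ₑ ≤ nlDiffBound z w k := by
  rw [P.nl_sub_nl t hz hw (ellSq_sub_ne_top hz hw)]
  exact (enorm_add_le _ _).trans (add_le_add (P.enorm_nl_le t _ _ k) (P.enorm_nl_le t _ _ k))

lemma tsum_nlDiffBound_sq_le {z w : (Fin 3 → ℤ) → CVec} {M : ℝ≥0∞} (hz : ellSq z ≤ M)
    (hw : ellSq w ≤ M) : ∑' k, nlDiffBound z w k ^ 2 ≤
      16 * ENNReal.ofReal (convConst ^ 2) * M * ellSq (z - w) := by
  have h1 := tsum_conv_sq_le (fun j => ‖z j - w j‖ₑ) (fun j => ‖z j‖ₑ)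
  have h2 := tsum_conv_sq_le (fun j => ‖w j‖ₑ) (fun j => ‖z j - w j‖ₑ)
  calc ∑' k, nlDiffBound z w k ^ 2
      ≤ ∑' k, 8 * (conv (fun j => ‖z j - w j‖ₑ) (fun j => ‖z j‖ₑ) k ^ 2 +
          conv (fun j => ‖w j‖ₑ) (fun j => ‖z j - w j‖ₑ) k ^ 2) := by
        refine ENNReal.tsum_le_tsum fun k => (ennreal_add_sq_le _ _).trans (le_of_eq ?_)
        rw [mul_pow, mul_pow, ← mul_add, ← mul_assoc]; norm_num
    _ ≤ 8 * (ENNReal.ofReal (convConst ^ 2) * (ellSq (z - w) * M) +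
          ENNReal.ofReal (convConst ^ 2) * (M * ellSq (z - w))) := by
        rw [ENNReal.tsum_mul_left, ENNReal.tsum_add]
        refine mul_le_mul_right (add_le_add (h1.trans ?_) (h2.trans ?_)) _
        · exact mul_le_mul_right (mul_le_mul_right hz _) _
        · exact mul_le_mul_right (mul_le_mul_left hw _) _
    _ = _ := by ring

lemma measurable_nlDiffBound {z w : ℝ≥0 → (Fin 3 → ℤ) → CVec} (hz : P.IsModeSolution z)
    (hw : P.IsModeSolution w) (k : Fin 3 → ℤ) :
    Measurable fun τ : ℝ => nlDiffBound (z τ.toNNReal) (w τ.toNNReal) k := by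
  have h1 : ∀ j, Measurable fun τ : ℝ => ‖z τ.toNNReal j‖ₑ := fun j =>
    (hz.continuous j).enorm.measurable
  have h2 : ∀ j, Measurable fun τ : ℝ => ‖w τ.toNNReal j‖ₑ := fun j =>
    (hw.continuous j).enorm.measurable
  have h3 : ∀ j, Measurable fun τ : ℝ => ‖z τ.toNNReal j - w τ.toNNReal j‖ₑ := fun j =>
    ((hz.continuous j).sub (hw.continuous j)).enorm.measurable
  unfold nlDiffBound conv
  refine ((Measurable.tsum fun j => ?_).const_mul 2).add
    ((Measurable.tsum fun j => ?_).const_mul 2)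
  · exact ((h3 j).mul (h1 (k - j))).const_mul _
  · exact ((h2 j).mul (h3 (k - j))).const_mul _

/-- Two solutions which are locally bounded in `ℓ²` and agree initially are equal. -/
theorem IsModeSolution.unique {z w : ℝ≥0 → (Fin 3 → ℤ) → CVec} (hz : P.IsModeSolution z)
    (hw : P.IsModeSolution w)
    (hzb : ∀ T : ℝ≥0, ∃ M : ℝ, ∀ t ≤ T, ellSq (z t) ≤ ENNReal.ofReal M)
    (hwb : ∀ T : ℝ≥0, ∃ M : ℝ, ∀ t ≤ T, ellSq (w t) ≤ ENNReal.ofReal M) (h0 : z 0 = w 0) :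
    z = w := by
  have hC := convConst_pos
  have hs := P.s_gt
  suffices H : ∀ T : ℝ≥0, 0 < T → z T = w T by
    funext t
    rcases eq_zero_or_pos t with rfl | ht
    · exact h0
    · exact H t ht
  intro T hT
  obtain ⟨M₁, hM₁⟩ := hzb T
  obtain ⟨M₂, hM₂⟩ := hwb T
  set M := max 1 (max M₁ M₂) with hM
  have hM0 : 0 < M := lt_max_of_lt_left one_pos
  have hzM : ∀ τ ∈ Set.Icc (0 : ℝ) T, ellSq (z τ.toNNReal) ≤ ENNReal.ofReal M := fun τ hτ =>
    (hM₁ _ (Real.toNNReal_le_iff_le_coe.mpr hτ.2)).trans (ENNReal.ofReal_le_ofReal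
      ((le_max_left _ _).trans (le_max_right _ _)))
  have hwM : ∀ τ ∈ Set.Icc (0 : ℝ) T, ellSq (w τ.toNNReal) ≤ ENNReal.ofReal M := fun τ hτ =>
    (hM₂ _ (Real.toNNReal_le_iff_le_coe.mpr hτ.2)).trans (ENNReal.ofReal_le_ofReal
      ((le_max_right _ _).trans (le_max_right _ _)))
  set L : ℝ := 16 * convConst ^ 2 * M with hL
  have hL0 : 0 < L := by positivity
  -- `L` bounds the quadratic difference on `[0,T]`; `ε` is chosen so that the final inequality
  -- gains a factor `1/2`.
  obtain ⟨ε, hε, hεL⟩ : ∃ ε : ℝ, 0 < ε ∧ 4 * ε ^ 2 * L ≤ 1 / 2 := by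
    refine ⟨1 / (1 + 8 * L), by positivity, ?_⟩
    rw [div_pow, one_pow, mul_one_div, div_mul_eq_mul_div, div_le_iff₀ (by positivity)]
    nlinarith
  obtain ⟨μ, hμ, hμk⟩ := P.exists_absorption hε
  set D : ℝ → (Fin 3 → ℤ) → CVec := fun τ => z τ.toNNReal - w τ.toNNReal with hD
  have hDM : ∀ τ ∈ Set.Icc (0 : ℝ) T, ellSq (D τ) ≤ ENNReal.ofReal (4 * M) := fun τ hτ => by
    refine (ellSq_sub_le _ _).trans ?_
    refine (mul_le_mul_right (add_le_add (hzM τ hτ) (hwM τ hτ)) _).trans (le_of_eq ?_)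
    rw [← ENNReal.ofReal_add hM0.le hM0.le, ← ENNReal.ofReal_ofNat,
      ← ENNReal.ofReal_mul (by positivity)]
    congr 1; ring
  set g : (Fin 3 → ℤ) → ℝ → ℝ≥0∞ := fun k τ => nlDiffBound (z τ.toNNReal) (w τ.toNNReal) k with hg
  have hgm : ∀ k, Measurable (g k) := measurable_nlDiffBound hz hw
  have hgs : ∀ τ ∈ Set.Icc (0 : ℝ) T, ∑' k, g k τ ^ 2 ≤ ENNReal.ofReal L * ellSq (D τ) := by
    intro τ hτ
    refine (tsum_nlDiffBound_sq_le (hzM τ hτ) (hwM τ hτ)).trans (le_of_eq ?_)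
    rw [hL, ENNReal.ofReal_mul (by positivity), ENNReal.ofReal_mul (by positivity)]
    simp [hD]
  have hgB : ∀ k, ∀ τ ∈ Set.Icc (0 : ℝ) T, g k τ ^ 2 ≤ ENNReal.ofReal (L * (4 * M)) := by
    intro k τ hτ
    refine ((ENNReal.le_tsum k).trans (hgs τ hτ)).trans ?_
    rw [ENNReal.ofReal_mul hL0.le]
    exact mul_le_mul_right (hDM τ hτ) _
  set φ : (Fin 3 → ℤ) → ℝ → ℝ := fun k τ => Real.exp (-μ * τ) * ‖D τ k‖ ^ 2 with hφ
  set G : (Fin 3 → ℤ) → ℝ → ℝ := fun k τ => Real.exp (-μ * τ) * (g k τ).toReal ^ 2 with hG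
  have hDc : ∀ k, Continuous fun τ => D τ k := fun k => (hz.continuous k).sub (hw.continuous k)
  have hφc : ∀ k, Continuous (φ k) := fun k => by
    have := hDc k
    simp only [hφ]
    fun_prop
  have hφ0 : ∀ k τ, 0 ≤ φ k τ := fun k τ => by positivity
  -- Each mode is integrated separately, since the bounds available do not allow the energy series
  -- to be differentiated. The weight `e^{-μτ}` raises the damping to `b = μ + 2κ|k|^{2s}`; half of
  -- it absorbs the nonlinear term by Young's inequality, and `lintegral_le_of_deriv_le` is applied
  -- with the other half.
  have hmode : ∀ k, ∫⁻ τ in Set.Icc (0 : ℝ) T, ENNReal.ofReal (φ k τ) ≤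
      ENNReal.ofReal (4 * ε ^ 2) * ∫⁻ τ in Set.Icc (0 : ℝ) T, ENNReal.ofReal (G k τ) := by
    intro k
    have hN := freqNorm_rpow_nonneg k (2 * P.s)
    have hNa := freqNorm_rpow_nonneg k P.a
    have hκ := P.κ_pos
    set b : ℝ := μ + 2 * (P.κ * freqNorm k ^ (2 * P.s)) with hb
    have hb0 : 0 < b := by positivity
    have hr : P.κ * freqNorm k ^ (2 * P.s) ≤ P.rate k := by
      by_cases hk : k = 0
      · rw [hk, freqNorm_zero, Real.zero_rpow (by linarith), P.rate_zero, mul_zero]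
      · exact P.le_rate k hk
    refine lintegral_le_of_deriv_le (T := T) (b := b / 2) (B := L * (4 * M)) T.2 (by positivity)
      (φ' := fun τ => Real.exp (-μ * τ) * -μ * ‖D τ k‖ ^ 2 +
        Real.exp (-μ * τ) * (2 * inner ℝ (D τ k)
          ((-P.rate k • z τ.toNNReal k - (freqNorm k ^ P.a) •
            P.nl τ.toNNReal (z τ.toNNReal) (z τ.toNNReal) k) -
          (-P.rate k • w τ.toNNReal k - (freqNorm k ^ P.a) •
            P.nl τ.toNNReal (w τ.toNNReal) (w τ.toNNReal) k)))) ?_ (hφ0 k) (hφc k) ?_ ?_ ?_ ?_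
      (by positivity) ?_
    · simp [hφ, hD, h0]
    · intro τ hτ
      have h1 := hz k τ.toNNReal
      have h2 := hw k τ.toNNReal
      rw [Real.coe_toNNReal τ hτ.1.le] at h1 h2
      have h3 : HasDerivAt (fun τ : ℝ => Real.exp (-μ * τ)) (Real.exp (-μ * τ) * -μ) τ := by
        simpa using ((hasDerivAt_id τ).const_mul (-μ)).exp
      exact (h3.hasDerivWithinAt.mul (h1.sub h2).norm_sq).mono
        (Set.Ioi_subset_Ici hτ.1.le)
    · have := (hgm k).ennreal_toReal
      simp only [hG]
      fun_prop
    · intro τ; positivity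
    · intro τ hτ
      have h1 : Real.exp (-μ * τ) ≤ 1 := Real.exp_le_one_iff.mpr (by nlinarith [hτ.1])
      have h2 : (g k τ).toReal ^ 2 ≤ L * (4 * M) := by
        rw [← ENNReal.toReal_pow]
        exact ENNReal.toReal_le_of_le_ofReal (by positivity) (hgB k τ hτ)
      calc G k τ ≤ 1 * (L * (4 * M)) := by
            simp only [hG]
            gcongr
        _ = _ := one_mul _
    · intro τ hτ
      have hτ' : τ ∈ Set.Icc (0 : ℝ) T := ⟨hτ.1.le, hτ.2.le⟩
      set t := τ.toNNReal
      set nd := P.nl t (z t) (z t) k - P.nl t (w t) (w t) k with hnd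
      have hle : ‖nd‖ ≤ (g k τ).toReal := by
        have h1 : ‖nd‖ₑ ≤ g k τ := enorm_nl_sub_nl_le t
          (ne_top_of_le_ne_top ENNReal.ofReal_ne_top (hzM τ hτ'))
          (ne_top_of_le_ne_top ENNReal.ofReal_ne_top (hwM τ hτ')) k
        have h2 : g k τ ≠ ∞ := by
          have := ne_top_of_le_ne_top ENNReal.ofReal_ne_top (hgB k τ hτ')
          simpa using this
        simpa using ENNReal.toReal_mono h2 h1
      have hi : inner ℝ (D τ k) ((-P.rate k • z t k - (freqNorm k ^ P.a) •
            P.nl t (z t) (z t) k) - (-P.rate k • w t k - (freqNorm k ^ P.a) •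
            P.nl t (w t) (w t) k)) =
          -(P.rate k * ‖D τ k‖ ^ 2) - freqNorm k ^ P.a * inner ℝ (D τ k) nd := by
        have : (-P.rate k • z t k - (freqNorm k ^ P.a) •
            P.nl t (z t) (z t) k) - (-P.rate k • w t k - (freqNorm k ^ P.a) •
            P.nl t (w t) (w t) k) = -P.rate k • D τ k - (freqNorm k ^ P.a) • nd := by
          simp only [hnd, hD, Pi.sub_apply]
          module
        rw [this, inner_sub_right, real_inner_smul_right, real_inner_smul_right,
          real_inner_self_eq_norm_sq]; ring
      rw [hi]
      have hcs := (abs_le.mp (abs_real_inner_le_norm (D τ k) nd)).1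
      set x := ‖D τ k‖ with hx
      set y := (g k τ).toReal with hy
      have hx0 : 0 ≤ x := norm_nonneg _
      have hy0 : 0 ≤ y := ENNReal.toReal_nonneg
      have hA : 2 * freqNorm k ^ P.a ≤ 2 * ε * b := by
        have := hμk k
        have h2 : ε * (μ + P.κ * freqNorm k ^ (2 * P.s)) ≤ ε * b :=
          mul_le_mul_of_nonneg_left (by rw [hb]; linarith [mul_nonneg hκ.le hN]) hε.le
        linarith
      have h4 : -(freqNorm k ^ P.a * inner ℝ (D τ k) nd) ≤ freqNorm k ^ P.a * (x * y) := by
        rw [← mul_neg]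
        refine mul_le_mul_of_nonneg_left ?_ hNa
        have := mul_le_mul_of_nonneg_left hle hx0
        linarith
      have h5 : 2 * freqNorm k ^ P.a * (x * y) ≤ 2 * ε * b * (x * y) := by gcongr
      have h6 : 2 * ε * b * (x * y) ≤ b / 2 * (4 * ε ^ 2 * y ^ 2) + b / 2 * x ^ 2 := by
        nlinarith [mul_nonneg hb0.le (sq_nonneg (x - 2 * ε * y))]
      have h7 : P.κ * freqNorm k ^ (2 * P.s) * x ^ 2 ≤ P.rate k * x ^ 2 := by gcongr
      have h8 : -μ * x ^ 2 + 2 * (-(P.rate k * x ^ 2) -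
          freqNorm k ^ P.a * inner ℝ (D τ k) nd) ≤ b / 2 * (4 * ε ^ 2 * y ^ 2 - x ^ 2) := by
        have : b * x ^ 2 = μ * x ^ 2 + 2 * (P.κ * freqNorm k ^ (2 * P.s) * x ^ 2) := by
          rw [hb]; ring
        linarith
      have h9 := mul_le_mul_of_nonneg_left h8 (Real.exp_pos (-μ * τ)).le
      calc _ = Real.exp (-μ * τ) * (-μ * x ^ 2 + 2 * (-(P.rate k * x ^ 2) -
          freqNorm k ^ P.a * inner ℝ (D τ k) nd)) := by ring
        _ ≤ _ := h9
        _ = _ := by simp only [hφ, hG]; ring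
  have hφm : ∀ k, Measurable fun τ => ENNReal.ofReal (φ k τ) := fun k =>
    (hφc k).measurable.ennreal_ofReal
  have hGm : ∀ k, Measurable fun τ => ENNReal.ofReal (G k τ) := fun k => by
    have h1 : Measurable fun τ => (g k τ).toReal := (hgm k).ennreal_toReal
    simp only [hG]
    fun_prop
  set I := ∫⁻ τ in Set.Icc (0 : ℝ) T, ∑' k, ENNReal.ofReal (φ k τ) with hI
  have hφsum : ∀ τ, ∑' k, ENNReal.ofReal (φ k τ) =
      ENNReal.ofReal (Real.exp (-μ * τ)) * ellSq (D τ) := by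
    intro τ
    rw [ellSq, ← ENNReal.tsum_mul_left]
    refine tsum_congr fun k => ?_
    rw [ENNReal.ofReal_mul (Real.exp_pos _).le, ENNReal.ofReal_pow (norm_nonneg _), ofReal_norm]
  -- Summing over `k` by Tonelli returns the same integral, because the `ℓ²` bound on the nonlinear
  -- difference loses no derivative.
  have hII : I ≤ ENNReal.ofReal (1 / 2) * I := by
    calc I = ∑' k, ∫⁻ τ in Set.Icc (0 : ℝ) T, ENNReal.ofReal (φ k τ) :=
          lintegral_tsum fun k => (hφm k).aemeasurable
      _ ≤ ∑' k, ENNReal.ofReal (4 * ε ^ 2) * ∫⁻ τ in Set.Icc (0 : ℝ) T, ENNReal.ofReal (G k τ) :=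
          ENNReal.tsum_le_tsum hmode
      _ = ENNReal.ofReal (4 * ε ^ 2) *
          ∫⁻ τ in Set.Icc (0 : ℝ) T, ∑' k, ENNReal.ofReal (G k τ) := by
          rw [ENNReal.tsum_mul_left, lintegral_tsum fun k => (hGm k).aemeasurable]
      _ ≤ ENNReal.ofReal (4 * ε ^ 2) * ∫⁻ τ in Set.Icc (0 : ℝ) T,
          ENNReal.ofReal L * ∑' k, ENNReal.ofReal (φ k τ) := by
          refine mul_le_mul_right (setLIntegral_mono' measurableSet_Icc fun τ hτ => ?_) _
          rw [hφsum, mul_left_comm]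
          refine le_trans ?_ (mul_le_mul_right (hgs τ hτ) _)
          rw [← ENNReal.tsum_mul_left]
          refine ENNReal.tsum_le_tsum fun k => ?_
          rw [ENNReal.ofReal_mul (Real.exp_pos _).le, ENNReal.ofReal_pow ENNReal.toReal_nonneg]
          gcongr
          exact ENNReal.ofReal_toReal_le
      _ = ENNReal.ofReal (4 * ε ^ 2 * L) * I := by
          rw [lintegral_const_mul _ (Measurable.tsum hφm), ← mul_assoc,
            ← ENNReal.ofReal_mul (by positivity)]
      _ ≤ _ := mul_le_mul_left (ENNReal.ofReal_le_ofReal hεL) _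
  -- Finiteness, from the local `ℓ²` bounds, is indispensable: `I ≤ I/2` alone would allow `I = ∞`.
  have hIfin : I ≠ ∞ := by
    have h1 : I ≤ ∫⁻ _ in Set.Icc (0 : ℝ) T, ENNReal.ofReal (4 * M) := by
      refine setLIntegral_mono' measurableSet_Icc fun τ hτ => ?_
      rw [hφsum]
      refine mul_le_of_le_one_of_le ?_ (hDM τ hτ)
      rw [← ENNReal.ofReal_one]
      exact ENNReal.ofReal_le_ofReal (Real.exp_le_one_iff.mpr (by nlinarith [hτ.1]))
    refine ne_top_of_le_ne_top ?_ h1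
    rw [setLIntegral_const]
    exact ENNReal.mul_ne_top ENNReal.ofReal_ne_top (by simp)
  have hI0 : I = 0 := by
    have h1 := ENNReal.toReal_mono (ENNReal.mul_ne_top ENNReal.ofReal_ne_top hIfin) hII
    rw [ENNReal.toReal_mul, ENNReal.toReal_ofReal (by norm_num)] at h1
    have h2 : I.toReal = 0 := le_antisymm (by linarith) ENNReal.toReal_nonneg
    exact (ENNReal.toReal_eq_zero_iff I).mp h2 |>.resolve_right hIfin
  rw [hI, lintegral_eq_zero_iff (Measurable.tsum hφm)] at hI0
  funext k
  have hae : φ k =ᵐ[volume.restrict (Set.Icc (0 : ℝ) T)] fun _ => 0 := by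
    filter_upwards [hI0] with τ hτ
    have h1 := (ENNReal.tsum_eq_zero.mp hτ) k
    exact le_antisymm (ENNReal.ofReal_eq_zero.mp h1) (hφ0 k τ)
  have hTne : (0 : ℝ) ≠ T := (NNReal.coe_pos.mpr hT).ne
  -- Continuity upgrades vanishing almost everywhere to vanishing at the endpoint `T`; the interval
  -- must be nondegenerate.
  have h1 := Measure.eqOn_Icc_of_ae_eq volume hTne hae (hφc k).continuousOn
    continuousOn_const (Set.right_mem_Icc.mpr T.2)
  have h2 : D T k = 0 := by
    have h3 := (mul_eq_zero.mp h1).resolve_left (Real.exp_pos _).ne'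
    simpa using h3
  simpa [hD, sub_eq_zero] using h2

end ModeFlow

/-! ### Fourier coefficients on the torus -/

lemma norm_mFourier_apply (n : Fin 3 → ℤ) (x : Torus) : ‖mFourier n x‖ = 1 := by
  simp only [mFourier, fourier_apply, ContinuousMap.coe_mk, norm_prod, Circle.norm_coe,
    Finset.prod_const_one]

lemma measurable_mFourier (n : Fin 3 → ℤ) : Measurable (mFourier n : Torus → ℂ) :=
  (mFourier n).continuous.measurable

lemma mFourier_mul (m n : Fin 3 → ℤ) (x : Torus) :
    mFourier m x * mFourier n x = mFourier (m + n) x := UnitAddTorus.mFourier_add.symm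

lemma integral_fourier (n : ℤ) :
    ∫ x : UnitAddCircle, fourier n x ∂AddCircle.haarAddCircle = if n = 0 then 1 else 0 := by
  have h := (orthonormal_iff_ite.mp (orthonormal_fourier (T := 1))) 0 n
  rw [ContinuousMap.inner_toLp] at h
  simpa [eq_comm] using h

lemma integral_mFourier (n : Fin 3 → ℤ) :
    ∫ x, mFourier n x ∂torusMeasure = if n = 0 then 1 else 0 := by
  have h : ∫ x, mFourier n x ∂torusMeasure = ∏ i, ∫ x : UnitAddCircle, fourier (n i) x
      ∂AddCircle.haarAddCircle :=
    integral_fintype_prod_eq_prod (fun i (x : UnitAddCircle) => (fourier (n i) x : ℂ))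
  rw [h]
  simp only [integral_fourier, Finset.prod_ite_zero, Finset.prod_const_one]
  congr 1
  simp [funext_iff]

lemma coef_congr {f g : Torus → ℝ} (h : f =ᵐ[torusMeasure] g) (n : Fin 3 → ℤ) :
    coef f n = coef g n := by
  refine integral_congr_ae ?_
  filter_upwards [h] with x hx
  rw [hx]

lemma integrable_mFourier_mul {f : Torus → ℝ} (hf : Integrable f torusMeasure)
    (n : Fin 3 → ℤ) : Integrable (fun x => mFourier n x * (f x : ℂ)) torusMeasure :=
  hf.ofReal.bdd_mul (measurable_mFourier n).aestronglyMeasurable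
    (Filter.Eventually.of_forall fun x => (norm_mFourier_apply n x).le)

lemma coef_add {f g : Torus → ℝ} (hf : Integrable f torusMeasure)
    (hg : Integrable g torusMeasure) (n : Fin 3 → ℤ) :
    coef (fun x => f x + g x) n = coef f n + coef g n := by
  rw [coef, coef, coef, ← integral_add (integrable_mFourier_mul hf _)
    (integrable_mFourier_mul hg _)]
  congr 1; funext x; push_cast; ring

lemma coef_neg (f : Torus → ℝ) (n : Fin 3 → ℤ) : coef f (-n) = conj (coef f n) := by
  rw [coef, coef, ← integral_conj]
  congr 1; funext x
  rw [map_mul, Complex.conj_ofReal, ← UnitAddTorus.mFourier_neg]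

lemma coef_zero (f : Torus → ℝ) : coef f 0 = ((∫ x, f x ∂torusMeasure : ℝ) : ℂ) := by
  rw [coef, ← integral_complex_ofReal]
  simp [UnitAddTorus.mFourier_zero]

/-- Fourier coefficients determine a square integrable function. -/
lemma ae_eq_of_coef_eq {f g : Torus → ℝ} (hf : MemLp f 2 torusMeasure)
    (hg : MemLp g 2 torusMeasure) (h : ∀ n, coef f n = coef g n) : f =ᵐ[torusMeasure] g := by
  have hF : MemLp (fun x => (f x : ℂ)) 2 torusMeasure := hf.ofReal
  have hG : MemLp (fun x => (g x : ℂ)) 2 torusMeasure := hg.ofReal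
  have key : hF.toLp = hG.toLp := by
    refine (UnitAddTorus.mFourierBasis (d := Fin 3)).repr.injective (lp.ext (funext fun n => ?_))
    have h1 := UnitAddTorus.mFourierBasis_repr (d := Fin 3) hF.toLp n
    have h2 := UnitAddTorus.mFourierBasis_repr (d := Fin 3) hG.toLp n
    refine h1.trans (Eq.trans ?_ h2.symm)
    have h3 : UnitAddTorus.mFourierCoeff (hF.toLp : Torus → ℂ) n = coef f n := by
      refine integral_congr_ae ?_
      filter_upwards [hF.coeFn_toLp] with x hx
      rw [hx]; rfl
    have h4 : UnitAddTorus.mFourierCoeff (hG.toLp : Torus → ℂ) n = coef g n := by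
      refine integral_congr_ae ?_
      filter_upwards [hG.coeFn_toLp] with x hx
      rw [hx]; rfl
    exact h3.trans ((h n).trans h4.symm)
  filter_upwards [hF.coeFn_toLp, hG.coeFn_toLp] with x h1 h2
  rw [key] at h1
  exact_mod_cast h1.symm.trans h2

lemma hfield_ext {U V : HField} (h : ∀ n i, vcoef U n i = vcoef V n i) : U = V := by
  funext i
  exact Lp.ext (ae_eq_of_coef_eq (Lp.memLp _) (Lp.memLp _) fun n => h n i)

/-! ### Absolutely convergent Fourier series -/

/-- The sum of a Fourier series. -/
def fourierSum (c : (Fin 3 → ℤ) → ℂ) (x : Torus) : ℂ := ∑' n, c n * mFourier n x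

lemma norm_mul_mFourier (c : (Fin 3 → ℤ) → ℂ) (n : Fin 3 → ℤ) (x : Torus) :
    ‖c n * mFourier n x‖ = ‖c n‖ := by rw [norm_mul, norm_mFourier_apply, mul_one]

lemma hasSum_fourierSum {c : (Fin 3 → ℤ) → ℂ} (hc : Summable fun n => ‖c n‖) (x : Torus) :
    HasSum (fun n => c n * mFourier n x) (fourierSum c x) :=
  (Summable.of_norm (hc.congr fun n => (norm_mul_mFourier c n x).symm)).hasSum

lemma continuous_fourierSum {c : (Fin 3 → ℤ) → ℂ} (hc : Summable fun n => ‖c n‖) :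
    Continuous (fourierSum c) :=
  continuous_tsum (fun n => continuous_const.mul (mFourier n).continuous) hc
    (fun n x => (norm_mul_mFourier c n x).le)

lemma norm_fourierSum_le {c : (Fin 3 → ℤ) → ℂ} (hc : Summable fun n => ‖c n‖) (x : Torus) :
    ‖fourierSum c x‖ ≤ ∑' n, ‖c n‖ :=
  tsum_of_norm_bounded (E := ℂ) hc.hasSum fun n => (norm_mul_mFourier c n x).le

lemma integrable_mul_of_ae_eq_fourierSum {c : (Fin 3 → ℤ) → ℂ} (hc : Summable fun n => ‖c n‖)
    {f g : Torus → ℝ} (hf : (fun x => (f x : ℂ)) =ᵐ[torusMeasure] fourierSum c)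
    (hg : Integrable g torusMeasure) : Integrable (fun x => f x * g x) torusMeasure := by
  have h1 : Integrable (fun x => fourierSum c x * (g x : ℂ)) torusMeasure :=
    hg.ofReal.bdd_mul (continuous_fourierSum hc).aestronglyMeasurable
      (Filter.Eventually.of_forall fun x => norm_fourierSum_le hc x)
  have h2 : Integrable (fun x => ((f x * g x : ℝ) : ℂ)) torusMeasure := by
    refine h1.congr ?_
    filter_upwards [hf] with x hx
    rw [← hx]; push_cast; rfl
  simpa using h2.re

/-- The Fourier coefficients of a product with an absolutely convergent Fourier series. -/
lemma hasSum_coef_mul {c : (Fin 3 → ℤ) → ℂ} (hc : Summable fun n => ‖c n‖)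
    {f g : Torus → ℝ} (hf : (fun x => (f x : ℂ)) =ᵐ[torusMeasure] fourierSum c)
    (hg : Integrable g torusMeasure) (n : Fin 3 → ℤ) :
    HasSum (fun j => c j * coef g (n - j)) (coef (fun x => f x * g x) n) := by
  have h := hasSum_integral_of_summable_integral_norm (μ := torusMeasure)
    (F := fun j x => c j * (mFourier (-(n - j)) x * (g x : ℂ)))
    (fun j => (integrable_mFourier_mul hg _).const_mul _) (by
      have : ∀ j, ∫ x, ‖c j * (mFourier (-(n - j)) x * (g x : ℂ))‖ ∂torusMeasure =
          ‖c j‖ * ∫ x, ‖g x‖ ∂torusMeasure := fun j => by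
        rw [← integral_const_mul]
        congr 1; funext x
        rw [norm_mul, norm_mul, norm_mFourier_apply, one_mul, Complex.norm_real]
      simp only [this]
      exact hc.mul_right _)
  have h1 : ∀ j, ∫ x, c j * (mFourier (-(n - j)) x * (g x : ℂ)) ∂torusMeasure =
      c j * coef g (n - j) := fun j => integral_const_mul (c j) _
  simp only [h1] at h
  refine (congrArg (HasSum _) ?_).mp h
  rw [coef]
  refine (integral_congr_ae ?_).symm
  filter_upwards [hf] with x hx
  have h2 : ((f x * g x : ℝ) : ℂ) = fourierSum c x * (g x : ℂ) := by rw [← hx]; push_cast; rfl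
  rw [h2, fourierSum, ← tsum_mul_right, ← tsum_mul_left]
  refine tsum_congr fun j => ?_
  have h3 : -(n - j) = -n + j := by abel
  rw [h3, ← mFourier_mul]
  ring

lemma coef_one (n : Fin 3 → ℤ) : coef (fun _ => 1) n = if n = 0 then 1 else 0 := by
  simp [coef, integral_mFourier]

lemma coef_of_ae_eq_fourierSum {c : (Fin 3 → ℤ) → ℂ} (hc : Summable fun n => ‖c n‖)
    {f : Torus → ℝ} (hf : (fun x => (f x : ℂ)) =ᵐ[torusMeasure] fourierSum c) (n : Fin 3 → ℤ) :
    coef f n = c n := by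
  have h := hasSum_coef_mul hc hf (integrable_const (1 : ℝ)) n
  simp only [mul_one, coef_one] at h
  refine h.unique ?_
  convert hasSum_single n (fun j hj => ?_) using 1
  · simp
  · rw [if_neg (sub_ne_zero.mpr hj.symm), mul_zero]

lemma conj_fourierSum {c : (Fin 3 → ℤ) → ℂ} (hr : ∀ n, c (-n) = conj (c n)) (x : Torus) :
    conj (fourierSum c x) = fourierSum c x := by
  rw [fourierSum, Complex.conj_tsum, ← (Equiv.neg (Fin 3 → ℤ)).tsum_eq]
  refine tsum_congr fun n => ?_
  simp only [Equiv.neg_apply, hr, map_mul, Complex.conj_conj, UnitAddTorus.mFourier_neg]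

/-- The real square integrable function with an absolutely summable, conjugation symmetric family
of Fourier coefficients. -/
lemma exists_lp_of_coef {c : (Fin 3 → ℤ) → ℂ} (hc : Summable fun n => ‖c n‖)
    (hr : ∀ n, c (-n) = conj (c n)) : ∃ f : Lp ℝ 2 torusMeasure, ∀ n, coef f n = c n := by
  have hcont : Continuous fun x => (fourierSum c x).re :=
    Complex.continuous_re.comp (continuous_fourierSum hc)
  have hm : MemLp (fun x => (fourierSum c x).re) 2 torusMeasure :=
    MemLp.of_bound hcont.aestronglyMeasurable (∑' n, ‖c n‖)
      (Filter.Eventually.of_forall fun x =>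
        (Complex.abs_re_le_norm _).trans (norm_fourierSum_le hc x))
  refine ⟨hm.toLp, fun n => coef_of_ae_eq_fourierSum hc ?_ n⟩
  filter_upwards [hm.coeFn_toLp] with x hx
  rw [hx]
  exact Complex.conj_eq_iff_re.mp (conj_fourierSum hr x)

lemma exists_hfield_of_coef {c : (Fin 3 → ℤ) → Fin 2 → ℂ}
    (hc : ∀ i, Summable fun n => ‖c n i‖) (hr : ∀ n i, c (-n) i = conj (c n i)) :
    ∃ U : HField, ∀ n i, vcoef U n i = c n i := by
  choose f hf using fun i => exists_lp_of_coef (hc i) (fun n => hr n i)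
  exact ⟨f, fun n i => hf i n⟩

lemma ae_eq_fourierSum_coef {f : Torus → ℝ} (hf : MemLp f 2 torusMeasure)
    (hc : Summable fun n => ‖coef f n‖) :
    (fun x => (f x : ℂ)) =ᵐ[torusMeasure] fourierSum (coef f) := by
  have hcont : Continuous fun x => (fourierSum (coef f) x).re :=
    Complex.continuous_re.comp (continuous_fourierSum hc)
  have hre : ∀ x, ((fourierSum (coef f) x).re : ℂ) = fourierSum (coef f) x := fun x =>
    Complex.conj_eq_iff_re.mp (conj_fourierSum (coef_neg f) x)
  have hm : MemLp (fun x => (fourierSum (coef f) x).re) 2 torusMeasure :=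
    MemLp.of_bound hcont.aestronglyMeasurable (∑' n, ‖coef f n‖)
      (Filter.Eventually.of_forall fun x =>
        (Complex.abs_re_le_norm _).trans (norm_fourierSum_le hc x))
  have := ae_eq_of_coef_eq hf hm fun n =>
    (coef_of_ae_eq_fourierSum hc (Filter.Eventually.of_forall hre) n).symm
  filter_upwards [this] with x hx
  rw [hx, hre]

/-! ### Averaging and reflection in the vertical direction -/

lemma measurable_update_two :
    Measurable fun q : Torus × UnitAddCircle => Function.update q.1 2 q.2 := by
  refine measurable_pi_lambda _ fun i => ?_
  by_cases hi : i = 2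
  · subst hi; simpa using measurable_snd
  · simp only [Function.update_of_ne hi]
    exact (measurable_pi_apply i).comp measurable_fst

/-- The overwritten vertical coordinate has total mass `1`. This turns integrals over the torus into
iterated integrals with an inner integral along vertical fibres. -/
lemma measurePreserving_update_two :
    MeasurePreserving (fun q : Torus × UnitAddCircle => Function.update q.1 2 q.2)
      (torusMeasure.prod AddCircle.haarAddCircle) torusMeasure := by
  refine ⟨measurable_update_two, (Measure.pi_eq fun s hs => ?_).symm⟩
  rw [Measure.map_apply measurable_update_two (MeasurableSet.univ_pi hs)]
  have h : (fun q : Torus × UnitAddCircle => Function.update q.1 2 q.2) ⁻¹' Set.univ.pi s =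
      (Set.univ.pi (Function.update s 2 Set.univ)) ×ˢ s 2 := by
    ext q
    simp only [Set.mem_preimage, Set.mem_pi, Set.mem_univ, true_implies, Set.mem_prod,
      Fin.forall_fin_succ]
    simp [Function.update, Fin.ext_iff, and_assoc]
  rw [h, Measure.prod_prod, Measure.pi_pi, Fin.prod_univ_three, Fin.prod_univ_three]
  simp [Function.update, Fin.ext_iff]

lemma mFourier_update (n : Fin 3 → ℤ) (x : Torus) (ζ : UnitAddCircle) :
    mFourier n (Function.update x 2 ζ) = mFourier n (Function.update x 2 0) * fourier (n 2) ζ := by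
  simp only [mFourier, ContinuousMap.coe_mk, Fin.prod_univ_three]
  simp [Function.update, Fin.ext_iff]

/-- If `n 2 = 0` the character is constant along vertical fibres and Fubini applies; otherwise `f̄`
is constant there and the character integrates to zero. -/
lemma coef_barotropic {f : Torus → ℝ} (hf : Integrable f torusMeasure) (n : Fin 3 → ℤ) :
    coef (barotropic f) n = if n 2 = 0 then coef f n else 0 := by
  have hmp := measurePreserving_update_two
  have hfu : Integrable (fun q : Torus × UnitAddCircle => f (Function.update q.1 2 q.2))
      (torusMeasure.prod AddCircle.haarAddCircle) := hmp.integrable_comp_of_integrable hf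
  by_cases hn : n 2 = 0
  · rw [if_pos hn]
    have h1 : Integrable (fun q : Torus × UnitAddCircle =>
        mFourier (-n) (Function.update q.1 2 q.2) * (f (Function.update q.1 2 q.2) : ℂ))
        (torusMeasure.prod AddCircle.haarAddCircle) :=
      hmp.integrable_comp_of_integrable (integrable_mFourier_mul hf (-n))
    have h2 : coef f n = ∫ q : Torus × UnitAddCircle,
        mFourier (-n) (Function.update q.1 2 q.2) * (f (Function.update q.1 2 q.2) : ℂ)
          ∂(torusMeasure.prod AddCircle.haarAddCircle) := by
      rw [coef]
      nth_rw 1 [← hmp.map_eq]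
      rw [integral_map measurable_update_two.aemeasurable]
      rw [hmp.map_eq]
      exact (integrable_mFourier_mul hf (-n)).aestronglyMeasurable
    rw [h2, integral_prod _ h1, coef]
    refine integral_congr_ae (Filter.Eventually.of_forall fun x => ?_)
    have h3 : ∀ ζ : UnitAddCircle, mFourier (-n) (Function.update x 2 ζ) = mFourier (-n) x := by
      intro ζ
      simp only [mFourier, ContinuousMap.coe_mk, Fin.prod_univ_three]
      simp [Function.update, Fin.ext_iff, hn]
    simp only [h3]
    rw [integral_const_mul, integral_complex_ofReal]
    rfl
  · rw [if_neg hn]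
    have hb : Integrable (barotropic f) torusMeasure := hfu.integral_prod_left
    have h1 : Integrable (fun q : Torus × UnitAddCircle =>
        mFourier (-n) (Function.update q.1 2 q.2) *
          (barotropic f (Function.update q.1 2 q.2) : ℂ))
        (torusMeasure.prod AddCircle.haarAddCircle) :=
      hmp.integrable_comp_of_integrable (integrable_mFourier_mul hb (-n))
    have h2 : coef (barotropic f) n = ∫ q : Torus × UnitAddCircle,
        mFourier (-n) (Function.update q.1 2 q.2) *
          (barotropic f (Function.update q.1 2 q.2) : ℂ)
          ∂(torusMeasure.prod AddCircle.haarAddCircle) := by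
      rw [coef]
      nth_rw 1 [← hmp.map_eq]
      rw [integral_map measurable_update_two.aemeasurable]
      rw [hmp.map_eq]
      exact (integrable_mFourier_mul hb (-n)).aestronglyMeasurable
    rw [h2, integral_prod _ h1]
    refine (integral_congr_ae (Filter.Eventually.of_forall fun x => ?_)).trans (integral_zero _ _)
    have h3 : ∀ ζ : UnitAddCircle, barotropic f (Function.update x 2 ζ) = barotropic f x := by
      intro ζ
      simp [barotropic]
    obtain ⟨A, hA⟩ : ∃ A : ℂ, ∀ ζ, mFourier (-n) (Function.update x 2 ζ) = A * fourier ((-n) 2) ζ :=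
      ⟨_, mFourier_update (-n) x⟩
    simp only [h3, hA]
    rw [integral_mul_const, integral_const_mul, integral_fourier]
    simp [hn]

/-- The reflection of frequencies in the vertical direction. -/
def reflect (n : Fin 3 → ℤ) : Fin 3 → ℤ := Function.update n 2 (-(n 2))

@[simp] lemma reflect_castSucc (n : Fin 3 → ℤ) (i : Fin 2) :
    reflect n i.castSucc = n i.castSucc := by
  fin_cases i <;> simp [reflect, Function.update, Fin.ext_iff]

@[simp] lemma reflect_two (n : Fin 3 → ℤ) : reflect n 2 = -(n 2) := by simp [reflect]

lemma reflect_reflect (n : Fin 3 → ℤ) : reflect (reflect n) = n := by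
  simp [reflect]

lemma reflect_sub (m n : Fin 3 → ℤ) : reflect (m - n) = reflect m - reflect n := by
  funext i
  fin_cases i <;> (simp [reflect, Function.update, Fin.ext_iff]; try ring)

/-- The reflection of frequencies as an equivalence. -/
def reflectEquiv : (Fin 3 → ℤ) ≃ (Fin 3 → ℤ) := ⟨reflect, reflect, reflect_reflect, reflect_reflect⟩

lemma freqNorm_reflect (n : Fin 3 → ℤ) : freqNorm (reflect n) = freqNorm n := by
  simp [freqNorm, Fin.sum_univ_three, reflect, Function.update, Fin.ext_iff]

lemma mFourier_reflect (n : Fin 3 → ℤ) (x : Torus) :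
    mFourier (reflect n) (Function.update x 2 (-(x 2))) = mFourier n x := by
  simp only [mFourier, ContinuousMap.coe_mk, Fin.prod_univ_three]
  simp [Function.update, Fin.ext_iff, reflect, fourier_apply]

lemma measurePreserving_reflect :
    MeasurePreserving (fun x : Torus => Function.update x 2 (-(x 2))) torusMeasure torusMeasure := by
  have h := measurePreserving_pi (fun _ : Fin 3 => (AddCircle.haarAddCircle (T := 1)))
    (fun _ : Fin 3 => (AddCircle.haarAddCircle (T := 1)))
    (f := fun i (y : UnitAddCircle) => if i = 2 then -y else y) (fun i => by
      by_cases hi : i = 2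
      · simpa [hi] using! Measure.measurePreserving_neg (AddCircle.haarAddCircle (T := 1))
      · simpa [hi] using! MeasurePreserving.id (AddCircle.haarAddCircle (T := 1)))
  convert! h using 1
  funext x i
  by_cases hi : i = 2
  · subst hi; simp
  · simp [hi]

lemma coef_comp_reflect {f : Torus → ℝ} (hf : Integrable f torusMeasure) (n : Fin 3 → ℤ) :
    coef (fun x => f (Function.update x 2 (-(x 2)))) n = coef f (reflect n) := by
  have hmp := measurePreserving_reflect
  symm
  rw [coef]
  nth_rw 1 [← hmp.map_eq]
  rw [integral_map hmp.measurable.aemeasurable]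
  · rw [coef]
    congr 1; funext x
    have : -reflect n = reflect (-n) := by
      funext i
      fin_cases i <;> simp [reflect, Function.update, Fin.ext_iff]
    rw [this, mFourier_reflect]
  · rw [hmp.map_eq]
    exact (integrable_mFourier_mul hf _).aestronglyMeasurable

lemma ae_even_iff {f : Torus → ℝ} (hf : MemLp f 2 torusMeasure) :
    (∀ᵐ x ∂torusMeasure, f (Function.update x 2 (-(x 2))) = f x) ↔
      ∀ n, coef f (reflect n) = coef f n := by
  have hi : Integrable f torusMeasure := hf.integrable (by norm_num)
  refine ⟨fun h n => ?_, fun h => ?_⟩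
  · rw [← coef_comp_reflect hi]
    exact coef_congr h n
  · exact ae_eq_of_coef_eq (hf.comp_measurePreserving measurePreserving_reflect) hf
      fun n => (coef_comp_reflect hi n).trans (h n)

/-- The state space in terms of Fourier coefficients. -/
lemma memH_iff (U : HField) : MemH U ↔ vcoef U 0 = 0 ∧
    (∀ n, n 2 = 0 → hdot n (vcoef U n) = 0) ∧ ∀ n, vcoef U (reflect n) = vcoef U n := by
  have hi : ∀ i, Integrable (U i) torusMeasure := fun i => (Lp.memLp (U i)).integrable (by norm_num)
  have hdf : ∀ n : Fin 3 → ℤ, (∑ i : Fin 2, 2 * Real.pi * Complex.I * (n i.castSucc : ℂ) *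
      coef (barotropic (U i)) n) =
        if n 2 = 0 then 2 * Real.pi * Complex.I * hdot n (vcoef U n) else 0 := by
    intro n
    simp only [coef_barotropic (hi _), hdot, Fin.sum_univ_two, vcoef]
    split_ifs <;> ring
  have h2pi : (2 * Real.pi * Complex.I : ℂ) ≠ 0 := Complex.two_pi_I_ne_zero
  constructor
  · rintro ⟨h1, h2, h3⟩
    refine ⟨funext fun i => ?_, fun n hn => ?_, fun n => funext fun i => ?_⟩
    · simp [vcoef, coef_zero, h1]
    · have := h2 n
      rw [hdf, if_pos hn] at this
      exact (mul_eq_zero.mp this).resolve_left h2pi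
    · exact (ae_even_iff (Lp.memLp (U i))).mp (h3 i) n
  · rintro ⟨h1, h2, h3⟩
    refine ⟨fun i => ?_, fun n => ?_, fun i => ?_⟩
    · have := congrFun h1 i
      rw [vcoef, coef_zero] at this
      exact Complex.ofReal_eq_zero.mp this
    · rw [hdf]
      split_ifs with hn
      · rw [h2 n hn, mul_zero]
      · rfl
    · exact (ae_even_iff (Lp.memLp (U i))).mpr fun n => congrFun (h3 n) i

/-! ### The vertical velocity -/

lemma volume_unitAddCircle : (volume : Measure UnitAddCircle) = AddCircle.haarAddCircle := by
  rw [AddCircle.volume_eq_smul_haarAddCircle]; simp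

lemma ae_Ioc_of_ae_circle {p : UnitAddCircle → Prop}
    (h : ∀ᵐ ζ ∂AddCircle.haarAddCircle, p ζ) :
    ∀ᵐ r : ℝ ∂volume.restrict (Set.Ioc 0 1), p (r : UnitAddCircle) := by
  have h1 := AddCircle.measurePreserving_mk (1 : ℝ) 0
  rw [zero_add, volume_unitAddCircle] at h1
  exact h1.quasiMeasurePreserving.ae h

lemma integral_fourier_Ioc (m : ℤ) (r : ℝ) (hm : m ≠ 0) :
    ∫ ζ in (0 : ℝ)..r, (fourier m (ζ : UnitAddCircle) : ℂ) =
      (fourier m (r : UnitAddCircle) - 1) / (2 * Real.pi * Complex.I * m) := by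
  have hm' : (2 * Real.pi * Complex.I * m : ℂ) ≠ 0 :=
    mul_ne_zero Complex.two_pi_I_ne_zero (Int.cast_ne_zero.mpr hm)
  simp only [fourier_coe_apply, Complex.ofReal_one, div_one]
  have := integral_exp_mul_complex (a := 0) (b := r) hm'
  simpa using this

/-- An odd function vanishes at `z = 0`: reindexing by the reflection shows that the sum is its own
negative. -/
lemma fourierSum_update_zero_eq_zero {b : (Fin 3 → ℤ) → ℂ} (hb : ∀ n, b (reflect n) = -b n)
    (x : Torus) : fourierSum b (Function.update x 2 0) = 0 := by
  have h1 : fourierSum b (Function.update x 2 0) = -fourierSum b (Function.update x 2 0) := by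
    nth_rw 1 [fourierSum]
    rw [← reflectEquiv.tsum_eq, fourierSum, ← tsum_neg]
    refine tsum_congr fun n => ?_
    have h2 : mFourier (reflect n) (Function.update x 2 0) = mFourier n (Function.update x 2 0) := by
      simpa using mFourier_reflect n (Function.update x 2 0)
    change b (reflect n) * mFourier (reflect n) _ = _
    rw [hb, h2, neg_mul]
  exact self_eq_neg.mp h1

/-- The series of `d` is integrated termwise. The absence of modes with `n 2 = 0` excludes a part
linear in `z`, which would not be periodic; evenness makes the primitive odd, so the integration
constant is zero. -/
lemma vertical_ae_eq_fourierSum {c : (Fin 3 → ℤ) → ℂ} (hc : Summable fun n => ‖c n‖)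
    (h0 : ∀ n, n 2 = 0 → c n = 0) (hr : ∀ n, c (reflect n) = c n) {d : Torus → ℝ}
    (hd : (fun x => (d x : ℂ)) =ᵐ[torusMeasure] fourierSum c) :
    (fun x => (vertical d x : ℂ)) =ᵐ[torusMeasure]
      fourierSum fun n => -(c n / (2 * Real.pi * Complex.I * n 2)) := by
  have h1 : ∀ᵐ x ∂torusMeasure, ∀ᵐ ζ ∂(AddCircle.haarAddCircle (T := 1)),
      (d (Function.update x 2 ζ) : ℂ) = fourierSum c (Function.update x 2 ζ) :=
    Measure.ae_ae_of_ae_prod (measurePreserving_update_two.quasiMeasurePreserving.ae hd)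
  filter_upwards [h1] with x hx
  set r : ℝ := (AddCircle.equivIco (1 : ℝ) 0 (x 2) : ℝ) with hrdef
  have hr0 : 0 ≤ r := (AddCircle.equivIco (1 : ℝ) 0 (x 2)).2.1
  have hr1 : r ≤ 1 := by
    have := (AddCircle.equivIco (1 : ℝ) 0 (x 2)).2.2
    linarith
  have hrx : (r : UnitAddCircle) = x 2 := AddCircle.coe_equivIco
  set b : (Fin 3 → ℤ) → ℂ := fun n => c n / (2 * Real.pi * Complex.I * n 2) with hb
  have hbc : ∀ n, ‖b n‖ ≤ ‖c n‖ := by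
    intro n
    by_cases hn : n 2 = 0
    · simp [hb, h0 n hn]
    · have h2 : (1 : ℝ) ≤ |(n 2 : ℝ)| := by exact_mod_cast Int.one_le_abs hn
      rw [hb, norm_div]
      refine div_le_self (norm_nonneg _) ?_
      simp only [norm_mul, Complex.norm_ofNat, Complex.norm_real, Complex.norm_I, mul_one,
        Complex.norm_intCast, Real.norm_of_nonneg Real.pi_pos.le]
      nlinarith [Real.pi_gt_three]
  have hbs : Summable fun n => ‖b n‖ := hc.of_nonneg_of_le (fun _ => norm_nonneg _) hbc
  have hint : ∫ ζ in (0 : ℝ)..r, (d (Function.update x 2 (ζ : UnitAddCircle)) : ℂ) =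
      ∫ ζ in (0 : ℝ)..r, fourierSum c (Function.update x 2 (ζ : UnitAddCircle)) := by
    refine intervalIntegral.integral_congr_ae_restrict ?_
    rw [Set.uIoc_of_le hr0]
    exact ae_restrict_of_ae_restrict_of_subset (Set.Ioc_subset_Ioc_right hr1)
      (ae_Ioc_of_ae_circle hx)
  have hcu : ∀ n : Fin 3 → ℤ, Continuous fun ζ : ℝ =>
      c n * mFourier n (Function.update x 2 (ζ : UnitAddCircle)) := by
    intro n
    refine continuous_const.mul ((mFourier n).continuous.comp ?_)
    exact continuous_const.update 2 (AddCircle.continuous_mk' 1)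
  have hsum := intervalIntegral.hasSum_integral_of_dominated_convergence (a := 0) (b := r)
    (μ := volume) (F := fun n (ζ : ℝ) => c n * mFourier n (Function.update x 2 (ζ : UnitAddCircle)))
    (f := fun ζ : ℝ => fourierSum c (Function.update x 2 (ζ : UnitAddCircle)))
    (fun n _ => ‖c n‖) (fun n => (hcu n).aestronglyMeasurable)
    (fun n => Filter.Eventually.of_forall fun ζ _ => (norm_mul_mFourier c n _).le)
    (Filter.Eventually.of_forall fun ζ _ => hc) (by simp)
    (Filter.Eventually.of_forall fun ζ _ => hasSum_fourierSum hc _)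
  have hterm : ∀ n, ∫ ζ in (0 : ℝ)..r, c n * mFourier n (Function.update x 2 (ζ : UnitAddCircle)) =
      b n * mFourier n x - b n * mFourier n (Function.update x 2 0) := by
    intro n
    by_cases hn : n 2 = 0
    · simp [hb, h0 n hn]
    · have h2 : mFourier n x = mFourier n (Function.update x 2 0) * fourier (n 2) (x 2) := by
        rw [← mFourier_update, Function.update_eq_self]
      obtain ⟨A, hA₀, hA⟩ : ∃ A : ℂ, A = mFourier n (Function.update x 2 0) ∧
          ∀ ζ, mFourier n (Function.update x 2 ζ) = A * fourier (n 2) ζ :=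
        ⟨_, rfl, mFourier_update n x⟩
      rw [h2, ← hA₀]
      simp only [hA]
      rw [intervalIntegral.integral_const_mul, intervalIntegral.integral_const_mul,
        integral_fourier_Ioc _ _ hn, hrx]
      simp only [hb]
      ring
  simp only [hterm] at hsum
  have hval := hsum.unique ((hasSum_fourierSum hbs x).sub
    (hasSum_fourierSum hbs (Function.update x 2 0)))
  rw [fourierSum_update_zero_eq_zero (fun n => by
    simp only [hb, hr, reflect_two]; push_cast; rw [mul_neg, div_neg]), sub_zero] at hval
  have hneg : fourierSum (fun n => -b n) x = -fourierSum b x := by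
    rw [fourierSum, fourierSum, ← tsum_neg]
    exact tsum_congr fun n => neg_mul _ _
  rw [hneg, ← hval, ← hint, vertical, Complex.ofReal_neg, ← intervalIntegral.integral_ofReal]

/-! ### The Fourier coefficients of the nonlinearity -/

lemma norm_two_pi_I_mul_le (n : Fin 3 → ℤ) (j : Fin 3) :
    ‖(2 * Real.pi * Complex.I * (n j : ℂ))‖ ≤ freqNorm n := by
  refine le_trans (le_of_eq ?_) (two_pi_abs_le_freqNorm n j)
  simp only [norm_mul, Complex.norm_ofNat, Complex.norm_real, Complex.norm_I, mul_one,
    Complex.norm_intCast, Real.norm_of_nonneg Real.pi_pos.le]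

lemma fourierSum_add {a b : (Fin 3 → ℤ) → ℂ} (ha : Summable fun n => ‖a n‖)
    (hb : Summable fun n => ‖b n‖) (x : Torus) :
    fourierSum (fun n => a n + b n) x = fourierSum a x + fourierSum b x := by
  rw [fourierSum]
  simp only [add_mul]
  exact ((hasSum_fourierSum ha x).add (hasSum_fourierSum hb x)).tsum_eq

/-- The advection term of a smooth field in the state space is integrable, and its Fourier
coefficients are convolutions. -/
lemma advection_coef {V : HField} {D : Fin 3 → HField} (hV : MemH V)
    (hD : ∀ j, IsWeakPartial j V (D j))
    (hs : ∀ i, Summable fun n => freqNorm n * ‖vcoef V n i‖) (i : Fin 2) :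
    Integrable (advection V D i) torusMeasure ∧ ∀ n,
      HasSum (fun m => transportSymbol m (n - m) (vcoef V m) * vcoef V (n - m) i)
        (coef (advection V D i) n) := by
  obtain ⟨hV0, hVdiv, hVeven⟩ := (memH_iff V).mp hV
  have hs0 : ∀ i, Summable fun n => ‖vcoef V n i‖ := fun i =>
    (hs i).of_nonneg_of_le (fun _ => norm_nonneg _) fun n => by
      by_cases hn : n = 0
      · simp [hn, hV0]
      · exact le_mul_of_one_le_left (norm_nonneg _) (one_le_freqNorm hn)
  have hDs : ∀ j i, Summable fun n => ‖vcoef (D j) n i‖ := fun j i =>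
    (hs i).of_nonneg_of_le (fun _ => norm_nonneg _) fun n => by
      rw [hD j n i, norm_mul]
      exact mul_le_mul_of_nonneg_right (norm_two_pi_I_mul_le n j) (norm_nonneg _)
  have hDint : ∀ j i, Integrable (D j i) torusMeasure := fun j i =>
    (Lp.memLp (D j i)).integrable (by norm_num)
  have hVae : ∀ i, (fun x => (V i x : ℂ)) =ᵐ[torusMeasure] fourierSum fun n => vcoef V n i :=
    fun i => ae_eq_fourierSum_coef (Lp.memLp (V i)) (hs0 i)
  have hDae : ∀ j i, (fun x => (D j i x : ℂ)) =ᵐ[torusMeasure]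
      fourierSum fun n => vcoef (D j) n i :=
    fun j i => ae_eq_fourierSum_coef (Lp.memLp (D j i)) (hDs j i)
  set c : (Fin 3 → ℤ) → ℂ := fun n => 2 * Real.pi * Complex.I * hdot n (vcoef V n) with hc
  have hcD : ∀ n, c n = vcoef (D 0) n 0 + vcoef (D 1) n 1 := fun n => by
    rw [hD 0 n 0, hD 1 n 1, hc]
    simp only [hdot, Fin.sum_univ_two, Fin.castSucc_zero, Fin.castSucc_one]
    ring
  have hcs : Summable fun n => ‖c n‖ :=
    ((hDs 0 0).add (hDs 1 1)).of_nonneg_of_le (fun _ => norm_nonneg _) fun n => by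
      rw [hcD]; exact norm_add_le _ _
  have hdae : (fun x => ((∑ j : Fin 2, D j.castSucc j x : ℝ) : ℂ)) =ᵐ[torusMeasure]
      fourierSum c := by
    filter_upwards [hDae 0 0, hDae 1 1] with x h0 h1
    rw [funext hcD, fourierSum_add (hDs 0 0) (hDs 1 1), ← h0, ← h1]
    simp
  have hvert := vertical_ae_eq_fourierSum hcs
    (fun n hn => by simp only [hc, hVdiv n hn, mul_zero])
    (fun n => by simp only [hc, hVeven, hdot, reflect_castSucc]) hdae
  set b : (Fin 3 → ℤ) → ℂ := fun n => -(hdot n (vcoef V n) / n 2) with hb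
  have hbc : (fun n : Fin 3 → ℤ => -(c n / (2 * Real.pi * Complex.I * n 2))) = b := by
    funext n
    simp only [hc, hb]
    rw [mul_div_mul_left _ _ Complex.two_pi_I_ne_zero]
  rw [hbc] at hvert
  have hbs : Summable fun n => ‖b n‖ :=
    hcs.of_nonneg_of_le (fun _ => norm_nonneg _) fun n => by
      have h1 : ‖b n‖ = ‖hdot n (vcoef V n)‖ * ‖(n 2 : ℂ)‖⁻¹ := by
        rw [hb, norm_neg, norm_div, div_eq_mul_inv]
      have h2 : ‖(n 2 : ℂ)‖⁻¹ ≤ 1 := by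
        by_cases hn : n 2 = 0
        · simp [hn]
        · refine inv_le_one_of_one_le₀ ?_
          rw [Complex.norm_intCast]
          exact_mod_cast Int.one_le_abs hn
      have h3 : ‖c n‖ = 2 * Real.pi * ‖hdot n (vcoef V n)‖ := by
        simp only [hc, norm_mul, Complex.norm_ofNat, Complex.norm_real, Complex.norm_I, mul_one,
          Real.norm_of_nonneg Real.pi_pos.le]
      rw [h1, h3]
      have := norm_nonneg (hdot n (vcoef V n))
      nlinarith [Real.pi_gt_three]
  have i0 := integrable_mul_of_ae_eq_fourierSum (hs0 0) (hVae 0) (hDint 0 i)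
  have i1 := integrable_mul_of_ae_eq_fourierSum (hs0 1) (hVae 1) (hDint 1 i)
  have i2 := integrable_mul_of_ae_eq_fourierSum hbs hvert (hDint 2 i)
  have hadv : advection V D i = fun x => (V 0 x * D 0 i x + V 1 x * D 1 i x) +
      vertical (fun y => ∑ j : Fin 2, D j.castSucc j y) x * D 2 i x := by
    funext x
    simp [advection, Fin.sum_univ_two]
  have i01 : Integrable (fun x => V 0 x * D 0 i x + V 1 x * D 1 i x) torusMeasure := i0.add i1
  refine ⟨by rw [hadv]; exact i01.add i2, fun n => ?_⟩
  rw [hadv, coef_add i01 i2, coef_add i0 i1]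
  have h := ((hasSum_coef_mul (hs0 0) (hVae 0) (hDint 0 i) n).add
    (hasSum_coef_mul (hs0 1) (hVae 1) (hDint 1 i) n)).add
    (hasSum_coef_mul hbs hvert (hDint 2 i) n)
  refine h.congr_fun fun m => ?_
  have e0 : coef (D 0 i) (n - m) = _ := hD 0 (n - m) i
  have e1 : coef (D 1 i) (n - m) = _ := hD 1 (n - m) i
  have e2 : coef (D 2 i) (n - m) = _ := hD 2 (n - m) i
  rw [e0, e1, e2, transportSymbol]
  simp only [hb, hdot, Fin.sum_univ_two, Fin.castSucc_zero, Fin.castSucc_one]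
  ring

/-! ### Symmetries of the nonlinearity -/

/-- Complex conjugation on `ℂ²`. -/
def conjVec : CVec →L[ℝ] CVec :=
  LinearMap.mkContinuous
    { toFun := fun c => WithLp.toLp 2 fun i => conj (c i)
      map_add' := fun c d => by ext i; simp
      map_smul' := fun r c => by ext i; simp }
    1 fun c => by simp [EuclideanSpace.norm_eq]

lemma conjVec_apply (c : CVec) (i : Fin 2) : conjVec c i = conj (c i) := rfl

/-- `c ↦ k_h · c` as a continuous linear functional. -/
def hdotCLM (n : Fin 3 → ℤ) : CVec →L[ℝ] ℂ :=
  LinearMap.mkContinuous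
    { toFun := fun c => hdot n c
      map_add' := fun c d => by simp only [hdot, Fin.sum_univ_two, PiLp.add_apply]; ring
      map_smul' := fun r c => by
        simp only [hdot, Fin.sum_univ_two, PiLp.smul_apply, Complex.real_smul, RingHom.id_apply]
        ring }
    (freqNorm n) fun c => by
      have h1 := norm_hdot_le n c
      have h2 : 0 ≤ ‖hdot n c‖ := norm_nonneg _
      change ‖hdot n c‖ ≤ _
      nlinarith [Real.pi_gt_three]

lemma hdotCLM_apply (n : Fin 3 → ℤ) (c : CVec) : hdotCLM n c = hdot n c := rfl

lemma hdot_lerayLin {n : Fin 3 → ℤ} (hn : n 2 = 0) (c : CVec) : hdot n (lerayLin n c) = 0 := by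
  by_cases h : (n 0 : ℝ) ^ 2 + (n 1 : ℝ) ^ 2 = 0
  · have h0 : n 0 = 0 := by
      have : (n 0 : ℝ) = 0 := by nlinarith [sq_nonneg (n 0 : ℝ), sq_nonneg (n 1 : ℝ)]
      exact_mod_cast this
    have h1 : n 1 = 0 := by
      have : (n 1 : ℝ) = 0 := by nlinarith [sq_nonneg (n 0 : ℝ), sq_nonneg (n 1 : ℝ)]
      exact_mod_cast this
    simp [hdot, Fin.sum_univ_two, h0, h1]
  · have h2 : (n 0 : ℂ) ^ 2 + (n 1 : ℂ) ^ 2 ≠ 0 := by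
      intro h3
      apply h
      exact_mod_cast h3
    simp only [hdot, Fin.sum_univ_two, lerayLin_apply, leray, hn, if_true, Fin.castSucc_zero,
      Fin.castSucc_one]
    field_simp
    ring

lemma transportSymbol_neg (j l : Fin 3 → ℤ) (c : CVec) :
    transportSymbol (-j) (-l) (conjVec c) = conj (transportSymbol j l c) := by
  simp only [transportSymbol, hdot, Fin.sum_univ_two, Pi.neg_apply, conjVec_apply, map_mul,
    map_sub, map_add, map_div₀, Complex.conj_I, Complex.conj_ofReal, map_intCast, map_ofNat]
  push_cast
  rw [neg_div_neg_eq]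
  ring

lemma transportSymbol_reflect (j l : Fin 3 → ℤ) (c : CVec) :
    transportSymbol (reflect j) (reflect l) c = transportSymbol j l c := by
  simp only [transportSymbol, hdot, reflect_castSucc, reflect_two]
  push_cast
  rw [neg_div_neg_eq]

/-- The transporting field is incompressible, so the transport term has mean zero: horizontal and
vertical parts cancel at `l = -j`. For `j 2 = 0` there is no vertical part and the divergence
condition is needed. -/
lemma transportSymbol_self_neg {j : Fin 3 → ℤ} {c : CVec} (h : j 2 = 0 → hdot j c = 0) :
    transportSymbol j (-j) c = 0 := by
  have h1 : hdot (-j) c = -hdot j c := by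
    simp only [hdot, Fin.sum_univ_two, Pi.neg_apply]; push_cast; ring
  rw [transportSymbol, h1]
  by_cases hj : j 2 = 0
  · simp [h hj]
  · have : (j 2 : ℂ) ≠ 0 := Int.cast_ne_zero.mpr hj
    simp only [Pi.neg_apply]
    push_cast
    rw [neg_div, div_self this]
    ring

lemma lerayLin_neg (n : Fin 3 → ℤ) (c : CVec) :
    lerayLin (-n) (conjVec c) = conjVec (lerayLin n c) := by
  ext i
  simp only [lerayLin_apply, conjVec_apply, leray, Pi.neg_apply, neg_eq_zero, Fin.sum_univ_two]
  split_ifs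
  · simp only [map_sub, map_div₀, map_mul, map_add, map_pow, map_intCast]
    push_cast
    congr 2 <;> ring
  · rfl

lemma lerayLin_reflect (n : Fin 3 → ℤ) (c : CVec) : lerayLin (reflect n) c = lerayLin n c := by
  ext i
  simp [lerayLin_apply, leray]

namespace ModeFlow

variable (P : ModeFlow)

lemma nlTerm_eq (t : ℝ≥0) (k j : Fin 3 → ℤ) (c d : CVec) :
    P.nlTerm t k j c d = P.weight t k j • (transportSymbol j (k - j) c • lerayLin k d) := rfl

lemma nlTerm_neg (t : ℝ≥0) (k j : Fin 3 → ℤ) (c d : CVec) :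
    P.nlTerm t (-k) (-j) (conjVec c) (conjVec d) = conjVec (P.nlTerm t k j c d) := by
  have h1 : -k - -j = -(k - j) := by abel
  have h2 : P.weight t (-k) (-j) = P.weight t k j := by
    simp only [weight, h1, freqNorm_neg]
  rw [nlTerm_eq, nlTerm_eq, h2, h1, transportSymbol_neg, lerayLin_neg, map_smul]
  congr 1
  ext i
  simp [conjVec_apply]

lemma nlTerm_reflect (t : ℝ≥0) (k j : Fin 3 → ℤ) (c d : CVec) :
    P.nlTerm t (reflect k) (reflect j) c d = P.nlTerm t k j c d := by
  have h2 : P.weight t (reflect k) (reflect j) = P.weight t k j := by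
    simp only [weight, ← reflect_sub, freqNorm_reflect]
  rw [nlTerm_eq, nlTerm_eq, h2, ← reflect_sub, transportSymbol_reflect, lerayLin_reflect]

lemma nl_neg (t : ℝ≥0) {z : (Fin 3 → ℤ) → CVec} (hz : ellSq z ≠ ∞)
    (h : ∀ k, z (-k) = conjVec (z k)) (k : Fin 3 → ℤ) :
    P.nl t z z (-k) = conjVec (P.nl t z z k) := by
  rw [nl, nl, conjVec.map_tsum (P.summable_nlTerm t hz hz k), ← (Equiv.neg _).tsum_eq]
  refine tsum_congr fun j => ?_
  have h1 : -k - -j = -(k - j) := by abel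
  rw [Equiv.neg_apply, h1, h, h, nlTerm_neg]

lemma nl_reflect (t : ℝ≥0) {z : (Fin 3 → ℤ) → CVec} (h : ∀ k, z (reflect k) = z k)
    (k : Fin 3 → ℤ) : P.nl t z z (reflect k) = P.nl t z z k := by
  rw [nl, nl, ← reflectEquiv.tsum_eq]
  refine tsum_congr fun j => ?_
  change P.nlTerm t (reflect k) (reflect j) (z (reflect j)) (z (reflect k - reflect j)) = _
  rw [← reflect_sub, h, h, nlTerm_reflect]

lemma hdot_nl (t : ℝ≥0) {z : (Fin 3 → ℤ) → CVec} (hz : ellSq z ≠ ∞) {k : Fin 3 → ℤ}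
    (hk : k 2 = 0) : hdot k (P.nl t z z k) = 0 := by
  rw [← hdotCLM_apply, nl, (hdotCLM k).map_tsum (P.summable_nlTerm t hz hz k)]
  refine (tsum_congr fun j => ?_).trans tsum_zero
  rw [nlTerm_eq, ← map_smul, map_smul, hdotCLM_apply, hdot_lerayLin hk, smul_zero]

/-- The rescaled modes do not see the mean, since `|0|^a = 0`; this shows that the mean of the field
is nevertheless consistent with the PDE. -/
lemma nl_zero (t : ℝ≥0) {z : (Fin 3 → ℤ) → CVec} (h : ∀ k, k 2 = 0 → hdot k (z k) = 0) :
    P.nl t z z 0 = 0 := by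
  rw [nl]
  refine (tsum_congr fun j => ?_).trans tsum_zero
  rw [nlTerm_eq, zero_sub, transportSymbol_self_neg (h j), zero_smul, smul_zero]

end ModeFlow

/-! ### Symmetry of the solutions of the integral equation -/

lemma map_duhamelFun {F : Type*} [NormedAddCommGroup F] [NormedSpace ℝ F] [CompleteSpace F]
    (L : CVec →L[ℝ] F) (lam : ℝ) (f : Traj) (τ : ℝ) :
    L (duhamelFun lam f τ) =
      Real.exp (-lam * τ) • ∫ u in (0 : ℝ)..τ, Real.exp (lam * u) • L (f u.toNNReal) := by
  rw [duhamelFun, map_smul, ← L.intervalIntegral_comp_comm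
    ((continuous_duhamel_integrand lam f).intervalIntegrable _ _)]
  simp only [map_smul]

/-- A family of vectors has the symmetries of the Fourier coefficients of a real field which is even
in the vertical direction and whose vertical average is divergence free. -/
structure IsSymmetric (z : (Fin 3 → ℤ) → CVec) : Prop where
  neg : ∀ k, z (-k) = conjVec (z k)
  reflect : ∀ k, z (reflect k) = z k
  div_free : ∀ k, k 2 = 0 → hdot k (z k) = 0

lemma continuous_eval (k : Fin 3 → ℤ) (t : ℝ≥0) : Continuous fun z : ModeSpace => z k t := by
  refine LipschitzWith.continuous (K := 1) (LipschitzWith.of_dist_le_mul fun z w => ?_)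
  rw [dist_eq_norm, dist_eq_norm, NNReal.coe_one, one_mul]
  exact (((z - w : ModeSpace) k).norm_coe_le_norm t).trans
    (lp.norm_apply_le_norm (by norm_num) (z - w) k)

lemma isClosed_isSymmetric : IsClosed {z : ModeSpace | ∀ t, IsSymmetric fun k => z k t} := by
  have h : {z : ModeSpace | ∀ t, IsSymmetric fun k => z k t} =
      (⋂ t : ℝ≥0, ⋂ k, {z : ModeSpace | z (-k) t = conjVec (z k t)}) ∩
      ((⋂ t : ℝ≥0, ⋂ k, {z : ModeSpace | z (reflect k) t = z k t}) ∩
      ⋂ t : ℝ≥0, ⋂ k : Fin 3 → ℤ, ⋂ _ : k 2 = 0, {z : ModeSpace | hdotCLM k (z k t) = 0}) := by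
    ext z
    simp only [Set.mem_ofPred_eq, Set.mem_inter_iff, Set.mem_iInter]
    exact ⟨fun h => ⟨fun t => (h t).neg, fun t => (h t).reflect, fun t => (h t).div_free⟩,
      fun h t => ⟨h.1 t, h.2.1 t, h.2.2 t⟩⟩
  rw [h]
  refine IsClosed.inter ?_ (IsClosed.inter ?_ ?_)
  · exact isClosed_iInter fun t => isClosed_iInter fun k =>
      isClosed_eq (continuous_eval _ t) (conjVec.continuous.comp (continuous_eval k t))
  · exact isClosed_iInter fun t => isClosed_iInter fun k =>
      isClosed_eq (continuous_eval _ t) (continuous_eval k t)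
  · exact isClosed_iInter fun t => isClosed_iInter fun k => isClosed_iInter fun _ =>
      isClosed_eq ((hdotCLM k).continuous.comp (continuous_eval k t)) continuous_const

namespace ModeFlow

variable (P : ModeFlow)

/-- The right-hand side of the fixed point equation preserves the symmetries: rates and interaction
are invariant under `k ↦ -k` with conjugation and under reflection, and the Leray projection
supplies the divergence condition. -/
lemma isSymmetric_rhs (hneg : ∀ k, P.rate (-k) = P.rate k)
    (href : ∀ k, P.rate (reflect k) = P.rate k) {y : lp (fun _ : Fin 3 → ℤ => CVec) 2}
    (hy : IsSymmetric y) {z : ModeSpace} (hz : ∀ t, IsSymmetric fun k => z k t) (t : ℝ≥0) :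
    IsSymmetric fun k => (P.linearFlow y + P.duhamelOp z z) k t := by
  have hzt : ∀ t, ellSq (fun k => z k t) ≠ ∞ := fun t =>
    ne_top_of_le_ne_top (ellSq_coe_ne_top z) (ellSq_eval_le z t)
  have hnl : ∀ k t, P.nlTraj z z k t = P.nl t (fun j => z j t) (fun j => z j t) k :=
    fun k t => P.nlTraj_apply (ellSq_coe_ne_top z) (ellSq_coe_ne_top z) k t
  have h00 : (P.linearFlow y + P.duhamelOp z z) 0 t = 0 := by rw [P.rhs_apply_zero]; rfl
  refine ⟨fun k => ?_, fun k => ?_, fun k hk => ?_⟩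
  · by_cases hk0 : k = 0
    · rw [hk0, neg_zero, h00, map_zero]
    have h1 : duhamelFun (P.rate k) (P.nlTraj z z (-k)) t =
        conjVec (duhamelFun (P.rate k) (P.nlTraj z z k) t) := by
      have h2 : ∀ u, P.nlTraj z z (-k) u = conjVec (P.nlTraj z z k u) := fun u => by
        rw [hnl, hnl]
        exact P.nl_neg u (z := fun j => z j u) (hzt u) (hz u).neg k
      rw [map_duhamelFun, duhamelFun]
      simp only [h2]
    rw [P.rhs_apply y z hk0, P.rhs_apply y z (neg_ne_zero.mpr hk0), freqNorm_neg, hneg,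
      hy.neg, map_sub, map_smul, map_smul, h1]
  · by_cases hk0 : k = 0
    · have : reflect (0 : Fin 3 → ℤ) = 0 := by funext i; simp [HydrostaticEuler.reflect]
      rw [hk0, this]
    have hr0 : HydrostaticEuler.reflect k ≠ 0 := by
      intro h
      have := congrArg freqNorm h
      rw [freqNorm_reflect, freqNorm_zero] at this
      exact (freqNorm_pos hk0).ne' this
    have h1 : P.nlTraj z z (HydrostaticEuler.reflect k) = P.nlTraj z z k := by
      ext1 u
      rw [hnl, hnl]
      exact P.nl_reflect u (z := fun j => z j u) (hz u).reflect k
    rw [P.rhs_apply y z hk0, P.rhs_apply y z hr0, freqNorm_reflect, href, hy.reflect, h1]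
  · by_cases hk0 : k = 0
    · simp [hk0, hdot]
    have hyk : hdotCLM k (y k) = 0 := hy.div_free k hk
    have hnk : ∀ u, hdotCLM k (P.nlTraj z z k u) = 0 := fun u => by
      rw [hnl]; exact P.hdot_nl u (hzt u) hk
    change hdotCLM k _ = 0
    simp only [P.rhs_apply y z hk0, map_sub, map_smul, map_duhamelFun, hyk, hnk, smul_zero,
      intervalIntegral.integral_zero, sub_zero]

lemma isSymmetric_linearFlow (hneg : ∀ k, P.rate (-k) = P.rate k)
    (href : ∀ k, P.rate (reflect k) = P.rate k) {y : lp (fun _ : Fin 3 → ℤ => CVec) 2}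
    (hy : IsSymmetric y) (t : ℝ≥0) : IsSymmetric fun k => P.linearFlow y k t := by
  have h := P.isSymmetric_rhs hneg href hy (z := 0) (fun t => ⟨fun k => by simp, fun k => rfl,
    fun k _ => by simp [hdot]⟩) t
  have h0 : P.duhamelOp 0 0 = 0 := by
    have := P.duhamelOp_sub_left 0 0 0
    simpa using this
  simpa [h0] using h

end ModeFlow

/-! ### Rescaled modes -/

/-- The rescaled modes `Z_k = |k|^a e^{r|k|^s} Û_k`. -/
def modes (s a r : ℝ) (U : HField) (k : Fin 3 → ℤ) : CVec :=
  (Real.exp (r * freqNorm k ^ s) * freqNorm k ^ a) • WithLp.toLp 2 (vcoef U k)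

lemma modes_apply (s a r : ℝ) (U : HField) (k : Fin 3 → ℤ) (i : Fin 2) :
    modes s a r U k i = ((Real.exp (r * freqNorm k ^ s) * freqNorm k ^ a : ℝ) : ℂ) *
      vcoef U k i := by
  simp [modes, Complex.real_smul]

lemma modes_zero {s a r : ℝ} {U : HField} (h : vcoef U 0 = 0) : modes s a r U 0 = 0 := by
  rw [modes, h]
  exact smul_zero _

lemma freqNorm_rpow_neg_mul_rpow {k : Fin 3 → ℤ} (hk : k ≠ 0) (a : ℝ) :
    freqNorm k ^ (-a) * freqNorm k ^ a = 1 := by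
  rw [← Real.rpow_add (freqNorm_pos hk), neg_add_cancel, Real.rpow_zero]

/-- The rescaling annihilates the zero mode, so it can be inverted only for mean-zero fields. -/
lemma vcoef_eq_modes {U : HField} (h : vcoef U 0 = 0) (s a r : ℝ) (k : Fin 3 → ℤ) :
    (WithLp.toLp 2 (vcoef U k) : CVec) =
      (Real.exp (-(r * freqNorm k ^ s)) * freqNorm k ^ (-a)) • modes s a r U k := by
  by_cases hk : k = 0
  · rw [hk, modes_zero h, h, smul_zero]; rfl
  · have h1 := freqNorm_rpow_neg_mul_rpow hk a
    have h2 : Real.exp (-(r * freqNorm k ^ s)) * Real.exp (r * freqNorm k ^ s) = 1 := by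
      rw [← Real.exp_add, neg_add_cancel, Real.exp_zero]
    rw [modes, smul_smul]
    have h3 : Real.exp (-(r * freqNorm k ^ s)) * freqNorm k ^ (-a) *
        (Real.exp (r * freqNorm k ^ s) * freqNorm k ^ a) = 1 := by
      linear_combination (Real.exp (-(r * freqNorm k ^ s)) * Real.exp (r * freqNorm k ^ s)) * h1 + h2
    rw [h3, one_smul]

lemma hfield_ext_modes {s a r : ℝ} {U V : HField} (hU : vcoef U 0 = 0) (hV : vcoef V 0 = 0)
    (h : modes s a r U = modes s a r V) : U = V := by
  refine hfield_ext fun n i => ?_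
  have h1 : (WithLp.toLp 2 (vcoef U n) : CVec) = WithLp.toLp 2 (vcoef V n) := by
    rw [vcoef_eq_modes hU s a r, vcoef_eq_modes hV s a r, h]
  exact congrArg (fun c : CVec => c i) h1

lemma freqNorm_rpow_two_mul (k : Fin 3 → ℤ) (a : ℝ) :
    freqNorm k ^ (2 * a) = (freqNorm k ^ a) ^ 2 := by
  rw [mul_comm, Real.rpow_mul (freqNorm_nonneg k), Real.rpow_two]

lemma exp_two_mul (x : ℝ) : Real.exp (2 * x) = Real.exp x ^ 2 := by
  rw [← Real.exp_nat_mul]; norm_num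

lemma normSq2_vcoef (U : HField) (k : Fin 3 → ℤ) :
    normSq2 (vcoef U k) = ‖(WithLp.toLp 2 (vcoef U k) : CVec)‖ ^ 2 :=
  normSq2_eq (WithLp.toLp 2 (vcoef U k))

/-- The weight that relates the norm of the Gevrey class and the rescaled modes. -/
def gevreyWeight (s a r : ℝ) (k : Fin 3 → ℤ) : ℝ :=
  1 + Real.exp (-(2 * r * freqNorm k ^ s)) * (freqNorm k ^ (-a)) ^ 2

/-- The `L²` part of the norm becomes a bounded correction of the weight `1`. This is the form
required by the weights `p_k` of the energy estimate. -/
lemma gevreyTerm_eq {U : HField} (h : vcoef U 0 = 0) (σ s r : ℝ) (k : Fin 3 → ℤ) :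
    gevreyTerm σ s r U k =
      gevreyWeight s (σ * s) r k * ‖modes s (σ * s) r U k‖ ^ 2 := by
  rw [gevreyTerm, normSq2_vcoef]
  by_cases hk : k = 0
  · rw [hk, modes_zero h, h]
    simp
  · have h1 := freqNorm_rpow_neg_mul_rpow hk (σ * s)
    have h2 : Real.exp (-(2 * r * freqNorm k ^ s)) * Real.exp (2 * r * freqNorm k ^ s) = 1 := by
      rw [← Real.exp_add, neg_add_cancel, Real.exp_zero]
    have h3 : Real.exp (r * freqNorm k ^ s) ^ 2 = Real.exp (2 * r * freqNorm k ^ s) := by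
      rw [← exp_two_mul]; congr 1; ring
    rw [modes, norm_smul, mul_pow, Real.norm_of_nonneg (mul_nonneg (Real.exp_pos _).le
      (freqNorm_rpow_nonneg _ _)), mul_pow, h3, mul_assoc 2 σ s, freqNorm_rpow_two_mul, gevreyWeight]
    set e := Real.exp (-(2 * r * freqNorm k ^ s))
    set e' := Real.exp (2 * r * freqNorm k ^ s)
    set n := freqNorm k ^ (-(σ * s))
    set m := freqNorm k ^ (σ * s)
    set v := ‖(WithLp.toLp 2 (vcoef U k) : CVec)‖ ^ 2
    linear_combination (-v) * (n * m) ^ 2 * h2 - v * (n * m + 1) * h1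

lemma one_le_gevreyWeight (s a r : ℝ) (k : Fin 3 → ℤ) : 1 ≤ gevreyWeight s a r k := by
  unfold gevreyWeight
  have : 0 ≤ Real.exp (-(2 * r * freqNorm k ^ s)) * (freqNorm k ^ (-a)) ^ 2 := by positivity
  linarith

lemma freqNorm_rpow_neg_le_one {a : ℝ} (ha : 0 < a) (k : Fin 3 → ℤ) :
    freqNorm k ^ (-a) ≤ 1 := by
  by_cases hk : k = 0
  · rw [hk, freqNorm_zero, Real.zero_rpow (by linarith)]; exact zero_le_one
  · exact Real.rpow_le_one_of_one_le_of_nonpos (one_le_freqNorm hk) (by linarith)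

lemma gevreyWeight_le_two {s a r : ℝ} (ha : 0 < a) (hr : 0 ≤ r) (k : Fin 3 → ℤ) :
    gevreyWeight s a r k ≤ 2 := by
  unfold gevreyWeight
  have h1 : Real.exp (-(2 * r * freqNorm k ^ s)) ≤ 1 := by
    rw [Real.exp_le_one_iff]
    have := freqNorm_rpow_nonneg k s
    have : 0 ≤ 2 * r * freqNorm k ^ s := by positivity
    linarith
  have h2 : (freqNorm k ^ (-a)) ^ 2 ≤ 1 :=
    pow_le_one₀ (freqNorm_rpow_nonneg _ _) (freqNorm_rpow_neg_le_one ha k)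
  have h3 := mul_le_one₀ h1 (sq_nonneg (freqNorm k ^ (-a))) h2
  linarith

lemma summable_modes_sq {U : HField} (h : vcoef U 0 = 0) {σ s r : ℝ} (hU : MemGevrey σ s r U) :
    Summable fun k => ‖modes s (σ * s) r U k‖ ^ 2 :=
  Summable.of_nonneg_of_le (fun k => sq_nonneg _) (fun k => by
    rw [gevreyTerm_eq h]
    exact le_mul_of_one_le_left (sq_nonneg _) (one_le_gevreyWeight _ _ _ _)) hU

lemma ellSq_modes_le {U : HField} (h : vcoef U 0 = 0) {σ s r : ℝ} (hU : MemGevrey σ s r U) :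
    ellSq (modes s (σ * s) r U) ≤ ENNReal.ofReal (gevreyNorm σ s r U ^ 2) := by
  have h0 : ∀ k, ‖modes s (σ * s) r U k‖ ^ 2 ≤ gevreyTerm σ s r U k := fun k => by
    rw [gevreyTerm_eq h]
    exact le_mul_of_one_le_left (sq_nonneg _) (one_le_gevreyWeight _ _ _ _)
  rw [ellSq_eq_ofReal_tsum (summable_modes_sq h hU), gevreyNorm,
    Real.sq_sqrt (tsum_nonneg fun k => (sq_nonneg _).trans (h0 k))]
  exact ENNReal.ofReal_le_ofReal ((summable_modes_sq h hU).tsum_le_tsum h0 hU)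

lemma memGevrey_of_summable {U : HField} (h : vcoef U 0 = 0) {σ s r : ℝ} (ha : 0 < σ * s)
    (hr : 0 ≤ r) (hU : Summable fun k => ‖modes s (σ * s) r U k‖ ^ 2) : MemGevrey σ s r U := by
  refine Summable.of_nonneg_of_le (fun k => ?_) (fun k => ?_) (hU.mul_left 2)
  · rw [gevreyTerm_eq h]
    exact mul_nonneg (zero_le_one.trans (one_le_gevreyWeight _ _ _ _)) (sq_nonneg _)
  · rw [gevreyTerm_eq h]
    exact mul_le_mul_of_nonneg_right (gevreyWeight_le_two ha hr k) (sq_nonneg _)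

/-- The `k`-th term of `gevreyDistSq` in terms of the rescaled modes. -/
lemma gevreyDistSq_eq (σ s r₁ r₂ : ℝ) (U₁ U₂ : HField) :
    gevreyDistSq σ s r₁ r₂ U₁ U₂ = ∑' k,
      (‖(WithLp.toLp 2 (vcoef U₁ k) : CVec) - WithLp.toLp 2 (vcoef U₂ k)‖ ^ 2 +
        ‖modes s (σ * s) r₁ U₁ k - modes s (σ * s) r₂ U₂ k‖ ^ 2) := by
  refine tsum_congr fun k => ?_
  congr 1
  · exact normSq2_eq (WithLp.toLp 2 (vcoef U₁ k) - WithLp.toLp 2 (vcoef U₂ k))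
  · rw [mul_assoc 2 σ s, freqNorm_rpow_two_mul, EuclideanSpace.norm_sq_eq, normSq2,
      Finset.mul_sum]
    refine Finset.sum_congr rfl fun i _ => ?_
    rw [PiLp.sub_apply, modes_apply, modes_apply]
    push_cast
    set N := freqNorm k ^ (σ * s) with hN
    have h1 : ∀ x : ℂ, N ^ 2 * ‖x‖ ^ 2 = ‖(N : ℂ) * x‖ ^ 2 := fun x => by
      rw [norm_mul, Complex.norm_real, Real.norm_of_nonneg (freqNorm_rpow_nonneg _ _), mul_pow]
    rw [h1]
    congr 2
    ring

lemma norm_vcoef_le_norm_modes {U : HField} (h : vcoef U 0 = 0) {s a r : ℝ} (ha : 0 < a)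
    (hr : 0 ≤ r) (k : Fin 3 → ℤ) :
    ‖(WithLp.toLp 2 (vcoef U k) : CVec)‖ ≤ ‖modes s a r U k‖ := by
  rw [vcoef_eq_modes h s a r, norm_smul, Real.norm_of_nonneg (mul_nonneg (Real.exp_pos _).le
    (freqNorm_rpow_nonneg _ _))]
  refine mul_le_of_le_one_left (norm_nonneg _) (mul_le_one₀ ?_ (freqNorm_rpow_nonneg _ _)
    (freqNorm_rpow_neg_le_one ha k))
  rw [Real.exp_le_one_iff]
  have := mul_nonneg hr (freqNorm_rpow_nonneg k s)
  linarith

/-- The strictly positive radius `ρ` is used here: `e^x ≥ x²/2` gains `|k|^{-2s}`, which leaves at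
most `|k|^{-8/5}‖z_k‖`, a product of two square summable sequences. -/
lemma summable_freqNorm_mul {s a ρ : ℝ} (hs : 4 / 5 < s) (ha : 8 / 5 < a) (hρ : 0 < ρ)
    {z : (Fin 3 → ℤ) → CVec} (hz : Summable fun k => ‖z k‖ ^ 2) :
    Summable fun k => freqNorm k *
      (Real.exp (-(ρ * freqNorm k ^ s)) * freqNorm k ^ (-a) * ‖z k‖) := by
  have hsum := ((summable_freqNorm_rpow (p := -(16 / 5)) le_rfl).add hz).mul_left (2 / ρ ^ 2)
  refine Summable.of_nonneg_of_le (fun k => ?_) (fun k => ?_) hsum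
  · have := freqNorm_nonneg k
    have := freqNorm_rpow_nonneg k (-a)
    positivity
  · by_cases hk : k = 0
    · rw [hk, freqNorm_zero, zero_mul, Real.zero_rpow (by norm_num)]
      positivity
    have hN := freqNorm_pos hk
    set N := freqNorm k
    set x := N ^ (-(8 / 5) : ℝ) with hx
    have hx2 : N ^ (-(16 / 5) : ℝ) = x ^ 2 := by
      rw [hx, ← Real.rpow_natCast, ← Real.rpow_mul hN.le]; norm_num
    have hexp : Real.exp (-(ρ * N ^ s)) ≤ 2 / ρ ^ 2 * N ^ (-(2 * s)) := by
      have h1 := Real.quadratic_le_exp_of_nonneg (x := ρ * N ^ s) (by positivity)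
      have h2 : 0 < (ρ * N ^ s) ^ 2 / 2 := by positivity
      have h3 : (ρ * N ^ s) ^ 2 / 2 ≤ Real.exp (ρ * N ^ s) := by
        have : 0 ≤ ρ * N ^ s := by positivity
        linarith
      rw [Real.exp_neg]
      refine (inv_anti₀ h2 h3).trans (le_of_eq ?_)
      have h4 : N ^ (2 * s) = (N ^ s) ^ 2 := freqNorm_rpow_two_mul k s
      rw [Real.rpow_neg hN.le, h4]
      field_simp
    have hpow : N * (N ^ (-(2 * s)) * N ^ (-a)) ≤ x := by
      nth_rw 1 [← Real.rpow_one N]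
      rw [← Real.rpow_add hN, ← Real.rpow_add hN]
      exact Real.rpow_le_rpow_of_exponent_le (one_le_freqNorm hk) (by linarith)
    have hx0 : 0 ≤ x := by positivity
    calc N * (Real.exp (-(ρ * N ^ s)) * N ^ (-a) * ‖z k‖)
        ≤ N * (2 / ρ ^ 2 * N ^ (-(2 * s)) * N ^ (-a) * ‖z k‖) := by gcongr
      _ = 2 / ρ ^ 2 * (N * (N ^ (-(2 * s)) * N ^ (-a)) * ‖z k‖) := by ring
      _ ≤ 2 / ρ ^ 2 * (x * ‖z k‖) := by gcongr
      _ ≤ 2 / ρ ^ 2 * (x ^ 2 + ‖z k‖ ^ 2) := by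
          gcongr
          nlinarith [sq_nonneg (x - ‖z k‖), sq_nonneg (x + ‖z k‖)]
      _ = _ := by rw [hx2]

lemma MemH.of_multiplier {m : (Fin 3 → ℤ) → ℂ} {U V : HField} (hU : MemH U)
    (hV : IsMultiplierImage m U V) (hm : ∀ n, m (reflect n) = m n) : MemH V := by
  obtain ⟨h0, h1, h2⟩ := (memH_iff U).mp hU
  have hv : ∀ n, vcoef V n = fun i => m n * vcoef U n i := fun n => funext fun i => hV n i
  refine (memH_iff V).mpr ⟨?_, fun n hn => ?_, fun n => ?_⟩
  · rw [hv, h0]; funext i; simp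
  · have h3 : hdot n (vcoef V n) = m n * hdot n (vcoef U n) := by
      rw [hv]; simp only [hdot, Fin.sum_univ_two]; ring
    rw [h3, h1 n hn, mul_zero]
  · rw [hv, hv, hm, h2]

lemma hasDerivWithinAt_cvec_iff {f : ℝ → CVec} {f' : CVec} {S : Set ℝ} {x : ℝ} :
    HasDerivWithinAt f f' S x ↔ ∀ i, HasDerivWithinAt (fun τ => f τ i) (f' i) S x := by
  refine ⟨fun h i => ?_, fun h => ?_⟩
  · exact ((EuclideanSpace.proj i : CVec →L[ℂ] ℂ).restrictScalars ℝ).hasFDerivAt.comp_hasDerivWithinAt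
      x h
  · have h1 : HasDerivWithinAt (fun τ i => f τ i) (fun i => f' i) S x :=
      hasDerivWithinAt_pi.mpr h
    exact ((PiLp.continuousLinearEquiv 2 ℝ (fun _ : Fin 2 => ℂ)).symm :
      (Fin 2 → ℂ) →L[ℝ] PiLp 2 (fun _ : Fin 2 => ℂ)).hasFDerivAt.comp_hasDerivWithinAt x h1

/-! ### The random PDE in terms of the rescaled modes -/

/-- The data of the random PDE. -/
structure FlowData where
  s : ℝ
  σ : ℝ
  ν : ℝ
  α : ℝ
  β : ℝ
  η : ℝ
  ω : WienerSpace
  s_gt : 4 / 5 < s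
  s_le : s ≤ 1
  σ_gt : 8 / (5 * s) < σ
  σ_lt : σ < 2
  α_pos : 0 < α
  β_pos : 0 < β
  β_lt : β < ν ^ 2 / 2
  η_pos : 0 < η
  ω_mem : ω ∈ goodPaths α β ν

namespace FlowData

variable (F : FlowData)

/-- The radius of analyticity. -/
def radius (τ : ℝ) : ℝ := F.α + F.β * τ + F.η

lemma radius_pos {τ : ℝ} (hτ : 0 ≤ τ) : 0 < F.radius τ := by
  have := F.α_pos
  have := F.η_pos
  have := mul_nonneg F.β_pos.le hτ
  unfold radius
  linarith

lemma regularity_gt : 8 / 5 < F.σ * F.s := by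
  have hs : 0 < F.s := by linarith [F.s_gt]
  have h := (div_lt_iff₀ (by positivity : 0 < 5 * F.s)).mp F.σ_gt
  linarith

/-- The equation for the rescaled modes. -/
def flow : ModeFlow where
  s := F.s
  a := F.σ * F.s
  κ := F.ν ^ 2 / 2 - F.β
  -- The second term is the derivative of `e^{r(t)|k|^s}`, as `r' = β`.
  rate k := 1 / 2 * F.ν ^ 2 * freqNorm k ^ (2 * F.s) - F.β * freqNorm k ^ F.s
  ρ t := F.radius t - F.ν * F.ω.1 t
  s_gt := F.s_gt
  s_le := F.s_le
  a_gt := F.regularity_gt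
  a_lt := mul_lt_mul_of_pos_right F.σ_lt (by linarith [F.s_gt])
  κ_pos := by linarith [F.β_lt]
  rate_zero := by
    have := F.s_gt
    rw [freqNorm_zero, Real.zero_rpow (by linarith), Real.zero_rpow (by linarith)]; ring
  -- As `|k| ≥ 1`, the loss `β|k|^s` is at most `β|k|^{2s}`, which leaves the constant `ν²/2 - β`.
  le_rate k hk := by
    have := F.s_gt
    have h1 : freqNorm k ^ F.s ≤ freqNorm k ^ (2 * F.s) :=
      Real.rpow_le_rpow_of_exponent_le (one_le_freqNorm hk) (by linarith)
    nlinarith [F.β_pos]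
  ρ_cont := by
    have := F.ω.1.continuous
    unfold radius
    fun_prop
  ρ_nonneg t := by
    have h := F.ω_mem t
    have := F.η_pos
    unfold radius
    linarith

lemma flow_ρ_pos (t : ℝ≥0) : 0 < F.flow.ρ t := by
  have h := F.ω_mem t
  have := F.η_pos
  change 0 < F.radius t - F.ν * F.ω.1 t
  unfold radius
  linarith

lemma flow_ρ (t : ℝ≥0) : F.flow.ρ t = F.radius t - F.ν * F.ω.1 t := rfl

lemma rate_neg (k : Fin 3 → ℤ) : F.flow.rate (-k) = F.flow.rate k := by
  simp only [flow, freqNorm_neg]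

lemma rate_reflect (k : Fin 3 → ℤ) : F.flow.rate (reflect k) = F.flow.rate k := by
  simp only [flow, freqNorm_reflect]

/-- The rescaled modes at time `t`. -/
abbrev modesAt (t : ℝ≥0) (U : HField) : (Fin 3 → ℤ) → CVec :=
  modes F.s (F.σ * F.s) (F.radius t) U

lemma exp_smul_vcoef (t : ℝ≥0) {U : HField} (hU : vcoef U 0 = 0) (n : Fin 3 → ℤ) :
    (Real.exp (F.ν * F.ω.1 t * freqNorm n ^ F.s) • WithLp.toLp 2 (vcoef U n) : CVec) =
      (Real.exp (-(F.flow.ρ t * freqNorm n ^ F.s)) * freqNorm n ^ (-(F.σ * F.s))) •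
        F.modesAt t U n := by
  rw [vcoef_eq_modes hU F.s (F.σ * F.s) (F.radius t), smul_smul, ← mul_assoc, ← Real.exp_add,
    flow_ρ]
  congr 3
  ring

lemma summable_freqNorm_mul_exp (t : ℝ≥0) {U : HField} (hU : vcoef U 0 = 0)
    (hz : Summable fun k => ‖F.modesAt t U k‖ ^ 2) (i : Fin 2) :
    Summable fun n => freqNorm n *
      ‖(Real.exp (F.ν * F.ω.1 t * freqNorm n ^ F.s) : ℂ) * vcoef U n i‖ := by
  refine Summable.of_nonneg_of_le
    (fun n => mul_nonneg (freqNorm_nonneg n) (norm_nonneg _)) (fun n => ?_)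
    (summable_freqNorm_mul F.s_gt F.regularity_gt (F.flow_ρ_pos t) hz)
  refine mul_le_mul_of_nonneg_left ?_ (freqNorm_nonneg n)
  have h1 := PiLp.norm_apply_le
    (Real.exp (F.ν * F.ω.1 t * freqNorm n ^ F.s) • WithLp.toLp 2 (vcoef U n) : CVec) i
  rwa [exp_smul_vcoef F t hU, norm_smul, Real.norm_of_nonneg (mul_nonneg (Real.exp_pos _).le
    (freqNorm_rpow_nonneg _ _)), ← exp_smul_vcoef F t hU, PiLp.smul_apply, Complex.real_smul] at h1

/-- The nonlinearity of the random PDE in terms of the rescaled modes. -/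
lemma advection_modes (t : ℝ≥0) {U V : HField} {D : Fin 3 → HField} (hU : MemH U)
    (hz : Summable fun k => ‖F.modesAt t U k‖ ^ 2)
    (hV : IsMultiplierImage (fun n => (Real.exp (F.ν * F.ω.1 t * freqNorm n ^ F.s) : ℂ)) U V)
    (hD : ∀ j, IsWeakPartial j V (D j)) :
    (∀ i, Integrable (advection V D i) torusMeasure) ∧ ∀ n i,
      (Real.exp (F.radius t * freqNorm n ^ F.s) : ℂ) *
        leray n (fun l => (Real.exp (-(F.ν * F.ω.1 t * freqNorm n ^ F.s)) : ℂ) *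
          coef (advection V D l) n) i = F.flow.nl t (F.modesAt t U) (F.modesAt t U) n i := by
  have hU0 := ((memH_iff U).mp hU).1
  have hVH : MemH V := hU.of_multiplier hV fun n => by rw [freqNorm_reflect]
  set z := F.modesAt t U with hzdef
  have hVz : ∀ n, (WithLp.toLp 2 (vcoef V n) : CVec) =
      (Real.exp (-(F.flow.ρ t * freqNorm n ^ F.s)) * freqNorm n ^ (-(F.σ * F.s))) • z n := by
    intro n
    rw [← F.exp_smul_vcoef t hU0]
    ext i
    simpa [Complex.real_smul] using hV n i
  have hVs : ∀ i, Summable fun n => freqNorm n * ‖vcoef V n i‖ := fun i =>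
    (F.summable_freqNorm_mul_exp t hU0 hz i).congr fun n => by rw [hV n i]
  refine ⟨fun i => (advection_coef hVH hD hVs i).1, fun n i => ?_⟩
  set A : CVec := WithLp.toLp 2 fun l => coef (advection V D l) n with hA
  have hsumA : HasSum (fun m => transportSymbol m (n - m) (vcoef V m) •
      (WithLp.toLp 2 (vcoef V (n - m)) : CVec)) A := by
    have h1 : HasSum (fun m l => transportSymbol m (n - m) (vcoef V m) * vcoef V (n - m) l)
        (fun l => coef (advection V D l) n) :=
      Pi.hasSum.mpr fun l => (advection_coef hVH hD hVs l).2 n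
    exact ((PiLp.continuousLinearEquiv 2 ℂ (fun _ : Fin 2 => ℂ)).symm :
      (Fin 2 → ℂ) →L[ℂ] PiLp 2 (fun _ : Fin 2 => ℂ)).hasSum h1
  have hsumL := ((lerayLin n).mkContinuous 2 (norm_lerayLin_le n)).hasSum hsumA
  have hsumE := hsumL.const_smul (Real.exp (F.flow.ρ t * freqNorm n ^ F.s))
  have hnl : F.flow.nl t z z n = Real.exp (F.flow.ρ t * freqNorm n ^ F.s) • lerayLin n A := by
    refine (hsumE.congr_fun fun m => ?_).tsum_eq
    change F.flow.nlTerm t n m (z m) (z (n - m)) = Real.exp _ • lerayLin n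
      (transportSymbol m (n - m) (WithLp.toLp 2 (vcoef V m) : CVec) •
        (WithLp.toLp 2 (vcoef V (n - m)) : CVec))
    rw [hVz, hVz, F.flow.nlTerm_eq, ModeFlow.weight]
    set l := n - m
    change (Real.exp (F.flow.ρ t * (freqNorm n ^ F.s - freqNorm m ^ F.s - freqNorm l ^ F.s)) *
      (freqNorm m ^ (-(F.σ * F.s)) * freqNorm l ^ (-(F.σ * F.s)))) • _ = _
    set e₁ := Real.exp (-(F.flow.ρ t * freqNorm m ^ F.s)) * freqNorm m ^ (-(F.σ * F.s))
    set e₂ := Real.exp (-(F.flow.ρ t * freqNorm l ^ F.s)) * freqNorm l ^ (-(F.σ * F.s))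
    have hc : ∀ (r : ℝ) (c : CVec), r • c = (r : ℂ) • c := fun r c => (Complex.coe_smul r c).symm
    rw [hc e₁, transportSymbol_smul, hc e₂, smul_smul, map_smul, hc, hc, smul_smul, smul_smul]
    congr 1
    -- Each coefficient of `V` contributes its own decay `e^{-ρ|·|^s}`, while the outer factor is
    -- `e^{r|n|^s} e^{-νW|n|^s} = e^{ρ|n|^s}`; together they form the exponential in `weight`.
    have he : Real.exp (F.flow.ρ t * (freqNorm n ^ F.s - freqNorm m ^ F.s - freqNorm l ^ F.s)) =
        Real.exp (F.flow.ρ t * freqNorm n ^ F.s) * (Real.exp (-(F.flow.ρ t * freqNorm m ^ F.s)) *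
          Real.exp (-(F.flow.ρ t * freqNorm l ^ F.s))) := by
      rw [← Real.exp_add, ← Real.exp_add]; congr 1; ring
    rw [he]
    simp only [e₁, e₂]
    push_cast
    ring
  have hl : leray n (fun l => (Real.exp (-(F.ν * F.ω.1 t * freqNorm n ^ F.s)) : ℂ) *
      coef (advection V D l) n) i = (Real.exp (-(F.ν * F.ω.1 t * freqNorm n ^ F.s)) : ℂ) *
        lerayLin n A i := by
    have := congrArg (fun c : CVec => c i)
      ((lerayLin n).map_smul (Real.exp (-(F.ν * F.ω.1 t * freqNorm n ^ F.s)) : ℂ) A)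
    exact this
  rw [hl, hnl, ← mul_assoc, ← Complex.ofReal_mul, ← Real.exp_add, PiLp.smul_apply,
    Complex.real_smul]
  congr 3
  rw [flow_ρ]; ring

end FlowData

/-! ### Fields with prescribed modes -/

lemma vcoef_neg (U : HField) (n : Fin 3 → ℤ) (i : Fin 2) :
    vcoef U (-n) i = conj (vcoef U n i) := coef_neg _ n

lemma exists_isMultiplierImage {m : (Fin 3 → ℤ) → ℂ} {U : HField}
    (hm : ∀ n, m (-n) = conj (m n)) (hs : ∀ i, Summable fun n => ‖m n * vcoef U n i‖) :
    ∃ V, IsMultiplierImage m U V :=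
  exists_hfield_of_coef (c := fun n i => m n * vcoef U n i) hs fun n i => by
    rw [hm, vcoef_neg, map_mul]

lemma isSymmetric_modes {U : HField} (hU : MemH U) (s a r : ℝ) :
    IsSymmetric (modes s a r U) := by
  obtain ⟨-, h1, h2⟩ := (memH_iff U).mp hU
  refine ⟨fun k => ?_, fun k => ?_, fun k hk => ?_⟩
  · ext i
    rw [conjVec_apply, modes_apply, modes_apply, vcoef_neg, freqNorm_neg, map_mul,
      Complex.conj_ofReal]
  · rw [modes, modes, h2, freqNorm_reflect]
  · have h3 := (hdotCLM k).map_smul (Real.exp (r * freqNorm k ^ s) * freqNorm k ^ a)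
      (WithLp.toLp 2 (vcoef U k))
    rw [hdotCLM_apply, hdotCLM_apply] at h3
    exact h3.trans (by rw [show hdot k _ = 0 from h1 k hk, smul_zero])

lemma exists_memH_modes_eq {s a r : ℝ} (hs : 4 / 5 < s) (ha : 8 / 5 < a) (hr : 0 < r)
    {z : (Fin 3 → ℤ) → CVec} (hz : Summable fun k => ‖z k‖ ^ 2) (h0 : z 0 = 0)
    (hsym : IsSymmetric z) : ∃ U, MemH U ∧ modes s a r U = z := by
  set g : (Fin 3 → ℤ) → ℝ := fun k => Real.exp (-(r * freqNorm k ^ s)) * freqNorm k ^ (-a) with hg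
  have hg0 : ∀ k, 0 ≤ g k := fun k => mul_nonneg (Real.exp_pos _).le (freqNorm_rpow_nonneg _ _)
  have hgneg : ∀ k, g (-k) = g k := fun k => by simp only [hg, freqNorm_neg]
  have hgref : ∀ k, g (reflect k) = g k := fun k => by simp only [hg, freqNorm_reflect]
  have hsum : ∀ i, Summable fun k => ‖(g k • z k) i‖ := fun i => by
    refine Summable.of_nonneg_of_le (fun _ => norm_nonneg _) (fun k => ?_)
      (summable_freqNorm_mul hs ha hr hz)
    by_cases hk : k = 0
    · simp [hk, h0]
    refine (PiLp.norm_apply_le _ i).trans ?_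
    rw [norm_smul, Real.norm_of_nonneg (hg0 k)]
    exact le_mul_of_one_le_left (mul_nonneg (hg0 k) (norm_nonneg _)) (one_le_freqNorm hk)
  obtain ⟨U, hU⟩ := exists_hfield_of_coef (c := fun k i => (g k • z k) i) hsum fun k i => by
    rw [hgneg, hsym.neg, PiLp.smul_apply, PiLp.smul_apply, conjVec_apply, Complex.real_smul,
      Complex.real_smul, map_mul, Complex.conj_ofReal]
  have hUz : ∀ k, (WithLp.toLp 2 (vcoef U k) : CVec) = g k • z k := fun k => by
    ext i; exact hU k i
  have hU' : ∀ k, vcoef U k = fun i => (g k • z k) i := fun k => funext fun i => hU k i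
  refine ⟨U, (memH_iff U).mpr ⟨?_, fun k hk => ?_, fun k => ?_⟩, funext fun k => ?_⟩
  · rw [hU', h0]; funext i; simp
  · have h3 := (hdotCLM k).map_smul (g k) (z k)
    rw [hdotCLM_apply, hdotCLM_apply, hsym.div_free k hk, smul_zero] at h3
    rw [hU']; exact h3
  · rw [hU', hU', hgref, hsym.reflect]
  · rw [modes, hUz, smul_smul]
    by_cases hk : k = 0
    · rw [hk, h0, smul_zero]
    · have h1 := freqNorm_rpow_neg_mul_rpow hk a
      have h2 : Real.exp (r * freqNorm k ^ s) * Real.exp (-(r * freqNorm k ^ s)) = 1 := by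
        rw [← Real.exp_add, add_neg_cancel, Real.exp_zero]
      have h3 : Real.exp (r * freqNorm k ^ s) * freqNorm k ^ a * g k = 1 := by
        simp only [hg]
        linear_combination
          (Real.exp (r * freqNorm k ^ s) * Real.exp (-(r * freqNorm k ^ s))) * h1 + h2
      rw [h3, one_smul]

namespace FlowData

variable (F : FlowData)

lemma hasDerivAt_radius_mul (c τ : ℝ) :
    HasDerivAt (fun τ => F.radius τ * c) (F.β * c) τ := by
  have h := ((((hasDerivAt_id τ).const_mul F.β).const_add F.α).add_const F.η).mul_const c
  simpa [radius] using! h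

/-- The random PDE is the equation for the rescaled modes. -/
lemma solvesRandomPDE_iff {U : ℝ≥0 → HField} (hU : ∀ t, MemH (U t))
    (hz : ∀ t, Summable fun k => ‖F.modesAt t (U t) k‖ ^ 2) :
    SolvesRandomPDE F.ν F.s F.ω U ↔ F.flow.IsModeSolution fun t => F.modesAt t (U t) := by
  have hU0 : ∀ t, vcoef (U t) 0 = 0 := fun t => ((memH_iff _).mp (hU t)).1
  have hrate : ∀ k, F.flow.rate k =
    1 / 2 * F.ν ^ 2 * freqNorm k ^ (2 * F.s) - F.β * freqNorm k ^ F.s := fun k => rfl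
  constructor
  · intro h k t
    obtain ⟨V, D, hV, hD, -, heq⟩ := h t
    have hnl := (F.advection_modes t (hU t) (hz t) hV hD).2 k
    refine hasDerivWithinAt_cvec_iff.mpr fun i => ?_
    have h1 := ((F.hasDerivAt_radius_mul (freqNorm k ^ F.s) t).exp.mul_const
      (freqNorm k ^ (F.σ * F.s))).ofReal_comp.hasDerivWithinAt (s := Set.Ici 0)
    have h2 := h1.mul (heq k i)
    refine (h2.congr_deriv ?_).congr (fun τ hτ => ?_) ?_
    · change _ = (-F.flow.rate k • F.modesAt t (U t) k) i -
        (freqNorm k ^ (F.σ * F.s) • F.flow.nl t _ _ k) i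
      rw [PiLp.smul_apply, PiLp.smul_apply, ← hnl i, modes_apply, hrate, Real.toNNReal_coe]
      simp only [Complex.real_smul]
      push_cast
      ring
    · rw [modes_apply, Real.coe_toNNReal τ hτ]; rfl
    · rw [modes_apply, Real.coe_toNNReal _ t.coe_nonneg]; rfl
  · intro h t
    -- The decay `e^{-ρ|k|^s}` with `ρ > 0` makes the coefficients of `Γ⁻¹U` and of its first
    -- derivatives absolutely summable, so these fields exist in `L²`.
    obtain ⟨V, hV⟩ := exists_isMultiplierImage
      (m := fun n => (Real.exp (F.ν * F.ω.1 t * freqNorm n ^ F.s) : ℂ)) (U := U t)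
      (fun n => by rw [freqNorm_neg, Complex.conj_ofReal])
      (fun i => (F.summable_freqNorm_mul_exp t (hU0 t) (hz t) i).of_nonneg_of_le
        (fun _ => norm_nonneg _) fun n => by
          by_cases hn : n = 0
          · simp [hn, hU0]
          · exact le_mul_of_one_le_left (norm_nonneg _) (one_le_freqNorm hn))
    have hDex : ∀ j, ∃ D, IsWeakPartial j V D := fun j => by
      refine exists_isMultiplierImage (fun n => ?_) fun i =>
        (F.summable_freqNorm_mul_exp t (hU0 t) (hz t) i).of_nonneg_of_le
          (fun _ => norm_nonneg _) fun n => ?_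
      · simp only [Pi.neg_apply, map_mul, map_ofNat, Complex.conj_ofReal, Complex.conj_I,
          map_intCast]
        push_cast
        ring
      · rw [hV n i, norm_mul]
        exact mul_le_mul_of_nonneg_right (norm_two_pi_I_mul_le n j) (norm_nonneg _)
    choose D hD using hDex
    obtain ⟨hint, hnl⟩ := F.advection_modes t (hU t) (hz t) hV hD
    refine ⟨V, D, hV, hD, hint, fun k i => ?_⟩
    have h1 := (((F.hasDerivAt_radius_mul (freqNorm k ^ F.s) t).neg.exp.mul_const
      (freqNorm k ^ (-(F.σ * F.s))))).ofReal_comp.hasDerivWithinAt (s := Set.Ici 0)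
    have h2 := h1.mul (hasDerivWithinAt_cvec_iff.mp (h k t) i)
    have hvc : ∀ t, vcoef (U t) k i = ((Real.exp (-(F.radius t * freqNorm k ^ F.s)) *
        freqNorm k ^ (-(F.σ * F.s)) : ℝ) : ℂ) * F.modesAt t (U t) k i := fun t => by
      rw [← Complex.real_smul, ← PiLp.smul_apply, ← vcoef_eq_modes (hU0 t)]
    refine (h2.congr_deriv ?_).congr (fun τ hτ => ?_) ?_
    -- At `k = 0` the product of powers is `0` instead of `1`; the identity survives because the
    -- nonlinearity has no zero mode.
    · have h3 : ((freqNorm k ^ (-(F.σ * F.s)) * freqNorm k ^ (F.σ * F.s) : ℝ) : ℂ) *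
          F.flow.nl t (F.modesAt t (U t)) (F.modesAt t (U t)) k i =
          F.flow.nl t (F.modesAt t (U t)) (F.modesAt t (U t)) k i := by
        by_cases hk : k = 0
        · rw [hk, F.flow.nl_zero t (isSymmetric_modes (hU t) _ _ _).div_free, PiLp.zero_apply,
            mul_zero]
        · rw [freqNorm_rpow_neg_mul_rpow hk, Complex.ofReal_one, one_mul]
      have h4 : (Real.exp (-(F.radius t * freqNorm k ^ F.s)) : ℂ) *
          Real.exp (F.radius t * freqNorm k ^ F.s) = 1 := by
        rw [← Complex.ofReal_mul, ← Real.exp_add, neg_add_cancel, Real.exp_zero,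
          Complex.ofReal_one]
      rw [hvc t]
      have h5 := hnl k i
      rw [Real.toNNReal_coe]
      change _ * _ + _ * ((-F.flow.rate k • F.modesAt t (U t) k) i -
        (freqNorm k ^ (F.σ * F.s) • F.flow.nl t _ _ k) i) = _
      rw [PiLp.smul_apply, PiLp.smul_apply, hrate]
      simp only [Complex.real_smul, Pi.neg_apply]
      set L := leray k _ i
      set n := F.flow.nl t (F.modesAt t (U t)) (F.modesAt t (U t)) k i
      set e := Real.exp (-(F.radius t * freqNorm k ^ F.s))
      set e' := Real.exp (F.radius t * freqNorm k ^ F.s)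
      push_cast at h3 ⊢
      linear_combination (-(e : ℂ)) * h3 - L * h4 + (e : ℂ) * h5
    · rw [hvc, Real.coe_toNNReal τ hτ]; rfl
    · rw [hvc, Real.coe_toNNReal _ t.coe_nonneg]; rfl

/-! ### Well-posedness of the random PDE -/

lemma exists_ellSq_modesAt_le {U : ℝ≥0 → HField}
    (hU : MemCGevrey F.σ F.s (fun t => F.radius t) U) (T : ℝ≥0) :
    ∃ M : ℝ, ∀ t ≤ T, ellSq (F.modesAt t (U t)) ≤ ENNReal.ofReal M := by
  have ha : 0 < F.σ * F.s := by linarith [F.regularity_gt]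
  have hU0 : ∀ t, vcoef (U t) 0 = 0 := fun t => ((memH_iff _).mp (hU.mem_H t)).1
  have hz : ∀ t, Summable fun k => ‖F.modesAt t (U t) k‖ ^ 2 := fun t =>
    summable_modes_sq (hU0 t) (hU.mem_gevrey t)
  have hzsub : ∀ t t₀, Summable fun k =>
      ‖F.modesAt t (U t) k - F.modesAt t₀ (U t₀) k‖ ^ 2 := fun t t₀ =>
    ellSq_ne_top_iff.mp (ellSq_sub_ne_top (ellSq_ne_top_iff.mpr (hz t))
      (ellSq_ne_top_iff.mpr (hz t₀)))
  have hu : ∀ t, Summable fun k => ‖(WithLp.toLp 2 (vcoef (U t) k) : CVec)‖ ^ 2 := fun t =>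
    (hz t).of_nonneg_of_le (fun _ => sq_nonneg _) fun k => pow_le_pow_left₀ (norm_nonneg _)
      (norm_vcoef_le_norm_modes (hU0 t) ha (F.radius_pos t.coe_nonneg).le k) 2
  have husub : ∀ t t₀, Summable fun k => ‖(WithLp.toLp 2 (vcoef (U t) k) : CVec) -
      WithLp.toLp 2 (vcoef (U t₀) k)‖ ^ 2 := fun t t₀ =>
    ellSq_ne_top_iff.mp (ellSq_sub_ne_top (ellSq_ne_top_iff.mpr (hu t))
      (ellSq_ne_top_iff.mpr (hu t₀)))
  suffices H : ∃ M : ℝ, ∀ t ∈ Set.Icc 0 T, ellSq (F.modesAt t (U t)) ≤ ENNReal.ofReal M by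
    obtain ⟨M, hM⟩ := H
    exact ⟨M, fun t ht => hM t ⟨t.2, ht⟩⟩
  refine isCompact_Icc.induction_on
    (p := fun S => ∃ M : ℝ, ∀ t ∈ S, ellSq (F.modesAt t (U t)) ≤ ENNReal.ofReal M)
    ⟨0, fun t ht => ht.elim⟩ (fun S S' hS ⟨M, hM⟩ => ⟨M, fun t ht => hM t (hS ht)⟩)
    (fun S S' ⟨M, hM⟩ ⟨M', hM'⟩ => ⟨max M M', fun t ht => ?_⟩) fun t₀ _ => ?_
  · rcases ht with ht | ht
    · exact (hM t ht).trans (ENNReal.ofReal_le_ofReal (le_max_left _ _))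
    · exact (hM' t ht).trans (ENNReal.ofReal_le_ofReal (le_max_right _ _))
  -- Near `t₀` the modes are within `ℓ²` distance `1` of those at `t₀`; compactness of `[0,T]` turns
  -- these local bounds into one.
  · have hev := (hU.continuous t₀).eventually (gt_mem_nhds one_pos)
    refine ⟨_, mem_nhdsWithin_of_mem_nhds hev,
      (2 * (ENNReal.ofReal 1 + ellSq (F.modesAt t₀ (U t₀)))).toReal, fun t ht => ?_⟩
    have hfin : 2 * (ENNReal.ofReal 1 + ellSq (F.modesAt t₀ (U t₀))) ≠ ∞ :=
      ENNReal.mul_ne_top (by simp)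
        (ENNReal.add_ne_top.mpr ⟨by simp, ellSq_ne_top_iff.mpr (hz t₀)⟩)
    rw [ENNReal.ofReal_toReal hfin]
    have h1 : ellSq (F.modesAt t (U t) - F.modesAt t₀ (U t₀)) ≤ ENNReal.ofReal 1 := by
      rw [ellSq_eq_ofReal_tsum (z := F.modesAt t (U t) - F.modesAt t₀ (U t₀)) (hzsub t t₀)]
      refine ENNReal.ofReal_le_ofReal (le_trans ?_ (le_of_lt ht))
      rw [gevreyDistSq_eq]
      exact (hzsub t t₀).tsum_le_tsum (fun k => le_add_of_nonneg_left (sq_nonneg _))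
        ((husub t t₀).add (hzsub t t₀))
    have h2 := ellSq_sub_le (F.modesAt t (U t) - F.modesAt t₀ (U t₀)) (-F.modesAt t₀ (U t₀))
    have h3 : ellSq (-F.modesAt t₀ (U t₀)) = ellSq (F.modesAt t₀ (U t₀)) :=
      tsum_congr fun k => by rw [Pi.neg_apply, enorm_neg]
    rw [sub_neg_eq_add, sub_add_cancel, h3] at h2
    exact h2.trans (by gcongr)

lemma unique_globalSolution {U₀ : HField} {U U' : ℝ≥0 → HField}
    (hU : IsGlobalSolution F.ν F.σ F.s (fun t => F.radius t) F.ω U₀ U)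
    (hU' : IsGlobalSolution F.ν F.σ F.s (fun t => F.radius t) F.ω U₀ U') : U' = U := by
  have hmode : ∀ {W}, IsGlobalSolution F.ν F.σ F.s (fun t => F.radius t) F.ω U₀ W →
      F.flow.IsModeSolution fun t => F.modesAt t (W t) := fun hW =>
    (F.solvesRandomPDE_iff hW.mem.mem_H fun t => summable_modes_sq
      ((memH_iff _).mp (hW.mem.mem_H t)).1 (hW.mem.mem_gevrey t)).mp hW.solves
  have h := (hmode hU').unique (hmode hU) (F.exists_ellSq_modesAt_le hU'.mem)
    (F.exists_ellSq_modesAt_le hU.mem) (by rw [hU.initial, hU'.initial])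
  funext t
  exact hfield_ext_modes ((memH_iff _).mp (hU'.mem.mem_H t)).1
    ((memH_iff _).mp (hU.mem.mem_H t)).1 (congrFun h t)

/-- Each mode is continuous, and the square summable suprema `sup_t |z_k(t)|` dominate the series,
so the limit may be taken termwise. The supremum stands inside the sum in the norm of `ModeSpace`
for this reason too. -/
lemma tendsto_gevreyDistSq {U : ℝ≥0 → HField} (hU : ∀ t, vcoef (U t) 0 = 0) {z : ModeSpace}
    (hz : ∀ t, F.modesAt t (U t) = fun k => z k t) (t₀ : ℝ≥0) :
    Filter.Tendsto (fun t : ℝ≥0 => gevreyDistSq F.σ F.s (F.radius t) (F.radius t₀) (U t) (U t₀))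
      (nhds t₀) (nhds 0) := by
  have ha : 0 < F.σ * F.s := by linarith [F.regularity_gt]
  have hzk : ∀ k t, ‖z k t‖ ≤ ‖z k‖ := fun k t => (z k).norm_coe_le_norm t
  have hu : ∀ k t, ‖(WithLp.toLp 2 (vcoef (U t) k) : CVec)‖ ≤ ‖z k‖ := fun k t =>
    (norm_vcoef_le_norm_modes (hU t) ha (F.radius_pos t.coe_nonneg).le k).trans
      ((congrArg norm (congrFun (hz t) k)).le.trans (hzk k t))
  have hsub : ∀ {a b : CVec} {c : ℝ}, ‖a‖ ≤ c → ‖b‖ ≤ c → ‖a - b‖ ^ 2 ≤ 4 * c ^ 2 :=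
    fun {a b c} h h' => by
      have h1 : ‖a - b‖ ≤ 2 * c := (norm_sub_le a b).trans (by linarith)
      nlinarith [norm_nonneg (a - b)]
  have hsum := (ellSq_ne_top_iff.mp (ellSq_coe_ne_top z)).mul_left 8
  have hlim := tendsto_tsum_of_dominated_convergence (𝓕 := nhds t₀)
    (f := fun (t : ℝ≥0) k => ‖(WithLp.toLp 2 (vcoef (U t) k) : CVec) -
      WithLp.toLp 2 (vcoef (U t₀) k)‖ ^ 2 + ‖z k t - z k t₀‖ ^ 2)
    (g := fun _ => (0 : ℝ)) hsum (fun k => ?_) (Filter.Eventually.of_forall fun t k => ?_)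
  · rw [tsum_zero] at hlim
    refine hlim.congr fun t => ?_
    rw [gevreyDistSq_eq]
    refine tsum_congr fun k => ?_
    rw [show modes F.s (F.σ * F.s) (F.radius t) (U t) k = z k t from congrFun (hz t) k,
      show modes F.s (F.σ * F.s) (F.radius t₀) (U t₀) k = z k t₀ from congrFun (hz t₀) k]
  · have hc : Continuous fun t : ℝ≥0 => (WithLp.toLp 2 (vcoef (U t) k) : CVec) := by
      have h1 : (fun t : ℝ≥0 => (WithLp.toLp 2 (vcoef (U t) k) : CVec)) = fun t : ℝ≥0 =>
          (Real.exp (-(F.radius t * freqNorm k ^ F.s)) * freqNorm k ^ (-(F.σ * F.s))) • z k t :=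
        funext fun t => by
          rw [vcoef_eq_modes (hU t) F.s (F.σ * F.s) (F.radius t)]
          exact congrArg _ (congrFun (hz t) k)
      rw [h1]
      have := (z k).continuous
      unfold radius
      fun_prop
    have hcz := (z k).continuous
    have h2 : Continuous fun t : ℝ≥0 => ‖(WithLp.toLp 2 (vcoef (U t) k) : CVec) -
        WithLp.toLp 2 (vcoef (U t₀) k)‖ ^ 2 + ‖z k t - z k t₀‖ ^ 2 := by fun_prop
    simpa using! h2.tendsto t₀
  · have h1 := hsub (hu k t) (hu k t₀)
    have h2 := hsub (hzk k t) (hzk k t₀)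
    rw [Real.norm_of_nonneg (by positivity)]
    linarith

lemma hasDerivAt_gevreyWeight (k : Fin 3 → ℤ) (τ : ℝ) :
    HasDerivAt (fun τ => gevreyWeight F.s (F.σ * F.s) (F.radius τ) k)
      (Real.exp (-(2 * F.radius τ * freqNorm k ^ F.s)) * -(F.β * (2 * freqNorm k ^ F.s)) *
        (freqNorm k ^ (-(F.σ * F.s))) ^ 2) τ := by
  have h := (((F.hasDerivAt_radius_mul (2 * freqNorm k ^ F.s) τ).neg.exp.mul_const
    ((freqNorm k ^ (-(F.σ * F.s))) ^ 2))).const_add 1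
  have h1 : ∀ τ, F.radius τ * (2 * freqNorm k ^ F.s) = 2 * F.radius τ * freqNorm k ^ F.s :=
    fun τ => by ring
  simpa only [Pi.neg_apply, h1] using! h

theorem exists_globalSolution {U₀ : HField} (hU₀ : MemH U₀)
    (hG : MemGevrey F.σ F.s (F.α + F.η) U₀)
    (hsmall : 16 * convConst * gevreyNorm F.σ F.s (F.α + F.η) U₀ ≤ F.ν ^ 2 / 2 - F.β) :
    ∃ U, IsGlobalSolution F.ν F.σ F.s (fun t => F.radius t) F.ω U₀ U ∧
      Antitone fun t : ℝ≥0 => gevreyNorm F.σ F.s (F.radius t) (U t) := by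
  have ha : 0 < F.σ * F.s := by linarith [F.regularity_gt]
  have hr0 : F.radius (0 : ℝ≥0) = F.α + F.η := by simp [radius]
  rw [← hr0] at hG hsmall
  have hU₀0 := ((memH_iff _).mp hU₀).1
  have hy := summable_modes_sq hU₀0 hG
  obtain ⟨y, hyU⟩ : ∃ y : lp (fun _ : Fin 3 → ℤ => CVec) 2,
      (y : (Fin 3 → ℤ) → CVec) = F.modesAt 0 U₀ :=
    ⟨⟨F.modesAt 0 U₀, memℓp_two_iff.mpr (ellSq_ne_top_iff.mpr hy)⟩, rfl⟩
  have hyn : ‖y‖ ≤ gevreyNorm F.σ F.s (F.radius (0 : ℝ≥0)) U₀ :=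
    lp_norm_le_of_ellSq_le (Real.sqrt_nonneg _) (by rw [hyU]; exact ellSq_modes_le hU₀0 hG)
  have hysym : IsSymmetric y := by rw [hyU]; exact isSymmetric_modes hU₀ _ _ _
  have hy0 : y 0 = 0 := by rw [hyU]; exact modes_zero hU₀0
  obtain ⟨z, hzsym, hzfix, hzmono⟩ := F.flow.exists_solution y
    ((mul_le_mul_of_nonneg_left hyn (by linarith [convConst_pos])).trans hsmall)
    isClosed_isSymmetric (fun t => F.flow.isSymmetric_linearFlow F.rate_neg F.rate_reflect hysym t)
    (fun z hz t => F.flow.isSymmetric_rhs F.rate_neg F.rate_reflect hysym hz t)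
  have hzs : ∀ t, Summable fun k => ‖z k t‖ ^ 2 := fun t =>
    ellSq_ne_top_iff.mp (ne_top_of_le_ne_top (ellSq_coe_ne_top z) (ellSq_eval_le z t))
  have hz0 : ∀ t, z 0 t = 0 := fun t => by
    rw [← hzfix, F.flow.rhs_apply_zero]; rfl
  have hex : ∀ t : ℝ≥0, ∃ U, MemH U ∧ F.modesAt t U = fun k => z k t := fun t =>
    exists_memH_modes_eq F.s_gt F.regularity_gt (F.radius_pos t.coe_nonneg) (hzs t) (hz0 t)
      (hzsym t)
  choose U hUH hUz using hex
  have hU0 : ∀ t, vcoef (U t) 0 = 0 := fun t => ((memH_iff _).mp (hUH t)).1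
  have hUs : ∀ t, Summable fun k => ‖F.modesAt t (U t) k‖ ^ 2 := fun t => by
    rw [hUz]; exact hzs t
  refine ⟨U, ⟨?_, ⟨hUH, fun t => ?_, F.tendsto_gevreyDistSq hU0 hUz⟩, ?_⟩, ?_⟩
  · refine hfield_ext_modes (hU0 0) hU₀0 ((hUz 0).trans (Eq.trans ?_ hyU))
    funext k
    rw [← hzfix]
    exact F.flow.rhs_apply_time_zero y hy0 z k
  · exact memGevrey_of_summable (hU0 t) ha (F.radius_pos t.coe_nonneg).le (hUs t)
  · refine (F.solvesRandomPDE_iff hUH hUs).mpr fun k t => ?_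
    simp only [hUz]
    have h := F.flow.hasDerivWithinAt_rhs y z k t
    rwa [hzfix] at h
  -- The weights decrease in time because the radius grows, so they are admissible in the energy
  -- estimate, and the weighted energy is the squared Gevrey norm.
  · have h := hzmono (fun k τ => gevreyWeight F.s (F.σ * F.s) (F.radius τ) k) _
      F.hasDerivAt_gevreyWeight (fun k τ => ?_) (fun k τ _ => one_le_gevreyWeight _ _ _ _)
      fun k τ hτ => gevreyWeight_le_two ha (F.radius_pos hτ).le k
    · have hterm : ∀ t : ℝ≥0, ∑' k, gevreyTerm F.σ F.s (F.radius t) (U t) k =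
          ∑' k, gevreyWeight F.s (F.σ * F.s) (F.radius t) k * ‖z k t‖ ^ 2 := fun t =>
        tsum_congr fun k => by
          rw [gevreyTerm_eq (hU0 t)]
          rw [show modes F.s (F.σ * F.s) (F.radius t) (U t) k = z k t from congrFun (hUz t) k]
      intro t t' htt'
      simp only [gevreyNorm, hterm]
      exact Real.sqrt_le_sqrt (h htt')
    · have h1 := mul_nonneg F.β_pos.le
        (mul_nonneg zero_le_two (freqNorm_rpow_nonneg k F.s))
      exact mul_nonpos_of_nonpos_of_nonneg
        (mul_nonpos_of_nonneg_of_nonpos (Real.exp_pos _).le (neg_nonpos.mpr h1)) (sq_nonneg _)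

end FlowData

end HydrostaticEuler

end

/-! ### The main theorem -/

theorem proposition3p4 (s σ : ℝ) (hs : 4 / 5 < s) (hs1 : s ≤ 1)
    (hσ : 8 / (5 * s) < σ) (hσ2 : σ < 2) :
    ∃ Cstar : ℝ, 0 < Cstar ∧
      ∀ (ν α β η : ℝ), 0 < ν → 0 < α → 0 < β → β < ν ^ 2 / 2 → 0 < η →
      ∀ U₀ : HydrostaticEuler.HField,
        HydrostaticEuler.MemH U₀ →
        HydrostaticEuler.MemGevrey σ s (α + η) U₀ →
        HydrostaticEuler.gevreyNorm σ s (α + η) U₀ < 1 / Cstar * (ν ^ 2 / 2 - β) →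
        ∀ ω ∈ HydrostaticEuler.goodPaths α β ν,
          ∃ U : ℝ≥0 → HydrostaticEuler.HField,
            HydrostaticEuler.IsGlobalSolution ν σ s (fun t => α + β * t + η) ω U₀ U ∧
            (∀ U' : ℝ≥0 → HydrostaticEuler.HField,
              HydrostaticEuler.IsGlobalSolution ν σ s (fun t => α + β * t + η) ω U₀ U' →
                U' = U) ∧
            Antitone (fun t : ℝ≥0 => HydrostaticEuler.gevreyNorm σ s (α + β * t + η) (U t)) := by
  have hC : 0 < 16 * HydrostaticEuler.convConst := by
    have := HydrostaticEuler.convConst_pos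
    positivity
  -- The contraction needs `8c‖x₀‖ ≤ 1` with `c = 2C/κ`, hence `16C`. The constant `C` comes from
  -- the kernel alone and depends neither on `σ` nor on `s`.
  refine ⟨16 * HydrostaticEuler.convConst, hC, ?_⟩
  intro ν α β η _ hα hβ hβν hη U₀ hU₀ hG hsmall ω hω
  let F : HydrostaticEuler.FlowData :=
    ⟨s, σ, ν, α, β, η, ω, hs, hs1, hσ, hσ2, hα, hβ, hβν, hη, hω⟩
  obtain ⟨U, hU, hmono⟩ := F.exists_globalSolution hU₀ hG (by
    rw [one_div, inv_mul_eq_div, lt_div_iff₀ hC] at hsmall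
    rw [mul_comm]
    exact hsmall.le)
  exact ⟨U, hU, fun U' hU' => F.unique_globalSolution hU hU', hmono⟩
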